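/- Let $G$ be a linear connected reductive group, i.e. a closed connected group of complex invertible $n\times n$ matrices that is stable under conjugate transpose. Put $K=G\cap U(n)$, let $\mathfrak g=\mathfrak k\oplus\mathfrak p$ be the Cartan decomposition of its Lie algebra ($\mathfrak p$ being the Hermitian matrices in $\mathfrak g$), and fix a maximal abelian subspace $\mathfrak a$ of $\mathfrak p$. View $\mathfrak a^\star$ as the subspace of $\mathfrak p^\star$ of functionals vanishing on the orthogonal complement of $\mathfrak a$ for the inner product $\operatorname{Re}\operatorname{tr}(XY)$ on $\mathfrak p$. Write $\mathrm{Ad}^\star$ for the coadjoint action of $K$ on $\mathfrak p^\star$. Let $(\chi,\mu)$ be a Mackey parameter: $\chi\in\mathfrak p^\star$, and $\mu$ is a continuous irreducible representation, on a finite-dimensional space $V_\mu$ with invariant inner product, of the stabilizer $K_\chi$ of $\chi$ in $K$. Assume that $\chi$ lies in $\mathfrak a^\star$ and is regular (not orthogonal to any root of $(\mathfrak g,\mathfrak a)$), so that $K_\chi=M:=Z_K(\mathfrak a)$. For $t>0$ let $G_t$ be the group with underlying set $K\times\mathfrak p$ for which $\varphi_t:(k,v)\mapsto\exp_G(tv)k$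 is an isomorphism onto $G$, and let $\mathfrak g_t$ be its Lie algebra. Identify $k \in K$ with $(k,0)\in G_t$. Fix a Weyl chamber in $\mathfrak a$; for the corresponding ordering let $\mathfrak n_t$ be the sum of the root spaces of the positive roots of $(\mathfrak g_t,\mathfrak a)$, let $N_t=\exp_{G_t}(\mathfrak n_t)$, let $\rho_t$ be the half-sum of these roots counted with multiplicity, and let $\kappa_t:G_t\to K$, $\mathbf a_t:G_t\to\mathfrak a$ be the Iwasawa projections, $\gamma\in\kappa_t(\gamma)\exp_{G_t}(\mathbf a_t(\gamma))N_t$. Let $$\mathbf E=\{f\in L^2(K,V_\mu):\ f(um)=\mu(m)^{-1}f(u)\ \text{for all } m\in M \text{ and almost all } u\in K\},$$ let $\pi_t(\gamma)$, $\gamma\in G_t$, be the operators $$[\pi_t(\gamma)f](u)=e^{\langle -i\chi-\rho_t,\ \mathbf a_t(\gamma^{-1}u)\rangle}\,f(\kappa_t(\gamma^{-1}u))$$ of the principal series representation of $G_t$ with continuous parameter $\chi$ in the compact picture, and let $$[\pi_0(k,v)f](u)=e^{i\langle \mathrm{Ad}^\star(u)\chi,\,v\rangle}f(k^{-1}u)$$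 be the operators of the representation $\mathbf M_0(\chi,\mu)$ of the Cartan motion group $G_0=K\ltimes\mathfrak p$. Fix $(k,v)\in K\times\mathfrak p$. Then $\pi_t(k,v)$ $(t>0)$ and $\pi_0(k,v)$ are well-defined maps from $\mathbf E$ to $\mathbf E$, and $\pi_0(k,v)$ preserves the space of $f\in L^2(K,V_\mu)$ with $f(um)=\mu(m)^{-1}f(u)$ for all $m\in K_\chi$ and almost all $u\in K$. Moreover: 1. for every $f\in\mathbf E$, $\pi_t(k,v)f\to\pi_0(k,v)f$ in $L^2(K,V_\mu)$ as $t\to0^+$; 2. for every continuous $f\in\mathbf E$, the functions $\pi_t(k,v)f$ $(t>0)$ and $\pi_0(k,v)f$ are continuous on $K$, and $\pi_t(k,v)f\to\pi_0(k,v)f$ uniformly on $K$ as $t\to0^+$. -/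

import Mathlib

open Filter Topology MeasureTheory

theorem norm_pow_sub_pow_le_aux {A : Type*} [NormedRing A] [NormOneClass A] (a b : A) (M : ℝ)
    (hM : 1 ≤ M) (ha : ‖a‖ ≤ M) (hb : ‖b‖ ≤ M) (k : ℕ) :
    ‖a ^ k - b ^ k‖ ≤ k * M ^ k * ‖a - b‖ := by
  induction k with
  | zero => simp
  | succ k ih =>
    have e : a ^ (k + 1) - b ^ (k + 1) = a ^ k * (a - b) + (a ^ k - b ^ k) * b := by
      rw [pow_succ, pow_succ]; noncomm_ring
    have h1 : ‖a ^ k‖ ≤ M ^ k :=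
      (norm_pow_le a k).trans (pow_le_pow_left₀ (norm_nonneg _) ha k)
    have h2 : M ^ k ≤ M ^ (k + 1) := pow_le_pow_right₀ hM (Nat.le_succ k)
    have hM0 : 0 ≤ M := by linarith
    calc ‖a ^ (k + 1) - b ^ (k + 1)‖
        ≤ ‖a ^ k‖ * ‖a - b‖ + ‖a ^ k - b ^ k‖ * ‖b‖ := by
          rw [e]
          exact (norm_add_le _ _).trans (add_le_add (norm_mul_le _ _) (norm_mul_le _ _))
      _ ≤ M ^ (k + 1) * ‖a - b‖ + (k * M ^ k * ‖a - b‖) * M := by gcongr; exact h1.trans h2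
      _ = ((k + 1 : ℕ) : ℝ) * M ^ (k + 1) * ‖a - b‖ := by push_cast; ring

theorem tendsto_pow_sub_pow_aux {A : Type*} [NormedRing A] [NormOneClass A] [NormedAlgebra ℝ A]
    {p q : ℝ → A} {Z : A} (hp : HasDerivAt p Z 0) (hq : HasDerivAt q Z 0)
    (hp0 : p 0 = 1) (hq0 : q 0 = 1) :
    Tendsto (fun m : ℕ => p ((m : ℝ)⁻¹) ^ m - q ((m : ℝ)⁻¹) ^ m) atTop (𝓝 0) := by
  have hinv : Tendsto (fun m : ℕ => ((m : ℝ)⁻¹)) atTop (𝓝[≠] 0) := by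
    rw [tendsto_nhdsWithin_iff]
    refine ⟨tendsto_inv_atTop_zero.comp tendsto_natCast_atTop_atTop, ?_⟩
    filter_upwards [eventually_gt_atTop 0] with m hm
    simp; omega
  have slope : ∀ {r : ℝ → A} {W : A}, HasDerivAt r W 0 →
      Tendsto (fun m : ℕ => ‖(m : ℝ) • (r ((m : ℝ)⁻¹) - r 0)‖) atTop (𝓝 ‖W‖) := by
    intro r W h
    have := (h.tendsto_slope_zero.comp hinv).norm
    simpa [Function.comp_def] using this
  have bd : ∀ {r : ℝ → A}, HasDerivAt r Z 0 → r 0 = 1 →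
      ∀ᶠ m : ℕ in atTop, ‖r ((m : ℝ)⁻¹)‖ ≤ 1 + (‖Z‖ + 1) / m := by
    intro r h h0
    filter_upwards [(slope h).eventually (gt_mem_nhds (lt_add_one ‖Z‖)), eventually_gt_atTop 0]
      with m hm hm0
    have hm0' : (0 : ℝ) < m := by exact_mod_cast hm0
    rw [norm_smul, h0] at hm
    have h3 : ‖r ((m : ℝ)⁻¹) - 1‖ ≤ (‖Z‖ + 1) / m := by
      rw [le_div_iff₀ hm0']
      have : ‖(m : ℝ)‖ = m := by simp
      rw [this] at hm; linarith
    calc ‖r ((m : ℝ)⁻¹)‖ = ‖1 + (r ((m : ℝ)⁻¹) - 1)‖ := by congr 1; abel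
      _ ≤ ‖(1 : A)‖ + ‖r ((m : ℝ)⁻¹) - 1‖ := norm_add_le _ _
      _ ≤ _ := by rw [norm_one]; linarith
  have hd := slope (hp.sub hq)
  simp only [sub_self, norm_zero, Pi.sub_apply, hp0, hq0, sub_zero] at hd
  have hd' : Tendsto (fun m : ℕ => Real.exp (‖Z‖ + 1) *
      ‖(m : ℝ) • (p ((m : ℝ)⁻¹) - q ((m : ℝ)⁻¹))‖) atTop (𝓝 0) := by
    simpa using hd.const_mul (Real.exp (‖Z‖ + 1))
  refine squeeze_zero_norm' ?_ hd'
  filter_upwards [bd hp hp0, bd hq hq0, eventually_gt_atTop 0] with m h1 h2 hm0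
  have hm0' : (0 : ℝ) < m := by exact_mod_cast hm0
  have hc : 0 ≤ (‖Z‖ + 1) / m := by positivity
  refine (norm_pow_sub_pow_le_aux _ _ _ (by linarith) h1 h2 m).trans ?_
  have h4 : (1 + (‖Z‖ + 1) / m) ^ m ≤ Real.exp (‖Z‖ + 1) := by
    calc (1 + (‖Z‖ + 1) / m) ^ m ≤ (Real.exp ((‖Z‖ + 1) / m)) ^ m := by
          gcongr; linarith [Real.add_one_le_exp ((‖Z‖ + 1) / m)]
      _ = Real.exp (‖Z‖ + 1) := by
          rw [← Real.exp_nat_mul]; congr 1; field_simp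
  rw [norm_smul]
  have : ‖(m : ℝ)‖ = m := by simp
  rw [this]
  calc (m : ℝ) * (1 + (‖Z‖ + 1) / m) ^ m * ‖p ((m : ℝ)⁻¹) - q ((m : ℝ)⁻¹)‖
      ≤ m * Real.exp (‖Z‖ + 1) * ‖p ((m : ℝ)⁻¹) - q ((m : ℝ)⁻¹)‖ := by gcongr
    _ = _ := by ring

theorem tendsto_exp_mul_exp_pow_aux {A : Type*} [NormedRing A] [NormOneClass A]
    [NormedAlgebra ℝ A] [CompleteSpace A] (X Y : A) :
    Tendsto (fun m : ℕ =>
      (NormedSpace.exp ((m : ℝ)⁻¹ • X) * NormedSpace.exp ((m : ℝ)⁻¹ • Y)) ^ m)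
      atTop (𝓝 (NormedSpace.exp (X + Y))) := by
  have hX : ∀ W : A, HasDerivAt (fun s : ℝ => NormedSpace.exp (s • W)) W 0 := by
    intro W
    have := hasDerivAt_exp_smul_const (𝕂 := ℝ) W 0
    simpa using this
  have hp : HasDerivAt (fun s : ℝ => NormedSpace.exp (s • X) * NormedSpace.exp (s • Y))
      (X + Y) 0 := by
    simpa [Pi.mul_def] using (hX X).mul (hX Y)
  have key := tendsto_pow_sub_pow_aux hp (hX (X + Y)) (by simp) (by simp)
  have hc : Tendsto (fun m : ℕ => NormedSpace.exp ((m : ℝ)⁻¹ • (X + Y)) ^ m) atTop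
      (𝓝 (NormedSpace.exp (X + Y))) := by
    refine tendsto_const_nhds.congr' ?_
    filter_upwards [eventually_gt_atTop 0] with m hm
    let _ : NormedAlgebra ℚ A := NormedAlgebra.restrictScalars ℚ ℝ A
    rw [← NormedSpace.exp_nsmul, ← Nat.cast_smul_eq_nsmul ℝ, smul_smul,
      mul_inv_cancel₀ (by exact_mod_cast hm.ne'), one_smul]
  simpa using key.add hc

theorem Matrix.tendsto_exp_mul_exp_pow {n : ℕ} (X Y : Matrix (Fin n) (Fin n) ℂ) :
    Tendsto (fun m : ℕ =>
      (NormedSpace.exp ((m : ℝ)⁻¹ • X) * NormedSpace.exp ((m : ℝ)⁻¹ • Y)) ^ m)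
      atTop (𝓝 (NormedSpace.exp (X + Y))) := by
  rcases n with _ | n
  · convert tendsto_const_nhds using 1
    exact Subsingleton.elim _ _
  · let _ : NormedRing (Matrix (Fin (n+1)) (Fin (n+1)) ℂ) := Matrix.linftyOpNormedRing
    let _ : NormedAlgebra ℝ (Matrix (Fin (n+1)) (Fin (n+1)) ℂ) := Matrix.linftyOpNormedAlgebra
    have : NormOneClass (Matrix (Fin (n+1)) (Fin (n+1)) ℂ) := Matrix.linfty_opNormOneClass
    exact tendsto_exp_mul_exp_pow_aux X Y

/-- The exponential of a complex matrix, as an invertible matrix. -/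
noncomputable def expGL {n : ℕ} (X : Matrix (Fin n) (Fin n) ℂ) : GL (Fin n) ℂ :=
  (Matrix.isUnit_exp X).unit

theorem expGL_val {n : ℕ} (X : Matrix (Fin n) (Fin n) ℂ) :
    (expGL X : Matrix (Fin n) (Fin n) ℂ) = NormedSpace.exp X :=
  (Matrix.isUnit_exp X).unit_spec

theorem tendsto_expGL_mul_expGL_pow {n : ℕ} (X Y : Matrix (Fin n) (Fin n) ℂ) :
    Tendsto (fun m : ℕ => (expGL ((m : ℝ)⁻¹ • X) * expGL ((m : ℝ)⁻¹ • Y)) ^ m)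
      atTop (𝓝 (expGL (X + Y))) := by
  have hemb : Topology.IsEmbedding
      (Units.val : GL (Fin n) ℂ → Matrix (Fin n) (Fin n) ℂ) := by
    let _ : NormedRing (Matrix (Fin n) (Fin n) ℂ) := Matrix.linftyOpNormedRing
    let _ : NormedAlgebra ℝ (Matrix (Fin n) (Fin n) ℂ) := Matrix.linftyOpNormedAlgebra
    have : CompleteSpace (Matrix (Fin n) (Fin n) ℂ) := FiniteDimensional.complete ℝ _
    exact Units.isOpenEmbedding_val.isEmbedding
  rw [hemb.tendsto_nhds_iff]
  simpa [Function.comp_def, expGL_val] using Matrix.tendsto_exp_mul_exp_pow X Y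

theorem expGL_star {n : ℕ} (X : Matrix (Fin n) (Fin n) ℂ) :
    expGL (star X) = star (expGL X) := by
  apply Units.ext
  rw [Units.coe_star, expGL_val, expGL_val]
  exact Matrix.exp_conjTranspose X

theorem expGL_conj {n : ℕ} (k : GL (Fin n) ℂ) (X : Matrix (Fin n) (Fin n) ℂ) :
    expGL (k.val * X * k.inv) = k * expGL X * k⁻¹ := by
  apply Units.ext
  simp only [Units.val_mul, expGL_val]
  exact Matrix.exp_units_conj k X

/-- A linear connected reductive group: a closed connected group of complex invertible matrices
which is stable under conjugate transpose.  (Groups of real matrices are included, as they are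
groups of complex matrices.) -/
structure LinearReductiveGroup (n : ℕ) where
  toSubgroup : Subgroup (GL (Fin n) ℂ)
  isClosed : IsClosed (toSubgroup : Set (GL (Fin n) ℂ))
  isConnected : IsConnected (toSubgroup : Set (GL (Fin n) ℂ))
  star_mem : ∀ g ∈ toSubgroup, star g ∈ toSubgroup

namespace LinearReductiveGroup

variable {n : ℕ} (G : LinearReductiveGroup n)

/-- The Lie algebra `𝔤` of `G`, consisting of the matrices `X` with `exp (s X) ∈ G` for all real
`s`. -/
noncomputable def lieAlg : Submodule ℝ (Matrix (Fin n) (Fin n) ℂ) where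
  carrier := {X | ∀ s : ℝ, expGL (s • X) ∈ G.toSubgroup}
  zero_mem' := fun s => by
    have : expGL (s • (0 : Matrix (Fin n) (Fin n) ℂ)) = 1 := by
      apply Units.ext
      simp [expGL_val]
    rw [this]
    exact G.toSubgroup.one_mem
  add_mem' := fun {X Y} hX hY s => by
    rw [smul_add]
    refine G.isClosed.mem_of_tendsto (tendsto_expGL_mul_expGL_pow (s • X) (s • Y))
      (Eventually.of_forall fun m => ?_)
    rw [smul_smul, smul_smul]
    exact G.toSubgroup.pow_mem (G.toSubgroup.mul_mem (hX _) (hY _)) m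
  smul_mem' := fun c X hX s => by
    rw [smul_smul]
    exact hX _

/-- The maximal compact subgroup `K = G ∩ U(n)`. -/
def K : Subgroup (GL (Fin n) ℂ) where
  carrier := {g | g ∈ G.toSubgroup ∧ star g = g⁻¹}
  one_mem' := ⟨G.toSubgroup.one_mem, by simp⟩
  mul_mem' := fun {a b} ha hb =>
    ⟨G.toSubgroup.mul_mem ha.1 hb.1, by rw [star_mul, ha.2, hb.2, mul_inv_rev]⟩
  inv_mem' := fun {a} ha => ⟨G.toSubgroup.inv_mem ha.1, by rw [star_inv, ha.2]⟩

/-- The space `𝔭` of Hermitian matrices in `𝔤`; the Cartan decomposition is `𝔤 = 𝔨 ⊕ 𝔭` where `𝔨`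
is the space of skew-Hermitian matrices in `𝔤`. -/
noncomputable def p : Submodule ℝ (Matrix (Fin n) (Fin n) ℂ) where
  carrier := {X | X ∈ G.lieAlg ∧ star X = X}
  zero_mem' := ⟨G.lieAlg.zero_mem, star_zero _⟩
  add_mem' := fun {X Y} hX hY => ⟨G.lieAlg.add_mem hX.1 hY.1, by rw [star_add, hX.2, hY.2]⟩
  smul_mem' := fun c X hX => ⟨G.lieAlg.smul_mem c hX.1, by rw [star_smul, hX.2, star_trivial]⟩

theorem conj_mem_p (k : G.K) (X : G.p) :
    (k : GL (Fin n) ℂ).val * (X : Matrix (Fin n) (Fin n) ℂ) * (k : GL (Fin n) ℂ).inv ∈ G.p := by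
  refine ⟨fun s => ?_, ?_⟩
  · have : s • ((k : GL (Fin n) ℂ).val * (X : Matrix (Fin n) (Fin n) ℂ) *
        (k : GL (Fin n) ℂ).inv) =
        (k : GL (Fin n) ℂ).val * (s • (X : Matrix (Fin n) (Fin n) ℂ)) *
          (k : GL (Fin n) ℂ).inv := by
      simp
    rw [this, expGL_conj]
    exact G.toSubgroup.mul_mem (G.toSubgroup.mul_mem k.2.1 (X.2.1 s))
      (G.toSubgroup.inv_mem k.2.1)
  · have h1 : star (k : GL (Fin n) ℂ).val = (k : GL (Fin n) ℂ).inv :=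
      congrArg Units.val k.2.2
    rw [← h1, star_mul, star_mul, star_star, X.2.2, mul_assoc]

/-- The adjoint action of `K` on `𝔭`, `Ad(k) X = k X k⁻¹`. -/
noncomputable def Ad (k : G.K) : G.p →ₗ[ℝ] G.p where
  toFun X := ⟨(k : GL (Fin n) ℂ).val * (X : Matrix (Fin n) (Fin n) ℂ) *
    (k : GL (Fin n) ℂ).inv, G.conj_mem_p k X⟩
  map_add' X Y := by
    apply Subtype.ext
    simp [mul_add, add_mul]
  map_smul' c X := by
    apply Subtype.ext
    simp

theorem Ad_one : G.Ad 1 = LinearMap.id := by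
  ext X : 2
  change (1 : Matrix (Fin n) (Fin n) ℂ) * X * 1 = X
  simp

theorem Ad_mul (k l : G.K) : G.Ad (k * l) = G.Ad k ∘ₗ G.Ad l := by
  ext X : 2
  change ((k : GL (Fin n) ℂ) * (l : GL (Fin n) ℂ)).val * (X : Matrix (Fin n) (Fin n) ℂ) *
    ((k : GL (Fin n) ℂ) * (l : GL (Fin n) ℂ)).inv = (k : GL (Fin n) ℂ).val *
    ((l : GL (Fin n) ℂ).val * (X : Matrix (Fin n) (Fin n) ℂ) * (l : GL (Fin n) ℂ).inv) *
    (k : GL (Fin n) ℂ).inv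
  have : ((k : GL (Fin n) ℂ) * (l : GL (Fin n) ℂ)).inv =
    (l : GL (Fin n) ℂ).inv * (k : GL (Fin n) ℂ).inv := rfl
  rw [this, Units.val_mul]
  simp only [mul_assoc]

/-- The coadjoint action of `K` on the dual `𝔭*`, `(Ad*(k) χ)(X) = χ(Ad(k⁻¹) X)`. -/
noncomputable def coAd (k : G.K) (χ : Module.Dual ℝ G.p) : Module.Dual ℝ G.p :=
  χ ∘ₗ G.Ad k⁻¹

/-- The stabilizer `K_χ` of `χ ∈ 𝔭*` in `K`. -/
noncomputable def stab (χ : Module.Dual ℝ G.p) : Subgroup G.K where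
  carrier := {k | G.coAd k χ = χ}
  one_mem' := by
    change χ ∘ₗ G.Ad 1⁻¹ = χ
    rw [inv_one, Ad_one, LinearMap.comp_id]
  mul_mem' := fun {a b} (ha : χ ∘ₗ G.Ad a⁻¹ = χ) (hb : χ ∘ₗ G.Ad b⁻¹ = χ) => by
    change χ ∘ₗ G.Ad (a * b)⁻¹ = χ
    rw [mul_inv_rev, Ad_mul, ← LinearMap.comp_assoc, hb, ha]
  inv_mem' := fun {a} (ha : χ ∘ₗ G.Ad a⁻¹ = χ) => by
    change χ ∘ₗ G.Ad a⁻¹⁻¹ = χ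
    nth_rewrite 1 [← ha]
    rw [LinearMap.comp_assoc, ← Ad_mul, mul_inv_cancel, Ad_one, LinearMap.comp_id]

/-- A Mackey parameter `(χ, μ)`: an element `χ` of `𝔭*` and an irreducible continuous
representation `μ` of the compact group `K_χ`, on a finite-dimensional space `V` whose inner
product is invariant. -/
structure MackeyParameter (V : Type*) [NormedAddCommGroup V] [InnerProductSpace ℂ V] where
  χ : Module.Dual ℝ G.p
  μ : Representation ℂ (G.stab χ) V
  irreducible : μ.IsIrreducible
  continuous : ∀ x : V, Continuous fun m => μ m x
  unitary : ∀ (m : G.stab χ) (x y : V), inner ℂ (μ m x) (μ m y) = inner ℂ x y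

/-! ### The groups `G_t` -/

/-- The map `φ_t : K × 𝔭 → G ⊆ GL(n, ℂ)`, `φ_t (k, v) = exp (t v) k`.  For `t ≠ 0` it is a
bijection onto `G`. -/
noncomputable def phi (t : ℝ) (x : G.K × G.p) : GL (Fin n) ℂ :=
  expGL (t • (x.2 : Matrix (Fin n) (Fin n) ℂ)) * (x.1 : GL (Fin n) ℂ)

/-- The inverse `φ_t⁻¹ : G → K × 𝔭`. -/
noncomputable def phiInv (t : ℝ) : GL (Fin n) ℂ → G.K × G.p :=
  Function.invFun (G.phi t)

/-- The product of the group `G_t`, whose underlying set is `K × 𝔭`. -/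
noncomputable def mul (t : ℝ) (x y : G.K × G.p) : G.K × G.p :=
  G.phiInv t (G.phi t x * G.phi t y)

/-- The inverse in the group `G_t`. -/
noncomputable def inv (t : ℝ) (x : G.K × G.p) : G.K × G.p :=
  G.phiInv t (G.phi t x)⁻¹

/-- The derivative of `φ_t` at the identity: the linear map which is the identity on
skew-Hermitian matrices and multiplication by `t` on Hermitian matrices.  Its inverse, for
`t ≠ 0`, is `dphi t⁻¹`. -/
noncomputable def dphi (n : ℕ) (t : ℝ) :
    Matrix (Fin n) (Fin n) ℂ →ₗ[ℝ] Matrix (Fin n) (Fin n) ℂ where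
  toFun X := (1 / 2 : ℝ) • (X - star X) + t • (1 / 2 : ℝ) • (X + star X)
  map_add' X Y := by
    rw [star_add]
    module
  map_smul' c X := by
    rw [star_smul, star_trivial, RingHom.id_apply]
    module

/-- The bracket of the Lie algebra `𝔤_t` of `G_t`; the underlying vector space of `𝔤_t` is
`𝔤 = 𝔨 ⊕ 𝔭`, and `dphi t` is an isomorphism of Lie algebras from `𝔤_t` to `𝔤`. -/
noncomputable def bracket (t : ℝ) (X Y : Matrix (Fin n) (Fin n) ℂ) :
    Matrix (Fin n) (Fin n) ℂ :=
  dphi n t⁻¹ (dphi n t X * dphi n t Y - dphi n t Y * dphi n t X)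

/-- The exponential map `𝔤_t → G_t`. -/
noncomputable def expGt (t : ℝ) (X : Matrix (Fin n) (Fin n) ℂ) : G.K × G.p :=
  G.phiInv t (expGL (dphi n t X))

/-! ### Roots, and the Iwasawa decomposition of `G_t` -/

/-- `𝔞` is a maximal abelian subspace of `𝔭`. -/
def IsMaximalAbelian (𝔞 : Submodule ℝ G.p) : Prop :=
  Maximal (fun 𝔟 : Submodule ℝ G.p => ∀ X ∈ 𝔟, ∀ Y ∈ 𝔟,
    (X : Matrix (Fin n) (Fin n) ℂ) * Y = Y * X) 𝔞

variable {G} (𝔞 : Submodule ℝ G.p)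

/-- The root space `{X ∈ 𝔤_t | [H, X]_t = α(H) X for all H ∈ 𝔞}`. -/
noncomputable def rootSpace (t : ℝ) (α : Module.Dual ℝ 𝔞) :
    Submodule ℝ (Matrix (Fin n) (Fin n) ℂ) where
  carrier := {X | X ∈ G.lieAlg ∧
    ∀ H : 𝔞, bracket t ((H : G.p) : Matrix (Fin n) (Fin n) ℂ) X = α H • X}
  zero_mem' := ⟨G.lieAlg.zero_mem, fun H => by simp [bracket]⟩
  add_mem' := fun {X Y} hX hY => ⟨G.lieAlg.add_mem hX.1 hY.1, fun H => by
    rw [smul_add, ← hX.2 H, ← hY.2 H]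
    simp only [bracket, ← map_add]
    congr 1
    simp only [map_add]
    noncomm_ring⟩
  smul_mem' := fun c X hX => ⟨G.lieAlg.smul_mem c hX.1, fun H => by
    rw [smul_comm, ← hX.2 H]
    simp only [bracket, ← map_smul]
    congr 1
    simp only [map_smul, mul_smul_comm, smul_mul_assoc, smul_sub]⟩

/-- `α ∈ 𝔞*` is a root of `(𝔤_t, 𝔞)`.  The roots of `(𝔤, 𝔞)` are those for `t = 1`. -/
def IsRoot (t : ℝ) (α : Module.Dual ℝ 𝔞) : Prop :=
  α ≠ 0 ∧ rootSpace 𝔞 t α ≠ ⊥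

/-- `χ ∈ 𝔭*` lies in `𝔞*` and is regular there.  Here `𝔞*` is the subspace of `𝔭*` consisting of
the linear functionals which vanish on the orthogonal complement of `𝔞` in `𝔭`, i.e. those of the
form `X ↦ ⟨H, X⟩` with `H ∈ 𝔞`, for the inner product `⟨X, Y⟩ = Re tr (X Y)` on `𝔭`;
and `χ` is regular if it is not orthogonal to any root, i.e. if `α(H) ≠ 0` for every root `α`. -/
def IsRegular (χ : Module.Dual ℝ G.p) : Prop :=
  ∃ H : 𝔞, (∀ X : G.p, χ X =
      (Matrix.trace (((H : G.p) : Matrix (Fin n) (Fin n) ℂ) *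
        (X : Matrix (Fin n) (Fin n) ℂ))).re) ∧
    ∀ α : Module.Dual ℝ 𝔞, IsRoot 𝔞 1 α → α H ≠ 0

/-- `H₀ ∈ 𝔞` lies in an open Weyl chamber, and therefore defines an ordering, for which a root
`α` is positive when `α(H₀) > 0`. -/
def IsChamberElement (H₀ : 𝔞) : Prop :=
  ∀ α : Module.Dual ℝ 𝔞, IsRoot 𝔞 1 α → α H₀ ≠ 0

/-- The positive roots of `(𝔤_t, 𝔞)` for the ordering defined by `H₀`. -/
def posRoots (H₀ : 𝔞) (t : ℝ) : Set (Module.Dual ℝ 𝔞) :=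
  {α | IsRoot 𝔞 t α ∧ 0 < α H₀}

/-- The Lie algebra `𝔫_t` of `N_t`, the sum of the root spaces for the positive roots. -/
noncomputable def nilp (H₀ : 𝔞) (t : ℝ) : Submodule ℝ (Matrix (Fin n) (Fin n) ℂ) :=
  ⨆ α ∈ posRoots 𝔞 H₀ t, rootSpace 𝔞 t α

/-- `ρ_t`, the half-sum of the positive roots of `(𝔤_t, 𝔞)`, counted with multiplicities. -/
noncomputable def rho (H₀ : 𝔞) (t : ℝ) : Module.Dual ℝ 𝔞 :=
  (1 / 2 : ℝ) • ∑ᶠ α ∈ posRoots 𝔞 H₀ t, (Module.finrank ℝ (rootSpace 𝔞 t α) : ℝ) • α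

/-- The group `M = Z_K(𝔞)`. -/
noncomputable def M : Subgroup G.K where
  carrier := {k | ∀ H ∈ 𝔞, G.Ad k H = H}
  one_mem' := fun H _ => by rw [Ad_one, LinearMap.id_apply]
  mul_mem' := fun {a b} ha hb H hH => by
    rw [Ad_mul, LinearMap.comp_apply, hb H hH, ha H hH]
  inv_mem' := fun {a} ha H hH => by
    nth_rewrite 1 [← ha H hH]
    rw [← LinearMap.comp_apply, ← Ad_mul, inv_mul_cancel, Ad_one, LinearMap.id_apply]

/-- The Iwasawa projections `γ ↦ (κ_t(γ), 𝐚_t(γ)) ∈ K × 𝔞` of `G_t`, for the minimal parabolic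
subgroup `M A_t N_t`: one has `γ = κ_t(γ) exp(𝐚_t(γ)) ν` in `G_t`, with `ν ∈ N_t = exp 𝔫_t`. -/
noncomputable def iwasawa (H₀ : 𝔞) (t : ℝ) (γ : G.K × G.p) : G.K × 𝔞 :=
  Classical.epsilon fun q => ∃ Y ∈ nilp 𝔞 H₀ t,
    γ = G.mul t (G.mul t (q.1, 0) (G.expGt t ((q.2 : G.p) : Matrix (Fin n) (Fin n) ℂ)))
      (G.expGt t Y)

/-! ### The representations -/

namespace MackeyParameter

variable {V : Type*} [NormedAddCommGroup V] [InnerProductSpace ℂ V] (δ : G.MackeyParameter V)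

/-- The carrier space of `M₀(χ, μ)`: the functions `f ∈ L²(K, V)` such that
`f(um) = μ(m)⁻¹ f(u)` for `m ∈ K_χ`. -/
def InH [MeasurableSpace G.K] (ν : Measure G.K) (f : G.K → V) : Prop :=
  MemLp f 2 ν ∧ ∀ m : G.stab δ.χ, ∀ᵐ u ∂ν, f (u * (m : G.K)) = δ.μ m⁻¹ (f u)

/-- The carrier space `E` of the compact picture of the principal series: the functions
`f ∈ L²(K, V)` such that `f(um) = μ(m)⁻¹ f(u)` for `m ∈ M`.  (If `χ` lies in `𝔞*` then
`M ⊆ K_χ`, and if it is regular then `M = K_χ`.) -/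
def InE [MeasurableSpace G.K] (ν : Measure G.K) (f : G.K → V) : Prop :=
  MemLp f 2 ν ∧ ∀ m : G.stab δ.χ, (m : G.K) ∈ M 𝔞 →
    ∀ᵐ u ∂ν, f (u * (m : G.K)) = δ.μ m⁻¹ (f u)

/-- The operator `π₀(k, v)` of the representation `M₀(χ, μ)` of `G₀`:
`(π₀(k, v) f)(u) = exp(i ⟨Ad*(u) χ, v⟩) f(k⁻¹ u)`. -/
noncomputable def piZero (x : G.K × G.p) (f : G.K → V) : G.K → V := fun u =>
  Complex.exp (Complex.I * (G.coAd u δ.χ x.2 : ℝ)) • f (x.1⁻¹ * u)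

/-- The operator `π_t(γ)` of the principal series representation of `G_t` with parameters `χ`
and `μ`, in the compact picture:
`(π_t(γ) f)(u) = exp(⟨-iχ - ρ_t, 𝐚_t(γ⁻¹ u)⟩) f(κ_t(γ⁻¹ u))`. -/
noncomputable def piT (H₀ : 𝔞) (t : ℝ) (γ : G.K × G.p) (f : G.K → V) : G.K → V := fun u =>
  let q := iwasawa 𝔞 H₀ t (G.mul t (G.inv t γ) (u, 0))
  Complex.exp (-Complex.I * (δ.χ q.2 : ℝ) - (rho 𝔞 H₀ t q.2 : ℝ)) • f q.1

end MackeyParameter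

end LinearReductiveGroup

/-! ### Logarithms of positive definite matrices -/

section HermitianLogarithm
open scoped Matrix.Norms.L2Operator ComplexOrder MatrixOrder

/-! The isomorphism `φ_t` turns every object attached to `G_t` into one attached to `G`. Its
differential multiplies `𝔞` by `t` and carries `𝔫_t` onto `𝔫`; hence, with `κ` and `𝐚` the Iwasawa
projections of `G`, one has `κ_t = κ ∘ φ_t`, `𝐚_t = t⁻¹ 𝐚 ∘ φ_t` and `ρ_t = t ρ` (`iwasawa_eq`,
`rho_eq_smul`). Moreover `φ_t(k,v)⁻¹ u = k⁻¹ u exp(-t Ad(u⁻¹)v)` (`phi_inv_mul`), and `κ(k g) = k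
κ(g)`, `𝐚(k g) = 𝐚(g)` for `k ∈ K`. Only the behaviour of `κ` and `𝐚` near the identity therefore
matters.

As `t → 0`, uniformly in `u` because `Ad(K)v` is bounded, the point of `K` tends to `k⁻¹ u`, the
`ρ`-term tends to `0`, and `t⁻¹ 𝐚(exp(-t Ad(u⁻¹)v))` tends to minus the projection of `Ad(u⁻¹)v` to
`𝔞` along `𝔨 ⊕ 𝔫`. For the form `Re tr(XY)` both `𝔨` and `𝔫` are orthogonal to `𝔞`, and `χ = Re tr(H
·)` with `H ∈ 𝔞`, so `χ` does not see the difference between `Ad(u⁻¹)v` and its projection. The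
exponent converges to `i⟨Ad*(u)χ, v⟩`. This is uniform convergence for continuous `f`
(`tendstoUniformly_piT`).

For `L²`, continuous functions are dense and `π₀(k,v)` is isometric, so it is enough that the
operators `π_t(k,v)` be uniformly bounded for `0 < t ≤ 1`. The scalar factor is bounded by
compactness. The change of variable on `K` distorts Haar measure by a bounded factor; this comes
from comparing volumes in `G` under left translation (`exists_map_le_smul_of_compact_projection`),
without computing a Jacobian.

The structure theory is derived from the definition of `G`: the local form of the closed subgroup
theorem, the Cartan decomposition by a connectedness argument on iterated square roots of `g* g`,
the diagonalisation of `ad 𝔞`, and the Iwasawa decomposition. The main tool for the latter is the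
flow `Ad(exp(-s H₀))`, which contracts `N` to the identity, fixes `exp 𝔞`, and cannot bring a
unitary matrix to a positive definite one unless both are trivial (`eq_one_of_tendsto_expFlow`). -/

theorem Matrix.exp_injective_of_isSelfAdjoint {n : ℕ} {X Y : Matrix (Fin n) (Fin n) ℂ} (hX : star X = X)
    (hY : star Y = Y) (h : NormedSpace.exp X = NormedSpace.exp Y) : X = Y := by
  rw [← CFC.log_exp X hX, ← CFC.log_exp Y hY, h]

theorem exists_continuous_log_star_mul_self (n : ℕ) :
    ∃ l : GL (Fin n) ℂ → Matrix (Fin n) (Fin n) ℂ, Continuous l ∧ (∀ g, star (l g) = l g) ∧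
      ∀ g, expGL (l g) = star g * g := by
  refine ⟨fun g => CFC.log (star g.val * g.val), ?_, fun g => IsSelfAdjoint.log, fun g => ?_⟩
  · refine CFC.continuousOn_log.comp_continuous ?_ fun g => ⟨IsSelfAdjoint.star_mul_self _, ?_⟩
    · exact (continuous_star.comp Units.continuous_val).mul Units.continuous_val
    · exact (star g * g).isUnit
  · apply Units.ext
    rw [expGL_val]
    have : IsStrictlyPositive (star g.val * g.val) :=
      (star g * g).isUnit.isStrictlyPositive (star_mul_self_nonneg _)
    exact CFC.exp_log _ this
end HermitianLogarithm

/-! ### The matrix exponential with values in `GL(n, ℂ)` -/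

section ExpGL
open scoped Matrix.Norms.Operator

variable {n : ℕ}

theorem GL.isEmbedding_val : Topology.IsEmbedding (Units.val : GL (Fin n) ℂ → Matrix (Fin n) (Fin n) ℂ) :=
  Units.isOpenEmbedding_val.isEmbedding

theorem continuous_expGL : Continuous (expGL : Matrix (Fin n) (Fin n) ℂ → GL (Fin n) ℂ) := by
  rw [GL.isEmbedding_val.continuous_iff]
  have : Continuous (NormedSpace.exp : Matrix (Fin n) (Fin n) ℂ → Matrix (Fin n) (Fin n) ℂ) :=
    NormedSpace.exp_continuous
  exact this.congr fun X => (expGL_val X).symm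

theorem expGL_zero : expGL (0 : Matrix (Fin n) (Fin n) ℂ) = 1 := by
  apply Units.ext
  simp [expGL_val]

theorem expGL_add {X Y : Matrix (Fin n) (Fin n) ℂ} (h : Commute X Y) :
    expGL (X + Y) = expGL X * expGL Y := by
  apply Units.ext
  rw [Units.val_mul, expGL_val, expGL_val, expGL_val, Matrix.exp_add_of_commute _ _ h]

theorem expGL_neg (X : Matrix (Fin n) (Fin n) ℂ) : expGL (-X) = (expGL X)⁻¹ := by
  rw [eq_inv_iff_mul_eq_one, ← expGL_add (Commute.refl X).neg_left, neg_add_cancel, expGL_zero]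

theorem expGL_add_smul (X : Matrix (Fin n) (Fin n) ℂ) (a b : ℝ) :
    expGL ((a + b) • X) = expGL (a • X) * expGL (b • X) := by
  rw [add_smul, expGL_add (((Commute.refl X).smul_left a).smul_right b)]

theorem expGL_nsmul (X : Matrix (Fin n) (Fin n) ℂ) (m : ℕ) : expGL (m • X) = expGL X ^ m := by
  induction m with
  | zero => simp [expGL_zero]
  | succ m ih => rw [succ_nsmul, expGL_add (((Commute.refl X : Commute X X)).smul_left m), ih, pow_succ]

theorem expGL_zsmul (X : Matrix (Fin n) (Fin n) ℂ) (m : ℤ) : expGL (m • X) = expGL X ^ m := by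
  obtain ⟨k, rfl | rfl⟩ := m.eq_nat_or_neg
  · rw [natCast_zsmul, expGL_nsmul, zpow_natCast]
  · rw [neg_smul, natCast_zsmul, expGL_neg, expGL_nsmul, zpow_neg, zpow_natCast]

theorem expGL_injective_of_isSelfAdjoint {X Y : Matrix (Fin n) (Fin n) ℂ} (hX : star X = X) (hY : star Y = Y)
    (h : expGL X = expGL Y) : X = Y :=
  Matrix.exp_injective_of_isSelfAdjoint hX hY <| by rw [← expGL_val, h, expGL_val]

theorem hasStrictFDerivAt_exp_zero_matrix :
    HasStrictFDerivAt (NormedSpace.exp : Matrix (Fin n) (Fin n) ℂ → Matrix (Fin n) (Fin n) ℂ)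
      (ContinuousLinearMap.id ℝ _) 0 :=
  hasStrictFDerivAt_exp_zero (𝕂 := ℝ)

theorem hasStrictFDerivAt_exp_comp {E : Type*} [NormedAddCommGroup E] [NormedSpace ℝ E]
    (A : E →L[ℝ] Matrix (Fin n) (Fin n) ℂ) :
    HasStrictFDerivAt (fun e => NormedSpace.exp (A e)) A 0 := by
  have h0 : HasStrictFDerivAt (NormedSpace.exp : Matrix (Fin n) (Fin n) ℂ → Matrix (Fin n) (Fin n) ℂ)
      (ContinuousLinearMap.id ℝ _) (A 0) := by
    rw [map_zero]; exact hasStrictFDerivAt_exp_zero_matrix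
  exact h0.comp (0 : E) A.hasStrictFDerivAt

end ExpGL

namespace LinearReductiveGroup

/-! ### Closed subgroups near the identity -/

section LocalTheory
open scoped Matrix.Norms.Operator

variable {n : ℕ} (G : LinearReductiveGroup n)

theorem expGL_mem {X : Matrix (Fin n) (Fin n) ℂ} (hX : X ∈ G.lieAlg) : expGL X ∈ G.toSubgroup := by
  simpa using hX 1

/-- The exponentials of small nonzero elements of a complement of `𝔤` are not in `G`. -/
theorem eventually_eq_zero_of_disjoint (C : Submodule ℝ (Matrix (Fin n) (Fin n) ℂ))
    (hC : Disjoint G.lieAlg C) :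
    ∀ᶠ Y in 𝓝 (0 : Matrix (Fin n) (Fin n) ℂ), Y ∈ C → expGL Y ∈ G.toSubgroup → Y = 0 := by
  by_contra hcon
  rw [Filter.not_eventually] at hcon
  have : FirstCountableTopology (Matrix (Fin n) (Fin n) ℂ) :=
    inferInstanceAs (FirstCountableTopology (Fin n → Fin n → ℂ))
  obtain ⟨y, hy, hy'⟩ := Filter.exists_seq_forall_of_frequently hcon
  push Not at hy'
  have hn : ∀ j, 0 < ‖y j‖ := fun j => norm_pos_iff.2 (hy' j).2.2
  have hsph : ∀ j, ‖y j‖⁻¹ • y j ∈ Metric.sphere (0 : Matrix (Fin n) (Fin n) ℂ) 1 := fun j => by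
    rw [mem_sphere_zero_iff_norm, norm_smul, norm_inv, norm_norm, inv_mul_cancel₀ (hn j).ne']
  have : ProperSpace (Matrix (Fin n) (Fin n) ℂ) := FiniteDimensional.proper ℝ _
  -- The directions of a sequence of counterexamples accumulate at a unit vector `Y` of `C`. It will
  -- lie in `𝔤` as well, which contradicts disjointness.
  obtain ⟨Y, hY, φ, hφ, hlim⟩ := (isCompact_sphere _ _).tendsto_subseq hsph
  have hYC : Y ∈ C := C.closed_of_finiteDimensional.mem_of_tendsto hlim
    (Eventually.of_forall fun j => C.smul_mem _ (hy' _).1)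
  have hYG : Y ∈ G.lieAlg := fun s => by
    have h0 : Tendsto (fun j => ‖y (φ j)‖) atTop (𝓝 0) := by
      simpa using (hy.comp hφ.tendsto_atTop).norm
    -- Rounding to an integer costs at most `‖y‖`, which tends to `0`. So `exp(sY)` is a limit of
    -- integer powers of the elements `exp(y j)` of `G`.
    have h1 : Tendsto (fun j => ((⌊s / ‖y (φ j)‖⌋ : ℤ) : ℝ) * ‖y (φ j)‖) atTop (𝓝 s) := by
      rw [tendsto_iff_norm_sub_tendsto_zero]
      refine squeeze_zero (fun _ => norm_nonneg _) (fun j => ?_) h0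
      have hp := hn (φ j)
      have e1 := Int.floor_le (s / ‖y (φ j)‖)
      have e2 := Int.lt_floor_add_one (s / ‖y (φ j)‖)
      rw [le_div_iff₀ hp] at e1
      rw [div_lt_iff₀ hp] at e2
      rw [Real.norm_eq_abs, abs_le]
      constructor <;> nlinarith
    have h2 : Tendsto (fun j => expGL (((⌊s / ‖y (φ j)‖⌋ : ℤ) : ℝ) • y (φ j))) atTop
        (𝓝 (expGL (s • Y))) := by
      refine (continuous_expGL.tendsto _).comp ((h1.smul hlim).congr fun j => ?_)
      simp only [Function.comp_apply]
      rw [smul_smul, mul_assoc, mul_inv_cancel₀ (hn _).ne', mul_one]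
    refine G.isClosed.mem_of_tendsto h2 (Eventually.of_forall fun j => ?_)
    rw [Int.cast_smul_eq_zsmul, expGL_zsmul]
    exact G.toSubgroup.zpow_mem (hy' _).2.1 _
  have : Y = 0 := Submodule.disjoint_def.1 hC Y hYG hYC
  rw [this, mem_sphere_zero_iff_norm, norm_zero] at hY
  exact zero_ne_one hY

/-- A parametrisation of `G` with bijective differential `E → 𝔤` at the identity has a local inverse
which is differentiable, as a function of matrices. -/
theorem exists_local_inverse {E : Type*} [NormedAddCommGroup E] [NormedSpace ℝ E] [FiniteDimensional ℝ E]
    (F : E → GL (Fin n) ℂ) (L : E →L[ℝ] Matrix (Fin n) (Fin n) ℂ)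
    (hF : HasStrictFDerivAt (fun e => (F e).val) L 0) (h0 : F 0 = 1) (hG : ∀ e, F e ∈ G.toSubgroup)
    (hinj : Function.Injective L) (hrange : L.range = G.lieAlg) :
    ∃ (Θ : Matrix (Fin n) (Fin n) ℂ → E) (D : Matrix (Fin n) (Fin n) ℂ →L[ℝ] E),
      HasStrictFDerivAt Θ D 1 ∧ Θ 1 = 0 ∧ (∀ e, D (L e) = e) ∧
      ∀ᶠ g in 𝓝 (1 : GL (Fin n) ℂ), g ∈ G.toSubgroup → F (Θ g.val) = g := by
  obtain ⟨C, hC⟩ := Submodule.exists_isCompl G.lieAlg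
  -- A complement `C` of `𝔤` completes `F` to the local diffeomorphism `(e, c) ↦ F(e) exp(c)` of the
  -- space of matrices. On `G` the coordinate `c` must vanish near the identity.
  let T : (E × C) →ₗ[ℝ] Matrix (Fin n) (Fin n) ℂ := (L : E →ₗ[ℝ] _).coprod C.subtype
  have hT : Function.Bijective T := by
    constructor
    · rw [← LinearMap.ker_eq_bot, LinearMap.ker_coprod_of_disjoint_range]
      · simp [LinearMap.ker_eq_bot.2 hinj]
      · rw [Submodule.range_subtype, hrange]
        exact hC.disjoint
    · rw [← LinearMap.range_eq_top, LinearMap.range_coprod, Submodule.range_subtype, hrange]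
      exact hC.sup_eq_top
  let T' : (E × C) ≃L[ℝ] Matrix (Fin n) (Fin n) ℂ := (LinearEquiv.ofBijective T hT).toContinuousLinearEquiv
  let Φ : E × C → Matrix (Fin n) (Fin n) ℂ := fun q => (F q.1).val * NormedSpace.exp (q.2 : Matrix (Fin n) (Fin n) ℂ)
  have hΦ : HasStrictFDerivAt Φ (T' : (E × C) →L[ℝ] _) 0 := by
    have h1 : HasStrictFDerivAt (fun q : E × C => (F q.1).val) (L ∘L ContinuousLinearMap.fst ℝ E C) 0 :=
      HasStrictFDerivAt.comp (0 : E × C) (f := Prod.fst) hF hasStrictFDerivAt_fst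
    have h2 : HasStrictFDerivAt (fun q : E × C => NormedSpace.exp (q.2 : Matrix (Fin n) (Fin n) ℂ))
        (C.subtypeL ∘L ContinuousLinearMap.snd ℝ E C) 0 :=
      hasStrictFDerivAt_exp_comp (C.subtypeL ∘L ContinuousLinearMap.snd ℝ E C)
    refine (h1.mul' h2).congr_fderiv ?_
    refine ContinuousLinearMap.ext fun q => ?_
    change (F 0).val * (q.2 : Matrix (Fin n) (Fin n) ℂ) +
      L q.1 * NormedSpace.exp ((0 : C) : Matrix (Fin n) (Fin n) ℂ) = L q.1 + q.2
    simp [h0, add_comm]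
  have hΦ0 : Φ 0 = 1 := by simp [Φ, h0]
  have hinv : ∀ᶠ g in 𝓝 (1 : GL (Fin n) ℂ), Φ (hΦ.localInverse Φ T' 0 g.val) = g.val := by
    have := hΦ.eventually_right_inverse
    rw [hΦ0] at this
    exact (Units.continuous_val.tendsto (1 : GL (Fin n) ℂ)).eventually this
  have hD := hΦ.to_localInverse
  rw [hΦ0] at hD
  have hz : hΦ.localInverse Φ T' 0 1 = 0 := by
    rw [← hΦ0]; exact hΦ.localInverse_apply_image
  have hsmall : ∀ᶠ g in 𝓝 (1 : GL (Fin n) ℂ),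
      expGL ((hΦ.localInverse Φ T' 0 g.val).2 : Matrix (Fin n) (Fin n) ℂ) ∈ G.toSubgroup →
        ((hΦ.localInverse Φ T' 0 g.val).2 : Matrix (Fin n) (Fin n) ℂ) = 0 := by
    have hc : Tendsto (fun g : GL (Fin n) ℂ => ((hΦ.localInverse Φ T' 0 g.val).2 : Matrix (Fin n) (Fin n) ℂ))
        (𝓝 1) (𝓝 0) := by
      have h1 : Tendsto (fun g : GL (Fin n) ℂ => hΦ.localInverse Φ T' 0 g.val) (𝓝 1) (𝓝 0) := by
        have := hD.continuousAt.tendsto.comp (Units.continuous_val.tendsto (1 : GL (Fin n) ℂ))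
        rwa [hz] at this
      exact ((continuous_subtype_val.comp continuous_snd).tendsto (0 : E × C)).comp h1
    filter_upwards [hc.eventually (G.eventually_eq_zero_of_disjoint C hC.disjoint)] with g hg
    exact hg (Subtype.mem _)
  refine ⟨fun x => (hΦ.localInverse Φ T' 0 x).1, ContinuousLinearMap.fst ℝ E C ∘L (T'.symm : _ →L[ℝ] E × C),
    hasStrictFDerivAt_fst.comp _ hD, by simp [hz], fun e => ?_, ?_⟩
  · have : L e = T' (e, 0) := by simp [T', T]
    rw [this]
    simp
  · filter_upwards [hinv, hsmall] with g hg hs hgG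
    have e1 : F (hΦ.localInverse Φ T' 0 g.val).1 * expGL ((hΦ.localInverse Φ T' 0 g.val).2 : Matrix (Fin n) (Fin n) ℂ) = g := by
      apply Units.ext
      rw [Units.val_mul, expGL_val]
      exact hg
    -- Both `g` and the value of `F` lie in `G`, hence so does `exp(c)`; being small, `c` is zero.
    have e2 := hs (by
      rw [eq_inv_mul_of_mul_eq e1]
      exact G.toSubgroup.mul_mem (G.toSubgroup.inv_mem (hG _)) hgG)
    rw [e2, expGL_zero, mul_one] at e1
    exact e1

end LocalTheory

/-! ### The Cartan decomposition -/

section Cartan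
open scoped Matrix.Norms.Operator

variable {n : ℕ} (G : LinearReductiveGroup n)

theorem conj_mem_lieAlg {g : GL (Fin n) ℂ} (hg : g ∈ G.toSubgroup) {X : Matrix (Fin n) (Fin n) ℂ}
    (hX : X ∈ G.lieAlg) : g.val * X * (g⁻¹).val ∈ G.lieAlg := fun s => by
  have : s • (g.val * X * (g⁻¹).val) = g.val * (s • X) * g.inv := by
    simp
  rw [this, expGL_conj]
  exact G.toSubgroup.mul_mem (G.toSubgroup.mul_mem hg (hX s)) (G.toSubgroup.inv_mem hg)

theorem star_mem_lieAlg {X : Matrix (Fin n) (Fin n) ℂ} (hX : X ∈ G.lieAlg) : star X ∈ G.lieAlg := fun s => by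
  have : s • star X = star (s • X) := by rw [star_smul, star_trivial s]
  rw [this, expGL_star]
  exact G.star_mem _ (hX s)

/-- With `w = exp(Z/2)`, which is Hermitian with square `exp Z`, multiplying the equation by `Y*`
and taking traces gives `‖wY‖² + ‖Yw‖² = 0` in the Frobenius norm. The lemma is used both for the
differential of squaring at `exp Z` and for that of the parametrisation of `G` in
`eventually_mem_of_sq_mem`. -/
theorem eq_zero_of_expGL_mul_add {Z Y : Matrix (Fin n) (Fin n) ℂ} (hZ : star Z = Z)
    (h : (expGL Z).val * Y + Y * (expGL Z).val = 0) : Y = 0 := by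
  set w := expGL ((1 / 2 : ℝ) • Z) with hw
  have hww : expGL Z = w * w := by
    rw [hw, ← expGL_add_smul]; norm_num
  have hws : star w.val = w.val := by
    rw [← Units.coe_star, hw, ← expGL_star, star_smul, hZ, star_trivial]
  have h1 : Matrix.trace (star (w.val * Y) * (w.val * Y)) + Matrix.trace (Y * w.val * star (Y * w.val)) = 0 := by
    rw [star_mul, star_mul, hws]
    have e1 : star Y * w.val * (w.val * Y) = star Y * ((expGL Z).val * Y) := by
      rw [hww, Units.val_mul]; simp only [mul_assoc]
    have e2 : Matrix.trace (Y * w.val * (w.val * star Y)) = Matrix.trace (star Y * (Y * (expGL Z).val)) := by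
      rw [Matrix.trace_mul_comm (star Y), hww, Units.val_mul]; simp only [mul_assoc]
    rw [e1, e2, ← Matrix.trace_add, ← mul_add, h, mul_zero, Matrix.trace_zero]
  open scoped ComplexOrder in
  have h2 : 0 ≤ Matrix.trace (star (w.val * Y) * (w.val * Y)) :=
    (Matrix.posSemidef_conjTranspose_mul_self (w.val * Y)).trace_nonneg
  open scoped ComplexOrder in
  have h3 : 0 ≤ Matrix.trace (Y * w.val * star (Y * w.val)) :=
    (Matrix.posSemidef_self_mul_conjTranspose (Y * w.val)).trace_nonneg
  open scoped ComplexOrder in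
  have h4 := ((add_eq_zero_iff_of_nonneg h2 h3).1 h1).1
  have h5 : w.val * Y = 0 := Matrix.trace_conjTranspose_mul_self_eq_zero_iff.1 h4
  calc Y = (w⁻¹).val * (w.val * Y) := by rw [← mul_assoc, Units.inv_mul, one_mul]
    _ = 0 := by rw [h5, mul_zero]

/-- For `x₀ = exp Z` one has `(x₀ e^Y)² = x₀² exp(x₀⁻¹ Y x₀) e^Y`. The differential `Y ↦ x₀⁻¹ Y x₀ +
Y` is bijective on `𝔤`, so the last two factors fill a neighbourhood of `1` in `G`. Thus `x² ∈ G`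
near `x₀²` is the square of some `x₀ e^Y ∈ G` near `x₀`, and local injectivity of squaring forces `x
= x₀ e^Y`. This supplies the openness in the connectedness argument for the Cartan decomposition. -/
theorem eventually_mem_of_sq_mem {Z : Matrix (Fin n) (Fin n) ℂ} (hZ : star Z = Z)
    (hG : expGL Z ∈ G.toSubgroup) :
    ∀ᶠ x in 𝓝 (expGL Z), x * x ∈ G.toSubgroup → x ∈ G.toSubgroup := by
  set x₀ := expGL Z with hx₀
  -- squaring is locally injective at `x₀`
  let Q : Matrix (Fin n) (Fin n) ℂ →ₗ[ℝ] Matrix (Fin n) (Fin n) ℂ :=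
    LinearMap.mulLeft ℝ x₀.val + LinearMap.mulRight ℝ x₀.val
  have hQ : Function.Injective Q := by
    rw [← LinearMap.ker_eq_bot, LinearMap.ker_eq_bot']
    intro Y hY
    exact eq_zero_of_expGL_mul_add hZ hY
  let Q' : Matrix (Fin n) (Fin n) ℂ ≃L[ℝ] Matrix (Fin n) (Fin n) ℂ :=
    (LinearEquiv.ofInjectiveEndo Q hQ).toContinuousLinearEquiv
  have hsq : HasStrictFDerivAt (fun y : Matrix (Fin n) (Fin n) ℂ => y * y)
      (Q' : Matrix (Fin n) (Fin n) ℂ →L[ℝ] Matrix (Fin n) (Fin n) ℂ) x₀.val := by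
    have h1 := hasStrictFDerivAt_id (𝕜 := ℝ) x₀.val
    refine (h1.mul' h1).congr_fderiv ?_
    refine ContinuousLinearMap.ext fun q => ?_
    change x₀.val * q + q * x₀.val = x₀.val * q + q * x₀.val
    rfl
  have hleft := hsq.eventually_left_inverse
  -- parametrise `G` near the identity by `Y ↦ exp (x₀⁻¹ Y x₀) exp Y`
  let A : Matrix (Fin n) (Fin n) ℂ →ₗ[ℝ] Matrix (Fin n) (Fin n) ℂ :=
    LinearMap.mulLeft ℝ (x₀⁻¹).val ∘ₗ LinearMap.mulRight ℝ x₀.val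
  let A' : Matrix (Fin n) (Fin n) ℂ →L[ℝ] Matrix (Fin n) (Fin n) ℂ := A.toContinuousLinearMap
  have hA : ∀ Y ∈ G.lieAlg, A' Y ∈ G.lieAlg := fun Y hY => by
    have := G.conj_mem_lieAlg (G.toSubgroup.inv_mem hG) hY
    rw [inv_inv, mul_assoc] at this
    exact this
  let F : G.lieAlg → GL (Fin n) ℂ := fun Y => expGL (A' Y) * expGL (Y : Matrix (Fin n) (Fin n) ℂ)
  let L : G.lieAlg →L[ℝ] Matrix (Fin n) (Fin n) ℂ := A' ∘L G.lieAlg.subtypeL + G.lieAlg.subtypeL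
  have hF : HasStrictFDerivAt (fun Y => (F Y).val) L 0 := by
    have h1 : HasStrictFDerivAt (fun Y : G.lieAlg => NormedSpace.exp (A' Y))
        (A' ∘L G.lieAlg.subtypeL) 0 := hasStrictFDerivAt_exp_comp (A' ∘L G.lieAlg.subtypeL)
    have h2 : HasStrictFDerivAt (fun Y : G.lieAlg => NormedSpace.exp (Y : Matrix (Fin n) (Fin n) ℂ))
        G.lieAlg.subtypeL 0 := hasStrictFDerivAt_exp_comp G.lieAlg.subtypeL
    have h3 := h1.mul' h2
    have h4 : (fun Y => (F Y).val) = fun Y : G.lieAlg => NormedSpace.exp (A' Y) *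
        NormedSpace.exp (Y : Matrix (Fin n) (Fin n) ℂ) := by
      funext Y
      simp only [F, Units.val_mul, expGL_val]
    rw [h4]
    refine h3.congr_fderiv (ContinuousLinearMap.ext fun q => ?_)
    change NormedSpace.exp (A' ((0 : G.lieAlg) : Matrix (Fin n) (Fin n) ℂ)) * (q : Matrix (Fin n) (Fin n) ℂ) +
      A' q * NormedSpace.exp ((0 : G.lieAlg) : Matrix (Fin n) (Fin n) ℂ) = A' q + q
    simp [add_comm]
  have hLmem : ∀ Y, L Y ∈ G.lieAlg := fun Y => G.lieAlg.add_mem (hA _ Y.2) Y.2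
  have hLinj : Function.Injective L := by
    change Function.Injective (L : G.lieAlg →ₗ[ℝ] Matrix (Fin n) (Fin n) ℂ)
    rw [← LinearMap.ker_eq_bot, LinearMap.ker_eq_bot']
    intro Y hY
    have hY' : (x₀⁻¹).val * ((Y : Matrix (Fin n) (Fin n) ℂ) * x₀.val) + Y = 0 := hY
    have := congrArg (fun W => x₀.val * W) hY'
    simp only [mul_add, mul_zero] at this
    rw [← mul_assoc, Units.mul_inv, one_mul, add_comm] at this
    exact Subtype.ext (eq_zero_of_expGL_mul_add hZ this)
  have hLrange : L.range = G.lieAlg := by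
    refine le_antisymm ?_ fun W hW => ?_
    · rintro _ ⟨Y, rfl⟩
      exact hLmem Y
    · let L' : G.lieAlg →ₗ[ℝ] G.lieAlg := (L : G.lieAlg →ₗ[ℝ] Matrix (Fin n) (Fin n) ℂ).codRestrict G.lieAlg hLmem
      have : Function.Injective L' := fun a b hab => hLinj (congrArg Subtype.val hab)
      obtain ⟨Y, hY⟩ := LinearMap.injective_iff_surjective.1 this ⟨W, hW⟩
      exact ⟨Y, congrArg Subtype.val hY⟩
  obtain ⟨Θ, D, hΘ, hΘ1, -, hΘF⟩ := G.exists_local_inverse F L hF (by simp [F, expGL_zero])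
    (fun Y => G.toSubgroup.mul_mem (G.expGL_mem (hA _ Y.2)) (G.expGL_mem Y.2)) hLinj hLrange
  have hg : Tendsto (fun x : GL (Fin n) ℂ => (x₀ * x₀)⁻¹ * (x * x)) (𝓝 x₀) (𝓝 1) := by
    have : Continuous (fun x : GL (Fin n) ℂ => (x₀ * x₀)⁻¹ * (x * x)) := by fun_prop
    simpa using this.tendsto x₀
  have hx' : Tendsto (fun x : GL (Fin n) ℂ => (x₀ * expGL (Θ ((x₀ * x₀)⁻¹ * (x * x) : GL (Fin n) ℂ).val :
      Matrix (Fin n) (Fin n) ℂ)).val) (𝓝 x₀) (𝓝 x₀.val) := by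
    have e1 : Tendsto (fun x : GL (Fin n) ℂ => Θ ((x₀ * x₀)⁻¹ * (x * x) : GL (Fin n) ℂ).val) (𝓝 x₀) (𝓝 0) := by
      have := hΘ.continuousAt.tendsto
      rw [hΘ1] at this
      exact this.comp ((Units.continuous_val.tendsto (1 : GL (Fin n) ℂ)).comp hg)
    have e2 : Continuous fun Y : G.lieAlg => (x₀ * expGL (Y : Matrix (Fin n) (Fin n) ℂ)).val :=
      Units.continuous_val.comp (continuous_const.mul (continuous_expGL.comp continuous_subtype_val))
    have := (e2.tendsto 0).comp e1
    simpa [expGL_zero, Function.comp_def] using this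
  filter_upwards [hg.eventually hΘF, hx'.eventually hleft,
    (Units.continuous_val.tendsto x₀).eventually hleft] with x h1 h2 h3 hxG
  have hgG : (x₀ * x₀)⁻¹ * (x * x) ∈ G.toSubgroup :=
    G.toSubgroup.mul_mem (G.toSubgroup.inv_mem (G.toSubgroup.mul_mem hG hG)) hxG
  have h4 := h1 hgG
  set Y := Θ ((x₀ * x₀)⁻¹ * (x * x) : GL (Fin n) ℂ).val with hY
  have h5 : expGL (A' Y) = x₀⁻¹ * expGL (Y : Matrix (Fin n) (Fin n) ℂ) * x₀ := by
    have := expGL_conj x₀⁻¹ (Y : Matrix (Fin n) (Fin n) ℂ)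
    rw [inv_inv] at this
    rw [← this]
    congr 1
    exact (mul_assoc _ _ _).symm
  have h6 : (x₀ * expGL (Y : Matrix (Fin n) (Fin n) ℂ)) * (x₀ * expGL (Y : Matrix (Fin n) (Fin n) ℂ)) = x * x := by
    have h7 : expGL (A' Y) * expGL (Y : Matrix (Fin n) (Fin n) ℂ) = (x₀ * x₀)⁻¹ * (x * x) := h4
    rw [h5, eq_inv_mul_iff_mul_eq] at h7
    rw [← h7]
    group
  have h8 : x = x₀ * expGL (Y : Matrix (Fin n) (Fin n) ℂ) := by
    apply Units.ext
    rw [← h2, ← h3]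
    congr 1
    exact congrArg Units.val h6.symm
  rw [h8]
  exact G.toSubgroup.mul_mem hG (G.expGL_mem Y.2)

/-- The logarithm of `g* g` lies in `𝔤`. -/
theorem exists_log_star_mul_self {g : GL (Fin n) ℂ} (hg : g ∈ G.toSubgroup) :
    ∃ X : G.p, expGL (X : Matrix (Fin n) (Fin n) ℂ) = star g * g := by
  obtain ⟨l, hl, hls, hle⟩ := exists_continuous_log_star_mul_self n
  have hroots : ∀ j : ℕ, ∀ g ∈ G.toSubgroup, expGL ((1 / 2 : ℝ) ^ j • l g) ∈ G.toSubgroup := by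
    intro j
    induction j with
    | zero =>
      intro g hg
      rw [pow_zero, one_smul, hle]
      exact G.toSubgroup.mul_mem (G.star_mem g hg) hg
    | succ j ih =>
      have : PreconnectedSpace G.toSubgroup :=
        isPreconnected_iff_preconnectedSpace.1 G.isConnected.isPreconnected
      have hcont : Continuous fun g : G.toSubgroup => expGL ((1 / 2 : ℝ) ^ (j + 1) • l g) :=
        by
        have hl' : Continuous fun g : G.toSubgroup => (1 / 2 : ℝ) ^ (j + 1) • l g := by fun_prop
        exact continuous_expGL.comp hl'
      -- Induction on `j`: the square of the `2^(j+1)`-th root of `g* g` is its `2^j`-th root,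
      -- already known to lie in `G`, so the condition on the former is open. It is closed since `G`
      -- is, and it holds at `g = 1`.
      have hclopen : IsClopen {g : G.toSubgroup | expGL ((1 / 2 : ℝ) ^ (j + 1) • l g) ∈ G.toSubgroup} := by
        refine ⟨G.isClosed.preimage hcont, isOpen_iff_mem_nhds.2 fun g hg => ?_⟩
        have hZ : star ((1 / 2 : ℝ) ^ (j + 1) • l g) = (1 / 2 : ℝ) ^ (j + 1) • l g := by
          rw [star_smul, hls, star_trivial]
        filter_upwards [(hcont.tendsto g).eventually (G.eventually_mem_of_sq_mem hZ hg)] with y hy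
        apply hy
        rw [← expGL_add_smul]
        have : (1 / 2 : ℝ) ^ (j + 1) + (1 / 2 : ℝ) ^ (j + 1) = (1 / 2 : ℝ) ^ j := by ring
        rw [this]
        exact ih y y.2
      have h1 : l 1 = 0 := expGL_injective_of_isSelfAdjoint (hls 1) (star_zero _) (by rw [hle, expGL_zero]; simp)
      have huniv := hclopen.eq_univ ⟨1, by
        change expGL ((1 / 2 : ℝ) ^ (j + 1) • l 1) ∈ G.toSubgroup
        rw [h1, smul_zero, expGL_zero]
        exact G.toSubgroup.one_mem⟩
      intro g hg
      exact Set.eq_univ_iff_forall.1 huniv ⟨g, hg⟩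
  refine ⟨⟨l g, fun s => ?_, hls g⟩, hle g⟩
  -- Dyadic rationals are dense, so the whole one-parameter group through `g* g` lies in the closed
  -- group `G`.
  have hlim : Tendsto (fun j : ℕ => ((⌊s * 2 ^ j⌋ : ℤ) : ℝ) * (1 / 2 : ℝ) ^ j) atTop (𝓝 s) := by
    rw [tendsto_iff_norm_sub_tendsto_zero]
    refine squeeze_zero (fun _ => norm_nonneg _) (fun j => ?_)
      (tendsto_pow_atTop_nhds_zero_of_lt_one (r := (1 / 2 : ℝ)) (by norm_num) (by norm_num))
    have e1 := Int.floor_le (s * 2 ^ j)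
    have e2 := Int.lt_floor_add_one (s * 2 ^ j)
    have hp : (0 : ℝ) < (1 / 2) ^ j := by positivity
    have e3 : s = s * 2 ^ j * (1 / 2 : ℝ) ^ j := by
      rw [mul_assoc, ← mul_pow]; norm_num
    rw [Real.norm_eq_abs, abs_le]
    constructor <;> nlinarith
  refine G.isClosed.mem_of_tendsto ((continuous_expGL.tendsto _).comp (hlim.smul_const (l g)))
    (Eventually.of_forall fun j => ?_)
  simp only [Function.comp_apply]
  rw [mul_smul, Int.cast_smul_eq_zsmul, expGL_zsmul]
  exact G.toSubgroup.zpow_mem (hroots j g hg) _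

theorem star_expGL_p (X : G.p) (s : ℝ) :
    star (expGL (s • (X : Matrix (Fin n) (Fin n) ℂ))) = expGL (s • (X : Matrix (Fin n) (Fin n) ℂ)) := by
  rw [← expGL_star, star_smul, X.2.2, star_trivial]

theorem expGL_conj_K (k : G.K) (X : G.p) (s : ℝ) :
    expGL (s • (G.Ad k X : Matrix (Fin n) (Fin n) ℂ)) =
      k * expGL (s • (X : Matrix (Fin n) (Fin n) ℂ)) * (k : GL (Fin n) ℂ)⁻¹ := by
  rw [← expGL_conj]
  congr 1
  simp [Ad]

/-- The Cartan decomposition. -/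
theorem exists_phi_eq {t : ℝ} (ht : t ≠ 0) {g : GL (Fin n) ℂ} (hg : g ∈ G.toSubgroup) :
    ∃ x, G.phi t x = g := by
  obtain ⟨X, hX⟩ := G.exists_log_star_mul_self hg
  -- The polar decomposition: `g* g = exp X` makes `k = g exp(-X/2)` unitary.
  have hk : g * (expGL ((1 / 2 : ℝ) • (X : Matrix (Fin n) (Fin n) ℂ)))⁻¹ ∈ G.K := by
    refine ⟨G.toSubgroup.mul_mem hg (G.toSubgroup.inv_mem (X.2.1 _)), ?_⟩
    rw [star_mul, star_inv, star_expGL_p, eq_inv_iff_mul_eq_one]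
    calc _ = (expGL ((1 / 2 : ℝ) • (X : Matrix (Fin n) (Fin n) ℂ)))⁻¹ * (star g * g) *
          (expGL ((1 / 2 : ℝ) • (X : Matrix (Fin n) (Fin n) ℂ)))⁻¹ := by group
      _ = 1 := by
        have : expGL (X : Matrix (Fin n) (Fin n) ℂ) = expGL ((1 / 2 : ℝ) • (X : Matrix (Fin n) (Fin n) ℂ)) *
            expGL ((1 / 2 : ℝ) • (X : Matrix (Fin n) (Fin n) ℂ)) := by
          rw [← expGL_add_smul]; norm_num
        rw [← hX, this]; group
  -- Moving `k` to the right in `g = k exp(X/2)` replaces `X/2` by `Ad(k)(X/2)`; the factor `t⁻¹`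
  -- compensates the `t` in `φ_t`.
  refine ⟨(⟨_, hk⟩, t⁻¹ • G.Ad ⟨_, hk⟩ ((1 / 2 : ℝ) • X)), ?_⟩
  have h1 : t • ((t⁻¹ • G.Ad ⟨_, hk⟩ ((1 / 2 : ℝ) • X) : G.p) : Matrix (Fin n) (Fin n) ℂ) =
      (1 : ℝ) • ((G.Ad ⟨_, hk⟩ ((1 / 2 : ℝ) • X) : G.p) : Matrix (Fin n) (Fin n) ℂ) := by
    rw [Submodule.coe_smul, smul_smul, mul_inv_cancel₀ ht]
  simp only [phi]
  rw [h1, expGL_conj_K, one_smul, Submodule.coe_smul]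
  group

theorem phi_mem (t : ℝ) (x : G.K × G.p) : G.phi t x ∈ G.toSubgroup :=
  G.toSubgroup.mul_mem (x.2.2.1 t) x.1.2.1

/-- The unitary factor cancels in `φ_t(k,v) φ_t(k,v)* = exp(2tv)`, and `exp` is injective on
Hermitian matrices; this determines `v`, and then `k`. -/
theorem phi_injective {t : ℝ} (ht : t ≠ 0) : Function.Injective (G.phi t) := by
  have key : ∀ x : G.K × G.p, G.phi t x * star (G.phi t x) = expGL ((t + t) • (x.2 : Matrix (Fin n) (Fin n) ℂ)) := by
    intro x
    rw [phi, star_mul, x.1.2.2, star_expGL_p, expGL_add_smul]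
    group
  intro x y hxy
  have h2 : x.2 = y.2 := by
    have h := key x
    rw [hxy, key y] at h
    have h3 := expGL_injective_of_isSelfAdjoint (by rw [star_smul, y.2.2.2, star_trivial])
      (by rw [star_smul, x.2.2.2, star_trivial]) h
    have htt : t + t ≠ 0 := by simpa using ht
    exact (Subtype.ext (smul_right_injective _ htt h3)).symm
  refine Prod.ext (Subtype.ext ?_) h2
  simpa [phi, h2] using hxy

theorem phi_phiInv {t : ℝ} (ht : t ≠ 0) {g : GL (Fin n) ℂ} (hg : g ∈ G.toSubgroup) :
    G.phi t (G.phiInv t g) = g :=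
  Function.invFun_eq (G.exists_phi_eq ht hg)

end Cartan

/-! ### Roots of `(𝔤_t, 𝔞)` and the decomposition of `𝔤` -/

section RootDecomposition
open scoped Matrix.Norms.Operator

variable {n : ℕ} (G : LinearReductiveGroup n)

theorem dphi_dphi (s t : ℝ) (X : Matrix (Fin n) (Fin n) ℂ) : dphi n s (dphi n t X) = dphi n (s * t) X := by
  simp only [dphi, LinearMap.coe_mk, AddHom.coe_mk, star_add, star_sub, star_smul, star_star, star_trivial]
  module

theorem dphi_one (X : Matrix (Fin n) (Fin n) ℂ) : dphi n 1 X = X := by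
  simp only [dphi, LinearMap.coe_mk, AddHom.coe_mk]
  module

theorem dphi_of_isSelfAdjoint (t : ℝ) {X : Matrix (Fin n) (Fin n) ℂ} (hX : star X = X) : dphi n t X = t • X := by
  simp only [dphi, LinearMap.coe_mk, AddHom.coe_mk, hX]
  module

theorem dphi_inv_dphi {t : ℝ} (ht : t ≠ 0) (X : Matrix (Fin n) (Fin n) ℂ) : dphi n t⁻¹ (dphi n t X) = X := by
  rw [dphi_dphi, inv_mul_cancel₀ ht, dphi_one]

theorem dphi_dphi_inv {t : ℝ} (ht : t ≠ 0) (X : Matrix (Fin n) (Fin n) ℂ) : dphi n t (dphi n t⁻¹ X) = X := by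
  rw [dphi_dphi, mul_inv_cancel₀ ht, dphi_one]

theorem dphi_mem {t : ℝ} {X : Matrix (Fin n) (Fin n) ℂ} (hX : X ∈ G.lieAlg) : dphi n t X ∈ G.lieAlg := by
  have hs := G.star_mem_lieAlg hX
  exact G.lieAlg.add_mem (G.lieAlg.smul_mem _ (G.lieAlg.sub_mem hX hs))
    (G.lieAlg.smul_mem _ (G.lieAlg.smul_mem _ (G.lieAlg.add_mem hX hs)))

theorem dphi_mem_iff {t : ℝ} (ht : t ≠ 0) {X : Matrix (Fin n) (Fin n) ℂ} :
    dphi n t X ∈ G.lieAlg ↔ X ∈ G.lieAlg :=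
  ⟨fun h => by simpa [dphi_inv_dphi ht] using G.dphi_mem (t := t⁻¹) h, fun h => G.dphi_mem h⟩

/-- The bracket is the derivative at `0` of the curve `s ↦ exp(sX) Y exp(-sX)`, which stays in the
closed subspace `𝔤`. -/
theorem lie_mem_lieAlg {X Y : Matrix (Fin n) (Fin n) ℂ} (hX : X ∈ G.lieAlg) (hY : Y ∈ G.lieAlg) :
    X * Y - Y * X ∈ G.lieAlg := by
  have h1 : HasDerivAt (fun s : ℝ => NormedSpace.exp (s • X) * Y * NormedSpace.exp (s • -X))
      (X * Y - Y * X) 0 := by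
    have hexp : ∀ W : Matrix (Fin n) (Fin n) ℂ,
        HasDerivAt (fun s : ℝ => NormedSpace.exp (s • W)) W 0 := fun W => by
      have h : HasDerivAt (fun s : ℝ => NormedSpace.exp (s • W)) (NormedSpace.exp ((0 : ℝ) • W) * W) 0 :=
        hasDerivAt_exp_smul_const (𝕂 := ℝ) W 0
      rwa [zero_smul, NormedSpace.exp_zero, one_mul] at h
    refine (((hexp X).mul_const Y).mul (hexp (-X))).congr_deriv ?_
    simp [sub_eq_add_neg]
  have h2 := h1.tendsto_slope_zero
  refine G.lieAlg.closed_of_finiteDimensional.mem_of_tendsto h2 (Eventually.of_forall fun s => ?_)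
  refine G.lieAlg.smul_mem _ (G.lieAlg.sub_mem ?_ (by simpa using hY))
  have := G.conj_mem_lieAlg (hX (0 + s)) hY
  rwa [← expGL_neg, expGL_val, expGL_val, ← smul_neg] at this

theorem exists_inner_core (𝔤 : Submodule ℝ (Matrix (Fin n) (Fin n) ℂ)) :
    ∃ c : InnerProductSpace.Core ℝ 𝔤, ∀ X Y : 𝔤, c.inner X Y =
      (Matrix.trace (star (X : Matrix (Fin n) (Fin n) ℂ) * (Y : Matrix (Fin n) (Fin n) ℂ))).re := by
  refine ⟨{ inner := fun X Y => (Matrix.trace (star (X : Matrix (Fin n) (Fin n) ℂ) *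
                (Y : Matrix (Fin n) (Fin n) ℂ))).re
            conj_inner_symm := fun X Y => ?_
            re_inner_nonneg := fun X => ?_
            add_left := fun X Y Z => ?_
            smul_left := fun X Y r => ?_
            definite := fun X hX => ?_ }, fun _ _ => rfl⟩
  · have : star (X : Matrix (Fin n) (Fin n) ℂ) * (Y : Matrix (Fin n) (Fin n) ℂ) =
        star (star (Y : Matrix (Fin n) (Fin n) ℂ) * (X : Matrix (Fin n) (Fin n) ℂ)) := by
      rw [star_mul, star_star]
    rw [this, Matrix.star_eq_conjTranspose (star _ * _), Matrix.trace_conjTranspose]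
    simp
  · open scoped ComplexOrder in
    have := (Matrix.posSemidef_conjTranspose_mul_self (X : Matrix (Fin n) (Fin n) ℂ)).trace_nonneg
    exact (Complex.le_def.1 this).1
  · simp [add_mul]
  · simp
  · open scoped ComplexOrder in
    have h0 := (Matrix.posSemidef_conjTranspose_mul_self (X : Matrix (Fin n) (Fin n) ℂ)).trace_nonneg
    have h1 : Matrix.trace (star (X : Matrix (Fin n) (Fin n) ℂ) * (X : Matrix (Fin n) (Fin n) ℂ)) = 0 := by
      apply Complex.ext
      · exact hX
      · exact (Complex.le_def.1 h0).2.symm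
    exact Subtype.ext (Matrix.trace_conjTranspose_mul_self_eq_zero_iff.1 h1)

/-- The inner product is an argument of type `Core` because spaces of matrices already carry a
different norm here. The operators will be the `ad H` with `H ∈ 𝔞`, symmetric for `Re tr(X* Y)`
since `H` is Hermitian. -/
theorem iSup_iInf_eigenspace_eq_top {E ι : Type*} [AddCommGroup E] [Module ℝ E] [FiniteDimensional ℝ E]
    (c : InnerProductSpace.Core ℝ E) (T : ι → Module.End ℝ E)
    (hT : ∀ i X Y, c.inner (T i X) Y = c.inner X (T i Y)) (hc : ∀ i j, Commute (T i) (T j)) :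
    ⨆ χ : ι → ℝ, ⨅ i, (T i).eigenspace (χ i) = ⊤ := by
  let _ : NormedAddCommGroup E := c.toNormedAddCommGroup
  let _ : InnerProductSpace ℝ E := InnerProductSpace.ofCore c.toCore
  exact LinearMap.IsSymmetric.iSup_iInf_eq_top_of_commute (T := T) (fun i X Y => hT i X Y)
    (fun i j _ => hc i j)

variable {G} (𝔞 : Submodule ℝ G.p)

/-- The matrix of an element of `𝔞`. -/
abbrev mat {𝔞 : Submodule ℝ G.p} (H : 𝔞) : Matrix (Fin n) (Fin n) ℂ := ((H : G.p) : Matrix (Fin n) (Fin n) ℂ)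

theorem star_mat {𝔞 : Submodule ℝ G.p} (H : 𝔞) : star (mat H) = mat H := (H : G.p).2.2

theorem mat_mem {𝔞 : Submodule ℝ G.p} (H : 𝔞) : mat H ∈ G.lieAlg := (H : G.p).2.1

variable {𝔞}

theorem IsMaximalAbelian.commute (h𝔞 : G.IsMaximalAbelian 𝔞) (H H' : 𝔞) : Commute (mat H) (mat H') :=
  h𝔞.prop H H.2 H' H'.2

theorem mem_rootSpace_one {α : Module.Dual ℝ 𝔞} {X : Matrix (Fin n) (Fin n) ℂ} :
    X ∈ rootSpace 𝔞 1 α ↔ X ∈ G.lieAlg ∧ ∀ H : 𝔞, mat H * X - X * mat H = α H • X := by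
  refine and_congr Iff.rfl (forall_congr' fun H => ?_)
  simp only [bracket, inv_one, dphi_one]

/-- The isomorphism `dphi t` from `𝔤_t` to `𝔤` multiplies `𝔞` by `t`, so it turns the eigenvalue `t
α` of `𝔤_t` into `α`. All the rescaling in `t` rests on this. -/
theorem mem_rootSpace_smul_iff {t : ℝ} (ht : t ≠ 0) {α : Module.Dual ℝ 𝔞} {X : Matrix (Fin n) (Fin n) ℂ} :
    X ∈ rootSpace 𝔞 t (t • α) ↔ dphi n t X ∈ rootSpace 𝔞 1 α := by
  rw [mem_rootSpace_one, dphi_mem_iff G ht]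
  refine and_congr Iff.rfl (forall_congr' fun H => ?_)
  have hinj : Function.Injective (dphi n t) := Function.LeftInverse.injective (dphi_inv_dphi ht)
  rw [← hinj.eq_iff, bracket, dphi_dphi_inv ht, dphi_of_isSelfAdjoint t (star_mat H), map_smul,
    LinearMap.smul_apply, smul_mul_assoc, mul_smul_comm, ← smul_sub, smul_assoc]
  exact (smul_right_injective _ ht).eq_iff

/-- The Lie algebra `𝔤` is the sum of the joint eigenspaces of `𝔞`. -/
theorem lieAlg_le_iSup_rootSpace (h𝔞 : G.IsMaximalAbelian 𝔞) :
    G.lieAlg ≤ ⨆ α : Module.Dual ℝ 𝔞, rootSpace 𝔞 1 α := by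
  let T : 𝔞 → Module.End ℝ G.lieAlg := fun H =>
    { toFun := fun X => ⟨mat H * X - X * mat H, G.lie_mem_lieAlg (mat_mem H) X.2⟩
      map_add' := fun X Y => by ext1; simp only [Submodule.coe_add]; noncomm_ring
      map_smul' := fun r X => by ext1; simp [smul_sub] }
  have hTv : ∀ H X, ((T H X : G.lieAlg) : Matrix (Fin n) (Fin n) ℂ) = mat H * X - X * mat H := fun _ _ => rfl
  obtain ⟨c, hc⟩ := exists_inner_core G.lieAlg
  have htop := iSup_iInf_eigenspace_eq_top c T (fun H X Y => by
    rw [hc, hc, hTv, hTv, star_sub, star_mul, star_mul, star_mat, sub_mul, mul_sub, Matrix.trace_sub,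
      Matrix.trace_sub]
    congr 2
    · rw [mul_assoc]
    · rw [mul_assoc, Matrix.trace_mul_comm, mul_assoc]) (fun H H' => by
    refine LinearMap.ext fun X => Subtype.ext ?_
    have h := (h𝔞.commute H H').eq
    simp only [Module.End.mul_apply, hTv]
    have e1 : mat H * (mat H' * X - X * mat H') - (mat H' * X - X * mat H') * mat H =
      mat H * mat H' * X - mat H * X * mat H' - mat H' * X * mat H + X * (mat H' * mat H) := by noncomm_ring
    have e2 : mat H' * (mat H * X - X * mat H) - (mat H * X - X * mat H) * mat H' =
      mat H' * mat H * X - mat H * X * mat H' - mat H' * X * mat H + X * (mat H * mat H') := by noncomm_ring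
    rw [e1, e2, h])
  intro X hX
  have hX' : (⟨X, hX⟩ : G.lieAlg) ∈ ⨆ χ : 𝔞 → ℝ, ⨅ H, (T H).eigenspace (χ H) := by
    rw [htop]; trivial
  suffices h : (⨆ χ : 𝔞 → ℝ, ⨅ H, (T H).eigenspace (χ H)) ≤
      (⨆ α : Module.Dual ℝ 𝔞, rootSpace 𝔞 1 α).comap G.lieAlg.subtype from h hX'
  refine iSup_le fun χ Y hY => ?_
  rw [Submodule.mem_iInf] at hY
  have hY' : ∀ H, mat H * Y - Y * mat H = χ H • (Y : Matrix (Fin n) (Fin n) ℂ) := fun H => by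
    rw [← hTv, Module.End.mem_eigenspace_iff.1 (hY H)]
    rfl
  by_cases hY0 : (Y : Matrix (Fin n) (Fin n) ℂ) = 0
  · rw [Submodule.mem_comap, Submodule.subtype_apply, hY0]
    exact Submodule.zero_mem _
  -- A family of joint eigenvalues is a priori just a function on `𝔞`; it is linear because the
  -- eigenvector `Y` is nonzero.
  · let α : Module.Dual ℝ 𝔞 :=
      { toFun := χ
        map_add' := fun H H' => by
          apply smul_left_injective ℝ hY0
          simp only [add_smul, ← hY']
          simp only [mat, Submodule.coe_add]
          noncomm_ring
        map_smul' := fun r H => by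
          apply smul_left_injective ℝ hY0
          simp only [RingHom.id_apply, smul_eq_mul, mul_smul, ← hY']
          simp [mat, smul_sub] }
    exact Submodule.mem_iSup_of_mem α (mem_rootSpace_one.2 ⟨Y.2, hY'⟩)

theorem star_mem_rootSpace {α : Module.Dual ℝ 𝔞} {X : Matrix (Fin n) (Fin n) ℂ} (hX : X ∈ rootSpace 𝔞 1 α) :
    star X ∈ rootSpace 𝔞 1 (-α) := by
  rw [mem_rootSpace_one] at hX ⊢
  refine ⟨G.star_mem_lieAlg hX.1, fun H => ?_⟩
  have := congrArg star (hX.2 H)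
  rw [star_sub, star_mul, star_mul, star_mat, star_smul, star_trivial (α H)] at this
  rw [LinearMap.neg_apply, neg_smul, ← this, neg_sub]

variable (G) in
/-- The Lie algebra `𝔨` of `K`. -/
def skewAlg : Submodule ℝ (Matrix (Fin n) (Fin n) ℂ) where
  carrier := {X | X ∈ G.lieAlg ∧ star X = -X}
  zero_mem' := ⟨G.lieAlg.zero_mem, by simp⟩
  add_mem' := fun hX hY => ⟨G.lieAlg.add_mem hX.1 hY.1, by rw [star_add, hX.2, hY.2, neg_add]⟩
  smul_mem' := fun c X hX => ⟨G.lieAlg.smul_mem c hX.1, by rw [star_smul, hX.2, star_trivial, smul_neg]⟩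

theorem rootSpace_le_nilp {H₀ : 𝔞} {α : Module.Dual ℝ 𝔞} (h : 0 < α H₀) :
    rootSpace 𝔞 1 α ≤ nilp 𝔞 H₀ 1 := by
  by_cases hb : rootSpace 𝔞 1 α = ⊥
  · rw [hb]; exact bot_le
  · exact le_iSup₂_of_le (f := fun α (_ : α ∈ posRoots 𝔞 H₀ 1) => rootSpace 𝔞 1 α) α
      ⟨⟨fun h0 => by simp [h0] at h, hb⟩, h⟩ le_rfl

theorem nilp_le_lieAlg (H₀ : 𝔞) (t : ℝ) : nilp 𝔞 H₀ t ≤ G.lieAlg :=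
  iSup₂_le fun _ _ _ hX => hX.1

/-- For `X` in the root space of a negative root, `X = (X - X*) + X*` with `X - X*` in `𝔨` and `X*`
in the root space of the opposite, positive root. For the eigenvalue zero, the Hermitian part of `X`
commutes with `𝔞` and lies in `𝔞` by maximality. -/
theorem exists_eq_add_of_mem_lieAlg (h𝔞 : G.IsMaximalAbelian 𝔞) {H₀ : 𝔞} (hH₀ : IsChamberElement 𝔞 H₀)
    {X : Matrix (Fin n) (Fin n) ℂ} (hX : X ∈ G.lieAlg) :
    ∃ Z : G.skewAlg, ∃ H : 𝔞, ∃ Y : nilp 𝔞 H₀ 1, X = Z + mat H + Y := by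
  suffices h : (⨆ α : Module.Dual ℝ 𝔞, rootSpace 𝔞 1 α) ≤
      G.skewAlg ⊔ (𝔞.map G.p.subtype) ⊔ nilp 𝔞 H₀ 1 by
    obtain ⟨W, hW, Y, hY, rfl⟩ := Submodule.mem_sup.1 (h (lieAlg_le_iSup_rootSpace h𝔞 hX))
    obtain ⟨Z, hZ, W', ⟨H, hH, rfl⟩, rfl⟩ := Submodule.mem_sup.1 hW
    exact ⟨⟨Z, hZ⟩, ⟨H, hH⟩, ⟨Y, hY⟩, rfl⟩
  refine iSup_le fun α X hX => ?_
  have hXG := hX.1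
  have hsG := G.star_mem_lieAlg hXG
  rcases lt_trichotomy (α H₀) 0 with h | h | h
  · have h1 : star X ∈ nilp 𝔞 H₀ 1 :=
      rootSpace_le_nilp (by simpa using h) (star_mem_rootSpace hX)
    have h2 : X - star X ∈ G.skewAlg := ⟨G.lieAlg.sub_mem hXG hsG, by rw [star_sub, star_star, neg_sub]⟩
    rw [← sub_add_cancel X (star X)]
    exact Submodule.add_mem _ (Submodule.mem_sup_left (Submodule.mem_sup_left h2)) (Submodule.mem_sup_right h1)
  · by_cases hX0 : X = 0
    · rw [hX0]; exact Submodule.zero_mem _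
    -- A nonzero `α` with a nonzero root space would be a root vanishing at `H₀`, which the choice
    -- of `H₀` in an open chamber excludes.
    have hα : α = 0 := by
      by_contra hα
      exact hH₀ α ⟨hα, fun hb => hX0 (by rw [hb] at hX; simpa using hX)⟩ h
    have hsX := star_mem_rootSpace hX
    rw [hα, neg_zero] at hsX
    rw [hα] at hX
    have hP : (1 / 2 : ℝ) • (X + star X) ∈ G.p := by
      refine ⟨G.lieAlg.smul_mem _ (G.lieAlg.add_mem hXG hsG), ?_⟩
      rw [star_smul, star_add, star_star, add_comm, star_trivial]
    have hcomm : ∀ H : 𝔞, mat H * ((1 / 2 : ℝ) • (X + star X)) = ((1 / 2 : ℝ) • (X + star X)) * mat H := by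
      intro H
      have h1 := (mem_rootSpace_one.1 hX).2 H
      have h2 := (mem_rootSpace_one.1 hsX).2 H
      rw [LinearMap.zero_apply, zero_smul, sub_eq_zero] at h1 h2
      rw [mul_smul_comm, smul_mul_assoc, mul_add, add_mul, h1, h2]
    have hmem : (⟨_, hP⟩ : G.p) ∈ 𝔞 := by
      have hle : 𝔞 ⊔ ℝ ∙ (⟨_, hP⟩ : G.p) ≤ 𝔞 := by
        refine h𝔞.le_of_ge ?_ le_sup_left
        intro A hA B hB
        obtain ⟨a, ha, a', ha', rfl⟩ := Submodule.mem_sup.1 hA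
        obtain ⟨b, hb, b', hb', rfl⟩ := Submodule.mem_sup.1 hB
        obtain ⟨r, rfl⟩ := Submodule.mem_span_singleton.1 ha'
        obtain ⟨r', rfl⟩ := Submodule.mem_span_singleton.1 hb'
        have e1 : Commute (a : Matrix (Fin n) (Fin n) ℂ) b := h𝔞.commute ⟨a, ha⟩ ⟨b, hb⟩
        have e2 : Commute (a : Matrix (Fin n) (Fin n) ℂ) ((1 / 2 : ℝ) • (X + star X)) := hcomm ⟨a, ha⟩
        have e3 : Commute (b : Matrix (Fin n) (Fin n) ℂ) ((1 / 2 : ℝ) • (X + star X)) := hcomm ⟨b, hb⟩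
        exact (e1.add_right (e2.smul_right r')).add_left
          ((e3.symm.smul_left r).add_right (((Commute.refl _).smul_left r).smul_right r'))
      exact hle (Submodule.mem_sup_right (Submodule.mem_span_singleton_self _))
    have h2 : (1 / 2 : ℝ) • (X - star X) ∈ G.skewAlg := by
      refine ⟨G.lieAlg.smul_mem _ (G.lieAlg.sub_mem hXG hsG), ?_⟩
      rw [star_smul, star_sub, star_star, star_trivial, ← smul_neg, neg_sub]
    have h3 : X = (1 / 2 : ℝ) • (X - star X) + (1 / 2 : ℝ) • (X + star X) := by module
    rw [h3]
    exact Submodule.mem_sup_left (Submodule.add_mem _ (Submodule.mem_sup_left h2)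
      (Submodule.mem_sup_right ⟨_, hmem, rfl⟩))
  · exact Submodule.mem_sup_right (rootSpace_le_nilp h hX)

/-- The relation `[H, X] = α(H) X` says that `X` intertwines `H + α(H)` with `H`, hence also their
exponentials. -/
theorem expGL_mul_of_mem_rootSpace {α : Module.Dual ℝ 𝔞} {X : Matrix (Fin n) (Fin n) ℂ}
    (hX : X ∈ rootSpace 𝔞 1 α) (H : 𝔞) :
    (expGL (mat H)).val * X * ((expGL (mat H))⁻¹).val = Real.exp (α H) • X := by
  have h := (mem_rootSpace_one.1 hX).2 H
  have h1 : SemiconjBy X (mat H + algebraMap ℝ _ (α H)) (mat H) := by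
    rw [SemiconjBy, mul_add, Algebra.algebraMap_eq_smul_one, mul_smul_comm, mul_one, ← h]
    abel
  have h2 := h1.exp_right
  rw [NormedSpace.exp_add_of_commute (Algebra.commutes _ _).symm, ← NormedSpace.algebraMap_exp_comm,
    ← Real.exp_eq_exp_ℝ, SemiconjBy] at h2
  rw [← expGL_neg, expGL_val, expGL_val]
  have h3 : NormedSpace.exp (mat H) * NormedSpace.exp (-mat H) = 1 := by
    rw [← expGL_val, ← expGL_val, expGL_neg, Units.mul_inv]
  have h4 : NormedSpace.exp (mat H) * X =
      X * (NormedSpace.exp (mat H) * algebraMap ℝ (Matrix (Fin n) (Fin n) ℂ) (Real.exp (α H))) := h2.symm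
  rw [h4, Algebra.algebraMap_eq_smul_one, mul_smul_comm, mul_smul_comm, mul_one, smul_mul_assoc, mul_assoc, h3, mul_one]

theorem conj_mem_nilp {H₀ : 𝔞} {g : GL (Fin n) ℂ}
    (hg : ∀ α : Module.Dual ℝ 𝔞, ∀ X ∈ rootSpace 𝔞 1 α, g.val * X * (g⁻¹).val ∈ rootSpace 𝔞 1 α)
    {Y : Matrix (Fin n) (Fin n) ℂ} (hY : Y ∈ nilp 𝔞 H₀ 1) : g.val * Y * (g⁻¹).val ∈ nilp 𝔞 H₀ 1 := by
  let A : Matrix (Fin n) (Fin n) ℂ →ₗ[ℝ] Matrix (Fin n) (Fin n) ℂ :=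
    LinearMap.mulRight ℝ (g⁻¹).val ∘ₗ LinearMap.mulLeft ℝ g.val
  suffices h : nilp 𝔞 H₀ 1 ≤ (nilp 𝔞 H₀ 1).comap A from h hY
  refine iSup₂_le fun α hα X hX => ?_
  exact le_iSup₂_of_le (f := fun α (_ : α ∈ posRoots 𝔞 H₀ 1) => rootSpace 𝔞 1 α) α hα le_rfl (hg α X hX)

theorem expGL_conj_mem_nilp {H₀ : 𝔞} (H : 𝔞) {Y : Matrix (Fin n) (Fin n) ℂ} (hY : Y ∈ nilp 𝔞 H₀ 1) :
    (expGL (mat H)).val * Y * ((expGL (mat H))⁻¹).val ∈ nilp 𝔞 H₀ 1 :=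
  conj_mem_nilp (fun α X hX => by
    rw [expGL_mul_of_mem_rootSpace hX]
    exact Submodule.smul_mem _ _ hX) hY

theorem conj_eq_of_mem_M {m : G.K} (hm : m ∈ M 𝔞) (H : 𝔞) :
    (m : GL (Fin n) ℂ).val * mat H * ((m : GL (Fin n) ℂ)⁻¹).val = mat H :=
  congrArg Subtype.val (hm H H.2)

theorem M_conj_mem_nilp {H₀ : 𝔞} {m : G.K} (hm : m ∈ M 𝔞) {Y : Matrix (Fin n) (Fin n) ℂ} (hY : Y ∈ nilp 𝔞 H₀ 1) :
    (m : GL (Fin n) ℂ).val * Y * ((m : GL (Fin n) ℂ)⁻¹).val ∈ nilp 𝔞 H₀ 1 :=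
  conj_mem_nilp (fun α X hX => by
    rw [mem_rootSpace_one] at hX ⊢
    refine ⟨G.conj_mem_lieAlg m.2.1 hX.1, fun H => ?_⟩
    have e := conj_eq_of_mem_M hm H
    set a := (m : GL (Fin n) ℂ).val
    set b := ((m : GL (Fin n) ℂ)⁻¹).val
    have hba : b * a = 1 := Units.inv_mul _
    calc mat H * (a * X * b) - a * X * b * mat H
        = a * mat H * b * (a * X * b) - a * X * b * (a * mat H * b) := by rw [e]
      _ = a * (mat H * ((b * a) * X) - X * ((b * a) * mat H)) * b := by noncomm_ring
      _ = α H • (a * X * b) := by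
        rw [hba, one_mul, one_mul, hX.2 H, mul_smul_comm, smul_mul_assoc]) hY

/-- The flow `Ad(exp(-s H₀))` contracts `𝔫`. -/
theorem tendsto_flow_of_mem_nilp {H₀ : 𝔞} {Y : Matrix (Fin n) (Fin n) ℂ} (hY : Y ∈ nilp 𝔞 H₀ 1) :
    Tendsto (fun s : ℝ => (expGL (-s • mat H₀)).val * Y * ((expGL (-s • mat H₀))⁻¹).val) atTop (𝓝 0) := by
  let S : Submodule ℝ (Matrix (Fin n) (Fin n) ℂ) :=
    { carrier := {Y | Tendsto (fun s : ℝ => (expGL (-s • mat H₀)).val * Y * ((expGL (-s • mat H₀))⁻¹).val)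
        atTop (𝓝 0)}
      zero_mem' := by simp
      add_mem' := fun {X Y} hX hY => by
        have := Tendsto.add hX hY
        simpa [mul_add, add_mul] using this
      smul_mem' := fun c X hX => by
        have := Tendsto.const_smul hX c
        simpa using this }
  suffices h : nilp 𝔞 H₀ 1 ≤ S from h hY
  refine iSup₂_le fun α hα X hX => ?_
  have h1 : ∀ s : ℝ, (expGL (-s • mat H₀)).val * X * ((expGL (-s • mat H₀))⁻¹).val =
      Real.exp (-(s * α H₀)) • X := fun s => by
    have := expGL_mul_of_mem_rootSpace hX (-s • H₀)
    rw [map_smul, smul_eq_mul, neg_mul] at this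
    exact this
  change Tendsto _ _ _
  simp only [h1]
  have h2 : Tendsto (fun s : ℝ => Real.exp (-(s * α H₀))) atTop (𝓝 0) :=
    Real.tendsto_exp_neg_atTop_nhds_zero.comp (tendsto_id.atTop_mul_const hα.2)
  simpa using h2.smul_const X

end RootDecomposition
end LinearReductiveGroup

/-! ### The flow `Ad(exp(-s H))` and unitary matrices -/

section Contraction
open scoped Matrix.Norms.Operator

variable {n : ℕ}

theorem eq_zero_of_tendsto_exp_mul {c L : ℂ} {r : ℝ} (hr : 0 < r)
    (h : Tendsto (fun s : ℝ => (Real.exp (s * r) : ℂ) * c) atTop (𝓝 L)) : c = 0 := by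
  by_contra hc
  have h1 : Tendsto (fun s : ℝ => Real.exp (s * r) * ‖c‖) atTop atTop :=
    (Real.tendsto_exp_atTop.comp (tendsto_id.atTop_mul_const hr)).atTop_mul_const (norm_pos_iff.2 hc)
  refine not_tendsto_nhds_of_tendsto_atTop h1 ‖L‖ (h.norm.congr fun s => ?_)
  rw [norm_mul, Complex.norm_real, Real.norm_of_nonneg (Real.exp_pos _).le]

/-- The one-parameter group `s ↦ Ad(exp(-s H))`, acting on matrices. -/
noncomputable def expFlow (H : Matrix (Fin n) (Fin n) ℂ) (s : ℝ) (g : GL (Fin n) ℂ) : GL (Fin n) ℂ :=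
  expGL (-s • H) * g * (expGL (-s • H))⁻¹

theorem expFlow_mul (H : Matrix (Fin n) (Fin n) ℂ) (s : ℝ) (g h : GL (Fin n) ℂ) :
    expFlow H s (g * h) = expFlow H s g * expFlow H s h := by
  simp only [expFlow]; group

theorem expFlow_inv (H : Matrix (Fin n) (Fin n) ℂ) (s : ℝ) (g : GL (Fin n) ℂ) :
    expFlow H s g⁻¹ = (expFlow H s g)⁻¹ := by
  simp only [expFlow]; group

theorem expFlow_expGL (H : Matrix (Fin n) (Fin n) ℂ) (s : ℝ) (Y : Matrix (Fin n) (Fin n) ℂ) :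
    expFlow H s (expGL Y) = expGL ((expGL (-s • H)).val * Y * ((expGL (-s • H))⁻¹).val) :=
  (expGL_conj _ _).symm

theorem expFlow_expGL_of_commute {H X : Matrix (Fin n) (Fin n) ℂ} (h : Commute H X) (s : ℝ) :
    expFlow H s (expGL X) = expGL X := by
  rw [expFlow, ← expGL_add (h.smul_left _), add_comm, expGL_add (h.symm.smul_right _), mul_inv_cancel_right]

/-- In an orthonormal eigenbasis of `H` the flow scales each matrix entry separately, which reduces
limits along the flow to scalar ones. -/
theorem exists_unitary_conj_expFlow {H : Matrix (Fin n) (Fin n) ℂ} (hH : star H = H) :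
    ∃ (W : GL (Fin n) ℂ) (l : Fin n → ℝ), star W = W⁻¹ ∧ ∀ (s : ℝ) (g : GL (Fin n) ℂ) (i j : Fin n),
      (W⁻¹ * expFlow H s g * W).val i j = (Real.exp (s * (l j - l i)) : ℂ) * (W⁻¹ * g * W).val i j := by
  have hH' : H.IsHermitian := hH
  obtain ⟨W, hW⟩ : ∃ W : GL (Fin n) ℂ, W.val = (hH'.eigenvectorUnitary : Matrix (Fin n) (Fin n) ℂ) ∧
      (W⁻¹).val = star (hH'.eigenvectorUnitary : Matrix (Fin n) (Fin n) ℂ) :=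
    ⟨⟨hH'.eigenvectorUnitary, star (hH'.eigenvectorUnitary : Matrix (Fin n) (Fin n) ℂ),
      Unitary.mul_star_self_of_mem hH'.eigenvectorUnitary.2,
      Unitary.star_mul_self_of_mem hH'.eigenvectorUnitary.2⟩, rfl, rfl⟩
  refine ⟨W, hH'.eigenvalues, Units.ext (by rw [Units.coe_star, hW.1, hW.2]), fun s g i j => ?_⟩
  have hspec : H = W.val * Matrix.diagonal (fun i => (hH'.eigenvalues i : ℂ)) * (W⁻¹).val := by
    rw [hW.1, hW.2]
    conv_lhs => rw [hH'.spectral_theorem]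
    rfl
  have hexp : ∀ r : ℝ, W⁻¹ * expGL (r • H) * W = expGL (Matrix.diagonal (fun i => ((r * hH'.eigenvalues i : ℝ) : ℂ))) := by
    intro r
    have h1 : r • H = W.val * Matrix.diagonal (fun i => ((r * hH'.eigenvalues i : ℝ) : ℂ)) * W.inv := by
      conv_lhs => rw [hspec]
      rw [← smul_mul_assoc, ← mul_smul_comm, ← Matrix.diagonal_smul]
      congr 3
      funext i
      simp
    rw [h1, expGL_conj]; group
  have hdiag : ∀ r : ℝ, (W⁻¹ * expGL (r • H) * W).val =
      Matrix.diagonal (fun i => (Real.exp (r * hH'.eigenvalues i) : ℂ)) := by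
    intro r
    rw [hexp, expGL_val, Matrix.exp_diagonal]
    congr 1
    funext i
    rw [Pi.coe_exp, ← Complex.exp_eq_exp_ℂ, Complex.ofReal_exp]
  have h2 : W⁻¹ * expFlow H s g * W =
      (W⁻¹ * expGL (-s • H) * W) * (W⁻¹ * g * W) * (W⁻¹ * expGL (s • H) * W) := by
    rw [expFlow, neg_smul, expGL_neg]; group
  rw [h2, Units.val_mul, Units.val_mul, hdiag, hdiag, Matrix.mul_diagonal, Matrix.diagonal_mul,
    mul_right_comm, ← Complex.ofReal_mul, ← Real.exp_add]
  congr 3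
  ring

/-- A unitary matrix which is contracted to a positive definite one is trivial. -/
theorem eq_one_of_tendsto_expFlow {H X : Matrix (Fin n) (Fin n) ℂ} (hH : star H = H) (hX : star X = X)
    {u : GL (Fin n) ℂ} (hu : star u = u⁻¹)
    (h : Tendsto (fun s => expFlow H s u) atTop (𝓝 (expGL X))) : u = 1 ∧ X = 0 := by
  obtain ⟨W, l, hW, hflow⟩ := exists_unitary_conj_expFlow hH
  have hconj : ∀ (g p : GL (Fin n) ℂ), Tendsto (fun s => expFlow H s g) atTop (𝓝 p) → ∀ i j,
      Tendsto (fun s : ℝ => (Real.exp (s * (l j - l i)) : ℂ) * (W⁻¹ * g * W).val i j) atTop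
        (𝓝 ((W⁻¹ * p * W).val i j)) := by
    intro g p hg i j
    have hc' : Continuous fun x : GL (Fin n) ℂ => W⁻¹ * x * W := by fun_prop
    have hc : Continuous fun x : GL (Fin n) ℂ => (W⁻¹ * x * W).val i j :=
      (Units.continuous_val.comp hc').matrix_elem i j
    exact ((hc.tendsto p).comp hg).congr fun s => hflow s g i j
  have h1 := hconj u _ h
  have h2 := hconj u⁻¹ _ (by simpa only [expFlow_inv] using h.inv)
  have hV : (W⁻¹ * u⁻¹ * W).val = star (W⁻¹ * u * W).val := by
    rw [← Units.coe_star]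
    congr 1
    rw [star_mul, star_mul, star_inv, hW, hu, inv_inv, mul_assoc]
  -- Where the exponent grows, convergence kills the entry of `u`. Where it decays, the transposed
  -- entry of `u⁻¹ = u*` has a growing exponent. So `u` is constant along the flow and equals its
  -- limit.
  have hoff : ∀ i j, l i ≠ l j → (W⁻¹ * u * W).val i j = 0 := by
    intro i j hij
    rcases lt_or_gt_of_ne hij with hlt | hlt
    · exact eq_zero_of_tendsto_exp_mul (sub_pos.2 hlt) (h1 i j)
    · have := eq_zero_of_tendsto_exp_mul (sub_pos.2 hlt) (h2 j i)
      rw [hV, Matrix.star_apply] at this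
      simpa using this
  have hup : u = expGL X := by
    have : W⁻¹ * u * W = W⁻¹ * expGL X * W := by
      apply Units.ext
      ext i j
      refine tendsto_nhds_unique (tendsto_const_nhds.congr fun s => ?_) (h1 i j)
      by_cases hij : l i = l j
      · simp [hij]
      · rw [hoff i j hij, mul_zero]
    simpa using this
  -- The limit is both unitary and Hermitian: `exp(-X) = exp(X)⁻¹ = exp(X)* = exp(X)`.
  have h3 : X = -X := by
    refine expGL_injective_of_isSelfAdjoint hX (by rw [star_neg, hX]) ?_
    rw [expGL_neg, ← hup, ← hu, hup, ← expGL_star, hX]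
  have h4 : X = 0 := by
    have h5 : (2 : ℝ) • X = 0 := by rw [two_smul]; nth_rewrite 1 [h3]; exact neg_add_cancel X
    exact (smul_eq_zero.1 h5).resolve_left two_ne_zero
  exact ⟨by rw [hup, h4, expGL_zero], h4⟩

theorem isCompact_setOf_star_eq_inv : IsCompact {g : GL (Fin n) ℂ | star g = g⁻¹} := by
  let S : Set (Matrix (Fin n) (Fin n) ℂ) := {A | star A * A = 1 ∧ A * star A = 1}
  have hS : IsCompact S := by
    refine IsCompact.of_isClosed_subset (isCompact_univ_pi fun _ => isCompact_univ_pi fun _ =>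
      isCompact_closedBall (0 : ℂ) 1) ?_ fun A hA => ?_
    · exact (isClosed_eq (by fun_prop) continuous_const).inter (isClosed_eq (by fun_prop) continuous_const)
    · intro i _ j _
      rw [mem_closedBall_zero_iff]
      exact entry_norm_bound_of_unitary (U := A) (Unitary.mem_iff.2 hA) i j
  have : CompactSpace S := isCompact_iff_compactSpace.1 hS
  let f : S → GL (Fin n) ℂ := fun A => ⟨A, star A.1, A.2.2, A.2.1⟩
  have hf : Continuous f := by
    rw [GL.isEmbedding_val.continuous_iff]
    exact continuous_subtype_val
  convert isCompact_range hf using 1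
  ext g
  constructor
  · intro hg
    have h1 : star g.val = (g⁻¹).val := congrArg Units.val hg
    exact ⟨⟨g.val, by rw [h1, Units.inv_mul], by rw [h1, Units.mul_inv]⟩, Units.ext rfl⟩
  · rintro ⟨A, rfl⟩
    exact Units.ext rfl

end Contraction

namespace LinearReductiveGroup
variable {n : ℕ} (G : LinearReductiveGroup n)

theorem isCompact_K : IsCompact (G.K : Set (GL (Fin n) ℂ)) :=
  isCompact_setOf_star_eq_inv.inter_left G.isClosed

instance : CompactSpace G.K := isCompact_iff_compactSpace.1 G.isCompact_K

/-! ### The Iwasawa decomposition of `G` -/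

section Iwasawa
open scoped Matrix.Norms.Operator

variable {n : ℕ} {G : LinearReductiveGroup n} {𝔞 : Submodule ℝ G.p}

theorem tendsto_expFlow_of_mem_nilp {H₀ : 𝔞} {Y : Matrix (Fin n) (Fin n) ℂ} (hY : Y ∈ nilp 𝔞 H₀ 1) :
    Tendsto (fun s => expFlow (mat H₀) s (expGL Y)) atTop (𝓝 1) := by
  have := (continuous_expGL.tendsto _).comp (tendsto_flow_of_mem_nilp hY)
  rw [expGL_zero] at this
  exact this.congr fun s => (expFlow_expGL _ _ _).symm

/-- The trace of `XY` does not change along the flow, while `X` converges and `Y` tends to zero.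
With `X ∈ 𝔞` this is the orthogonality of `𝔞` and `𝔫`; with `X = Y` it gives `tr(Y²) = 0`. -/
theorem trace_mul_eq_zero {H₀ : 𝔞} {X X' Y : Matrix (Fin n) (Fin n) ℂ}
    (hX : Tendsto (fun s : ℝ => (expGL (-s • mat H₀)).val * X * ((expGL (-s • mat H₀))⁻¹).val) atTop (𝓝 X'))
    (hY : Y ∈ nilp 𝔞 H₀ 1) : Matrix.trace (X * Y) = 0 := by
  have h1 := hX.mul (tendsto_flow_of_mem_nilp hY)
  rw [mul_zero] at h1
  have h2 : Continuous fun A : Matrix (Fin n) (Fin n) ℂ => Matrix.trace A := by fun_prop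
  have h3 := (h2.tendsto 0).comp h1
  rw [Matrix.trace_zero] at h3
  refine tendsto_nhds_unique (tendsto_const_nhds.congr fun s => ?_) h3
  have key : ∀ a : GL (Fin n) ℂ, Matrix.trace (X * Y) =
      Matrix.trace (a.val * X * (a⁻¹).val * (a.val * Y * (a⁻¹).val)) := fun a => by
    calc Matrix.trace (X * Y) = Matrix.trace ((a⁻¹).val * (a.val * (X * Y))) := by
          rw [← mul_assoc (a⁻¹).val, Units.inv_mul, one_mul]
      _ = Matrix.trace (a.val * (X * Y) * (a⁻¹).val) := Matrix.trace_mul_comm _ _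
      _ = Matrix.trace (a.val * X * ((a⁻¹).val * a.val) * Y * (a⁻¹).val) := by
          rw [Units.inv_mul, mul_one, mul_assoc a.val X]
      _ = _ := by simp only [mul_assoc]
  exact key _

theorem trace_mat_mul_eq_zero (h𝔞 : G.IsMaximalAbelian 𝔞) {H₀ : 𝔞} (H : 𝔞) {Y : Matrix (Fin n) (Fin n) ℂ}
    (hY : Y ∈ nilp 𝔞 H₀ 1) : Matrix.trace (mat H * Y) = 0 := by
  refine trace_mul_eq_zero (X' := mat H) (tendsto_const_nhds.congr fun s => ?_) hY
  have hc : Commute (expGL (-s • mat H₀)).val (mat H) := by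
    rw [expGL_val]
    exact ((h𝔞.commute H₀ H).smul_left _).exp_left
  rw [hc.eq, mul_assoc, Units.mul_inv, mul_one]

theorem re_trace_mat_mul_skew (H : 𝔞) (Z : G.skewAlg) :
    (Matrix.trace (mat H * (Z : Matrix (Fin n) (Fin n) ℂ))).re = 0 := by
  have h1 : Matrix.trace (star (mat H * (Z : Matrix (Fin n) (Fin n) ℂ))) = -Matrix.trace (mat H * (Z : Matrix (Fin n) (Fin n) ℂ)) := by
    rw [star_mul, Z.2.2, star_mat, neg_mul, Matrix.trace_neg, Matrix.trace_mul_comm]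
  rw [Matrix.star_eq_conjTranspose, Matrix.trace_conjTranspose] at h1
  have := congrArg Complex.re h1
  simp only [RCLike.star_def, Complex.conj_re, Complex.neg_re] at this
  linarith

variable (𝔞) in
/-- The sum map `𝔨 × 𝔞 × 𝔫 → 𝔤`. -/
noncomputable def iwasawaSum (H₀ : 𝔞) : (G.skewAlg × 𝔞 × nilp 𝔞 H₀ 1) →ₗ[ℝ] G.lieAlg where
  toFun e := ⟨(e.1 : Matrix (Fin n) (Fin n) ℂ) + mat e.2.1 + (e.2.2 : Matrix (Fin n) (Fin n) ℂ),
    G.lieAlg.add_mem (G.lieAlg.add_mem e.1.2.1 (mat_mem _)) (nilp_le_lieAlg _ _ e.2.2.2)⟩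
  map_add' e e' := Subtype.ext (by
    simp only [Prod.fst_add, Prod.snd_add, Submodule.coe_add, mat]
    abel)
  map_smul' c e := Subtype.ext (by simp [mat])

theorem iwasawaSum_coe (H₀ : 𝔞) (e : G.skewAlg × 𝔞 × nilp 𝔞 H₀ 1) :
    (iwasawaSum 𝔞 H₀ e : Matrix (Fin n) (Fin n) ℂ) =
      (e.1 : Matrix (Fin n) (Fin n) ℂ) + mat e.2.1 + (e.2.2 : Matrix (Fin n) (Fin n) ℂ) := rfl

/-- Both `𝔨` and `𝔫` are orthogonal to `𝔞`. This is why the projection along `𝔨 ⊕ 𝔫`, which the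
Iwasawa decomposition produces, can be replaced by the orthogonal projection implicit in `χ ∈ 𝔞*`.
-/
theorem re_trace_mat_mul_iwasawaSum (h𝔞 : G.IsMaximalAbelian 𝔞) {H₀ : 𝔞} (H : 𝔞)
    (e : G.skewAlg × 𝔞 × nilp 𝔞 H₀ 1) :
    (Matrix.trace (mat H * (iwasawaSum 𝔞 H₀ e : Matrix (Fin n) (Fin n) ℂ))).re =
      (Matrix.trace (mat H * mat e.2.1)).re := by
  rw [iwasawaSum_coe, mul_add, mul_add, Matrix.trace_add, Matrix.trace_add,
    trace_mat_mul_eq_zero h𝔞 H e.2.2.2, add_zero, Complex.add_re, re_trace_mat_mul_skew, zero_add]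

theorem eq_zero_of_re_trace_star_mul_self {X : Matrix (Fin n) (Fin n) ℂ} (h : (Matrix.trace (star X * X)).re = 0) :
    X = 0 := by
  obtain ⟨c, hc⟩ := exists_inner_core (⊤ : Submodule ℝ (Matrix (Fin n) (Fin n) ℂ))
  exact congrArg Subtype.val (c.definite ⟨X, trivial⟩ (by rw [hc]; exact h))

theorem iwasawaSum_bijective (h𝔞 : G.IsMaximalAbelian 𝔞) {H₀ : 𝔞} (hH₀ : IsChamberElement 𝔞 H₀) :
    Function.Bijective (iwasawaSum 𝔞 H₀) := by
  refine ⟨?_, fun X => ?_⟩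
  · suffices hker : ∀ e, iwasawaSum 𝔞 H₀ e = 0 → e = 0 from fun e e' h => sub_eq_zero.1 <| hker _ <| by
      refine (LinearMap.map_sub (iwasawaSum 𝔞 H₀) e e').trans ?_
      rw [h, sub_self]
    intro e he
    have he' : (e.1 : Matrix (Fin n) (Fin n) ℂ) + mat e.2.1 + (e.2.2 : Matrix (Fin n) (Fin n) ℂ) = 0 :=
      congrArg Subtype.val he
    -- Pairing the relation `Z + H + Y = 0` with `H` leaves `tr(H²) = 0`.
    have hH : e.2.1 = 0 := by
      have := re_trace_mat_mul_iwasawaSum h𝔞 e.2.1 e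
      rw [iwasawaSum_coe, he', mul_zero, Matrix.trace_zero, Complex.zero_re] at this
      refine Subtype.ext (Subtype.ext (eq_zero_of_re_trace_star_mul_self (X := mat e.2.1) ?_))
      rw [star_mat, ← this]
    rw [hH] at he'
    have he2 : (e.1 : Matrix (Fin n) (Fin n) ℂ) + (e.2.2 : Matrix (Fin n) (Fin n) ℂ) = 0 := by
      simpa [mat] using he'
    -- Now `Y = -Z` is skew-Hermitian, so `tr(Y* Y) = -tr(Y²) = 0`.
    have hY : (e.2.2 : Matrix (Fin n) (Fin n) ℂ) = 0 := by
      refine eq_zero_of_re_trace_star_mul_self ?_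
      have h1 : star (e.2.2 : Matrix (Fin n) (Fin n) ℂ) = -e.2.2 := by
        rw [eq_neg_of_add_eq_zero_right he2, star_neg, e.1.2.2]
      rw [h1, neg_mul, Matrix.trace_neg, trace_mul_eq_zero (tendsto_flow_of_mem_nilp e.2.2.2) e.2.2.2]
      simp
    rw [hY, add_zero] at he2
    exact Prod.ext (Subtype.ext he2) (Prod.ext hH (Subtype.ext hY))
  · obtain ⟨Z, H, Y, h⟩ := exists_eq_add_of_mem_lieAlg h𝔞 hH₀ X.2
    exact ⟨(Z, H, Y), Subtype.ext h.symm⟩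

/-- The decomposition `𝔤 = 𝔨 ⊕ 𝔞 ⊕ 𝔫`. -/
noncomputable def iwasawaEquiv (h𝔞 : G.IsMaximalAbelian 𝔞) {H₀ : 𝔞} (hH₀ : IsChamberElement 𝔞 H₀) :
    (G.skewAlg × 𝔞 × nilp 𝔞 H₀ 1) ≃ₗ[ℝ] G.lieAlg :=
  LinearEquiv.ofBijective _ (iwasawaSum_bijective h𝔞 hH₀)

theorem expGL_skew_mem (Z : G.skewAlg) : expGL (Z : Matrix (Fin n) (Fin n) ℂ) ∈ G.K :=
  ⟨G.expGL_mem Z.2.1, by rw [← expGL_star, Z.2.2, expGL_neg]⟩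

/-- The projection `𝔤 → 𝔞` along `𝔨 ⊕ 𝔫`. -/
noncomputable def iwasawaLinear (h𝔞 : G.IsMaximalAbelian 𝔞) {H₀ : 𝔞} (hH₀ : IsChamberElement 𝔞 H₀) :
    G.lieAlg →ₗ[ℝ] 𝔞 :=
  LinearMap.fst ℝ _ _ ∘ₗ LinearMap.snd ℝ _ _ ∘ₗ (iwasawaEquiv h𝔞 hH₀).symm.toLinearMap

theorem re_trace_mat_mul_iwasawaLinear (h𝔞 : G.IsMaximalAbelian 𝔞) {H₀ : 𝔞} (hH₀ : IsChamberElement 𝔞 H₀)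
    (H : 𝔞) (X : G.lieAlg) : (Matrix.trace (mat H * mat (iwasawaLinear h𝔞 hH₀ X))).re =
      (Matrix.trace (mat H * (X : Matrix (Fin n) (Fin n) ℂ))).re := by
  have := re_trace_mat_mul_iwasawaSum h𝔞 H ((iwasawaEquiv h𝔞 hH₀).symm X)
  have h2 : iwasawaSum 𝔞 H₀ ((iwasawaEquiv h𝔞 hH₀).symm X) = X := (iwasawaEquiv h𝔞 hH₀).apply_symm_apply X
  rw [h2] at this
  exact this.symm

/-- The parametrisation of `G` near the identity given by the Iwasawa decomposition. -/
noncomputable def iwasawaParam {H₀ : 𝔞} (e : G.skewAlg × 𝔞 × nilp 𝔞 H₀ 1) : GL (Fin n) ℂ :=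
  expGL (e.1 : Matrix (Fin n) (Fin n) ℂ) * expGL (mat e.2.1) * expGL (e.2.2 : Matrix (Fin n) (Fin n) ℂ)

/-- The differential at `0` of `(Z, H, Y) ↦ e^Z e^H e^Y` is the sum map, a bijection `𝔨 × 𝔞 × 𝔫 →
𝔤`. Taking the sum in `𝔤` as the parameter makes this differential the inclusion of `𝔤`, so that `D`
is the identity on `𝔤`. -/
theorem exists_iwasawa_local_inverse (h𝔞 : G.IsMaximalAbelian 𝔞) {H₀ : 𝔞} (hH₀ : IsChamberElement 𝔞 H₀) :
    ∃ (Θ : Matrix (Fin n) (Fin n) ℂ → G.lieAlg) (D : Matrix (Fin n) (Fin n) ℂ →L[ℝ] G.lieAlg),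
      HasStrictFDerivAt Θ D 1 ∧ Θ 1 = 0 ∧ (∀ e : G.lieAlg, D e = e) ∧
      ∀ᶠ g in 𝓝 (1 : GL (Fin n) ℂ), g ∈ G.toSubgroup →
        iwasawaParam ((iwasawaEquiv h𝔞 hH₀).symm (Θ g.val)) = g := by
  let S := iwasawaEquiv h𝔞 hH₀
  let A₁ : G.lieAlg →ₗ[ℝ] Matrix (Fin n) (Fin n) ℂ :=
    G.skewAlg.subtype ∘ₗ LinearMap.fst ℝ _ _ ∘ₗ S.symm.toLinearMap
  let A₂ : G.lieAlg →ₗ[ℝ] Matrix (Fin n) (Fin n) ℂ :=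
    G.p.subtype ∘ₗ 𝔞.subtype ∘ₗ LinearMap.fst ℝ _ _ ∘ₗ LinearMap.snd ℝ _ _ ∘ₗ S.symm.toLinearMap
  let A₃ : G.lieAlg →ₗ[ℝ] Matrix (Fin n) (Fin n) ℂ :=
    (nilp 𝔞 H₀ 1).subtype ∘ₗ LinearMap.snd ℝ _ _ ∘ₗ LinearMap.snd ℝ _ _ ∘ₗ S.symm.toLinearMap
  have hsum : ∀ X, A₁ X + A₂ X + A₃ X = X := fun X => by
    have h := iwasawaSum_coe H₀ (S.symm X)
    have h2 : iwasawaSum 𝔞 H₀ (S.symm X) = X := S.apply_symm_apply X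
    rw [h2] at h
    exact h.symm
  have hF : HasStrictFDerivAt (fun X : G.lieAlg => (iwasawaParam (S.symm X)).val) G.lieAlg.subtypeL 0 := by
    have h := ((hasStrictFDerivAt_exp_comp (LinearMap.toContinuousLinearMap A₁)).mul'
      (hasStrictFDerivAt_exp_comp (LinearMap.toContinuousLinearMap A₂))).mul'
      (hasStrictFDerivAt_exp_comp (LinearMap.toContinuousLinearMap A₃))
    have heq : (fun X : G.lieAlg => (iwasawaParam (S.symm X)).val) = fun X : G.lieAlg =>
        NormedSpace.exp (A₁ X) * NormedSpace.exp (A₂ X) * NormedSpace.exp (A₃ X) := by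
      funext X
      simp only [iwasawaParam, Units.val_mul, expGL_val]
      rfl
    rw [heq]
    refine h.congr_fderiv (ContinuousLinearMap.ext fun q => ?_)
    change (NormedSpace.exp (A₁ 0) * NormedSpace.exp (A₂ 0)) * A₃ q +
      (NormedSpace.exp (A₁ 0) * A₂ q + A₁ q * NormedSpace.exp (A₂ 0)) * NormedSpace.exp (A₃ 0) = q
    rw [map_zero, map_zero, map_zero, ← hsum]
    simp only [NormedSpace.exp_zero, one_mul, mul_one]
    abel
  obtain ⟨Θ, D, h1, h2, h3, h4⟩ := G.exists_local_inverse (fun X : G.lieAlg => iwasawaParam (S.symm X))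
    G.lieAlg.subtypeL hF (by simp [iwasawaParam, expGL_zero, mat])
    (fun X => G.toSubgroup.mul_mem (G.toSubgroup.mul_mem (expGL_skew_mem _).1 (G.expGL_mem (mat_mem _)))
      (G.expGL_mem (nilp_le_lieAlg _ _ (S.symm X).2.2.2)))
    Subtype.val_injective (Submodule.range_subtype _)
  exact ⟨Θ, D, h1, h2, h3, h4⟩

/-- `N = exp 𝔫` is closed under multiplication. -/
theorem exists_expGL_mul_expGL (h𝔞 : G.IsMaximalAbelian 𝔞) {H₀ : 𝔞} (hH₀ : IsChamberElement 𝔞 H₀)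
    {Y Y' : Matrix (Fin n) (Fin n) ℂ} (hY : Y ∈ nilp 𝔞 H₀ 1) (hY' : Y' ∈ nilp 𝔞 H₀ 1) :
    ∃ Y'' ∈ nilp 𝔞 H₀ 1, expGL Y * expGL Y' = expGL Y'' := by
  obtain ⟨Θ, -, -, -, -, hΘ⟩ := exists_iwasawa_local_inverse h𝔞 hH₀
  have h1 : Tendsto (fun s => expFlow (mat H₀) s (expGL Y * expGL Y')) atTop (𝓝 1) := by
    have := (tendsto_expFlow_of_mem_nilp hY).mul (tendsto_expFlow_of_mem_nilp hY')
    rw [one_mul] at this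
    exact this.congr fun s => (expFlow_mul _ _ _ _).symm
  -- The product may be far from `1`, but the flow brings it into the neighbourhood where Iwasawa
  -- coordinates exist.
  obtain ⟨s, hs⟩ := (h1.eventually hΘ).exists
  have hA : expGL (-s • mat H₀) ∈ G.toSubgroup := mat_mem H₀ _
  have hmem : expFlow (mat H₀) s (expGL Y * expGL Y') ∈ G.toSubgroup :=
    G.toSubgroup.mul_mem (G.toSubgroup.mul_mem hA (G.toSubgroup.mul_mem (G.expGL_mem (nilp_le_lieAlg _ _ hY))
      (G.expGL_mem (nilp_le_lieAlg _ _ hY')))) (G.toSubgroup.inv_mem hA)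
  have h2 := hs hmem
  set e := (iwasawaEquiv h𝔞 hH₀).symm (Θ (expFlow (mat H₀) s (expGL Y * expGL Y')).val)
  have h3 : expGL (e.1 : Matrix (Fin n) (Fin n) ℂ) = expFlow (mat H₀) s (expGL Y * expGL Y') *
      expGL (-(e.2.2 : Matrix (Fin n) (Fin n) ℂ)) * expGL (-mat e.2.1) := by
    rw [← h2, expGL_neg, expGL_neg, iwasawaParam]; group
  -- Continuing the flow contracts the unitary coordinate to `exp(-H)`, `H` being the coordinate in
  -- `𝔞`. Hence both coordinates are trivial and only the one in `𝔫` remains.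
  have h4 : Tendsto (fun r => expFlow (mat H₀) r (expGL (e.1 : Matrix (Fin n) (Fin n) ℂ))) atTop
      (𝓝 (expGL (-mat e.2.1))) := by
    have e1 : Tendsto (fun r => expFlow (mat H₀) r (expFlow (mat H₀) s (expGL Y * expGL Y'))) atTop (𝓝 1) := by
      refine (h1.comp (tendsto_atTop_add_const_right _ s tendsto_id)).congr fun r => ?_
      simp only [Function.comp_apply, expFlow, id, neg_add, expGL_add_smul]
      group
    have e2 := tendsto_expFlow_of_mem_nilp ((nilp 𝔞 H₀ 1).neg_mem e.2.2.2)
    have e3 : Tendsto (fun r => expFlow (mat H₀) r (expGL (-mat e.2.1))) atTop (𝓝 (expGL (-mat e.2.1))) :=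
      tendsto_const_nhds.congr fun r => (expFlow_expGL_of_commute (h𝔞.commute _ _).neg_right r).symm
    have := (e1.mul e2).mul e3
    rw [one_mul, one_mul] at this
    refine this.congr fun r => ?_
    rw [h3, expFlow_mul _ r (_ * _), expFlow_mul _ r (expFlow _ _ _)]
  obtain ⟨h5, h6⟩ := eq_one_of_tendsto_expFlow (star_mat H₀) (by rw [star_neg, star_mat])
    (expGL_skew_mem e.1).2 h4
  have h7 : expFlow (mat H₀) s (expGL Y * expGL Y') = expGL (e.2.2 : Matrix (Fin n) (Fin n) ℂ) := by
    rw [← h2, iwasawaParam, h5, neg_eq_zero.1 h6, expGL_zero, one_mul, one_mul]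
  -- The flow is undone by `Ad(exp(s H₀))`, which preserves `𝔫`.
  refine ⟨_, expGL_conj_mem_nilp (s • H₀) e.2.2.2, ?_⟩
  have h8 := expGL_conj (expGL (mat (s • H₀))) (e.2.2 : Matrix (Fin n) (Fin n) ℂ)
  refine Eq.trans ?_ h8.symm
  rw [← h7, expFlow, neg_smul, expGL_neg]
  change _ = expGL (s • mat H₀) * _ * (expGL (s • mat H₀))⁻¹
  group

variable (𝔞) in
/-- `g = k exp(H) ν` with `ν ∈ N`, where `q = (k, H)`. -/
def IsIwasawa (H₀ : 𝔞) (g : GL (Fin n) ℂ) (q : G.K × 𝔞) : Prop :=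
  ∃ Y ∈ nilp 𝔞 H₀ 1, g = q.1 * expGL (mat q.2) * expGL Y

/-- From `k e^H n = k' e^H' n'` the unitary matrix `k'⁻¹ k = e^H' n' n⁻¹ e^-H` flows to `e^(H' -
H)`. Such a limit forces `k = k'` and `H = H'`. -/
theorem IsIwasawa.unique (h𝔞 : G.IsMaximalAbelian 𝔞) {H₀ : 𝔞} {g : GL (Fin n) ℂ} {q q' : G.K × 𝔞}
    (h : IsIwasawa 𝔞 H₀ g q) (h' : IsIwasawa 𝔞 H₀ g q') : q = q' := by
  obtain ⟨Y, hY, h⟩ := h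
  obtain ⟨Y', hY', h'⟩ := h'
  have hu : (q'.1 : GL (Fin n) ℂ)⁻¹ * q.1 = expGL (mat q'.2) * expGL Y' * expGL (-Y) * expGL (-mat q.2) := by
    rw [h] at h'
    rw [expGL_neg, expGL_neg, eq_mul_inv_iff_mul_eq, eq_mul_inv_iff_mul_eq, mul_assoc, mul_assoc,
      inv_mul_eq_iff_eq_mul, ← mul_assoc, h', mul_assoc]
  have key : ∀ H : 𝔞, ∀ s, expFlow (mat H₀) s (expGL (mat H)) = expGL (mat H) := fun H s =>
    expFlow_expGL_of_commute (h𝔞.commute _ _) s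
  have h1 : Tendsto (fun s => expFlow (mat H₀) s ((q'.1 : GL (Fin n) ℂ)⁻¹ * q.1)) atTop
      (𝓝 (expGL (mat (q'.2 - q.2)))) := by
    have e1 := ((tendsto_const_nhds (x := expGL (mat q'.2)) (f := atTop)).mul
      (tendsto_expFlow_of_mem_nilp hY')).mul (tendsto_expFlow_of_mem_nilp ((nilp 𝔞 H₀ 1).neg_mem hY))
    have e2 := e1.mul (tendsto_const_nhds (x := expGL (mat (-q.2))))
    rw [mul_one, mul_one, ← expGL_add (h𝔞.commute _ _)] at e2
    have e3 : mat q'.2 + mat (-q.2) = mat (q'.2 - q.2) := by rw [sub_eq_add_neg q'.2]; rfl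
    rw [e3] at e2
    refine e2.congr fun s => ?_
    rw [hu, expFlow_mul, expFlow_mul, expFlow_mul, key]
    congr 1
    exact (key (-q.2) s).symm
  have hK : star ((q'.1 : GL (Fin n) ℂ)⁻¹ * q.1) = ((q'.1 : GL (Fin n) ℂ)⁻¹ * q.1)⁻¹ :=
    (G.K.mul_mem (G.K.inv_mem q'.1.2) q.1.2).2
  obtain ⟨h2, h3⟩ := eq_one_of_tendsto_expFlow (star_mat H₀) (star_mat _) hK h1
  refine Prod.ext (Subtype.ext (inv_mul_eq_one.1 h2).symm) ?_
  have : q'.2 - q.2 = 0 := Subtype.ext (Subtype.ext h3)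
  exact (sub_eq_zero.1 this).symm

theorem IsIwasawa.left {H₀ : 𝔞} {g : GL (Fin n) ℂ} {q : G.K × 𝔞} (h : IsIwasawa 𝔞 H₀ g q) (k : G.K) :
    IsIwasawa 𝔞 H₀ (k * g) (k * q.1, q.2) := by
  obtain ⟨Y, hY, rfl⟩ := h
  exact ⟨Y, hY, by simp only [Subgroup.coe_mul, mul_assoc]⟩

/-- Since `exp 𝔞` normalises `N`, the old unipotent factor can be moved past `exp H` and absorbed
into the new one. -/
theorem IsIwasawa.right (h𝔞 : G.IsMaximalAbelian 𝔞) {H₀ : 𝔞} (hH₀ : IsChamberElement 𝔞 H₀) {g : GL (Fin n) ℂ}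
    {q : G.K × 𝔞} (h : IsIwasawa 𝔞 H₀ g q) (H : 𝔞) {Y : Matrix (Fin n) (Fin n) ℂ} (hY : Y ∈ nilp 𝔞 H₀ 1) :
    IsIwasawa 𝔞 H₀ (g * expGL (mat H) * expGL Y) (q.1, q.2 + H) := by
  obtain ⟨Y', hY', rfl⟩ := h
  have h1 := expGL_conj_mem_nilp (-H) hY'
  obtain ⟨Y'', hY'', e⟩ := exists_expGL_mul_expGL h𝔞 hH₀ h1 hY
  refine ⟨Y'', hY'', ?_⟩
  have h2 : expGL ((expGL (mat (-H))).val * Y' * ((expGL (mat (-H)))⁻¹).val) =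
      (expGL (mat H))⁻¹ * expGL Y' * expGL (mat H) := by
    refine (expGL_conj _ _).trans ?_
    have : expGL (mat (-H)) = (expGL (mat H))⁻¹ := expGL_neg (mat H)
    rw [this, inv_inv]
  have h3 : expGL (mat (q.2 + H)) = expGL (mat q.2) * expGL (mat H) := expGL_add (h𝔞.commute _ _)
  rw [← e, h2, h3]
  group

/-- `M` centralises `exp 𝔞` and normalises `N`. This makes the principal series operators compatible
with the equivariance under `M`. -/
theorem IsIwasawa.mul_M {H₀ : 𝔞} {g : GL (Fin n) ℂ} {q : G.K × 𝔞} (h : IsIwasawa 𝔞 H₀ g q) {m : G.K}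
    (hm : m ∈ M 𝔞) : IsIwasawa 𝔞 H₀ (g * m) (q.1 * m, q.2) := by
  obtain ⟨Y, hY, rfl⟩ := h
  have hm' := (M 𝔞).inv_mem hm
  refine ⟨_, M_conj_mem_nilp hm' hY, ?_⟩
  have h1 := expGL_conj ((m⁻¹ : G.K) : GL (Fin n) ℂ) Y
  have h2 := expGL_conj (m : GL (Fin n) ℂ) (mat q.2)
  have h3 : (m : GL (Fin n) ℂ).val * mat q.2 * (m : GL (Fin n) ℂ).inv = mat q.2 := conj_eq_of_mem_M hm q.2
  rw [h3] at h2
  have h4 : expGL (((m⁻¹ : G.K) : GL (Fin n) ℂ).val * Y * (((m⁻¹ : G.K) : GL (Fin n) ℂ)⁻¹).val) =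
      (m : GL (Fin n) ℂ)⁻¹ * expGL Y * m := by
    refine h1.trans ?_
    simp
  rw [h4, Subgroup.coe_mul]
  have h5 : (m : GL (Fin n) ℂ) * expGL (mat q.2) = expGL (mat q.2) * m := by
    nth_rewrite 2 [h2]
    group
  calc _ = (q.1 : GL (Fin n) ℂ) * (expGL (mat q.2) * m) * ((m : GL (Fin n) ℂ)⁻¹ * expGL Y * m) := by group
    _ = _ := by rw [← h5]; group

theorem isIwasawa_of_param {H₀ : 𝔞} (e : G.skewAlg × 𝔞 × nilp 𝔞 H₀ 1) :
    IsIwasawa 𝔞 H₀ (iwasawaParam e) (⟨_, expGL_skew_mem e.1⟩, e.2.1) :=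
  ⟨e.2.2, e.2.2.2, rfl⟩

/-- The Iwasawa decomposition. -/
theorem exists_isIwasawa (h𝔞 : G.IsMaximalAbelian 𝔞) {H₀ : 𝔞} (hH₀ : IsChamberElement 𝔞 H₀)
    {g : GL (Fin n) ℂ} (hg : g ∈ G.toSubgroup) : ∃ q, IsIwasawa 𝔞 H₀ g q := by
  obtain ⟨Θ, -, -, -, -, hΘ⟩ := exists_iwasawa_local_inverse h𝔞 hH₀
  -- Compactness of `K` provides one neighbourhood of `1` whose conjugates by all of `K` have
  -- Iwasawa decompositions.
  have hconj : ∀ᶠ x in 𝓝 (1 : GL (Fin n) ℂ), ∀ k ∈ (G.K : Set (GL (Fin n) ℂ)),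
      k⁻¹ * x * k ∈ G.toSubgroup → ∃ q, IsIwasawa 𝔞 H₀ (k⁻¹ * x * k) q := by
    refine G.isCompact_K.eventually_forall_of_forall_eventually fun k _ => ?_
    have hc : Continuous fun z : GL (Fin n) ℂ × GL (Fin n) ℂ => z.2⁻¹ * z.1 * z.2 := by fun_prop
    have hc1 := hc.tendsto (1, k)
    simp only [mul_one, inv_mul_cancel] at hc1
    filter_upwards [hc1.eventually hΘ] with z hz hzG
    rw [← hz hzG]
    exact ⟨_, isIwasawa_of_param _⟩
  -- If `y = k a n`, then `x y = k (k⁻¹ x k) a n`, so it is enough to decompose the conjugate `k⁻¹ x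
  -- k`.
  have hstep : ∀ x : GL (Fin n) ℂ, x ∈ G.toSubgroup → (∀ k ∈ (G.K : Set (GL (Fin n) ℂ)),
      k⁻¹ * x * k ∈ G.toSubgroup → ∃ q, IsIwasawa 𝔞 H₀ (k⁻¹ * x * k) q) →
      ∀ y, (∃ q, IsIwasawa 𝔞 H₀ y q) → ∃ q, IsIwasawa 𝔞 H₀ (x * y) q := by
    rintro x hxG hx y ⟨q, Y, hY, rfl⟩
    obtain ⟨q', hq'⟩ := hx q.1 q.1.2 (G.toSubgroup.mul_mem (G.toSubgroup.mul_mem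
      (G.toSubgroup.inv_mem q.1.2.1) hxG) q.1.2.1)
    have h1 := (hq'.left q.1).right h𝔞 hH₀ q.2 hY
    refine ⟨(q.1 * q'.1, q'.2 + q.2), ?_⟩
    convert h1 using 1
    group
  have : PreconnectedSpace G.toSubgroup := isPreconnected_iff_preconnectedSpace.1 G.isConnected.isPreconnected
  -- Having a decomposition is a locally constant property on `G`, because `x y⁻¹` and `y x⁻¹` are
  -- both close to `1`. Connectedness concludes.
  have hloc : ∀ y : G.toSubgroup, ∀ᶠ x : G.toSubgroup in 𝓝 y,
      ((∃ q, IsIwasawa 𝔞 H₀ (x : GL (Fin n) ℂ) q) ↔ ∃ q, IsIwasawa 𝔞 H₀ (y : GL (Fin n) ℂ) q) := by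
    intro y
    have t1 : Tendsto (fun x : G.toSubgroup => (x : GL (Fin n) ℂ) * (y : GL (Fin n) ℂ)⁻¹) (𝓝 y) (𝓝 1) := by
      have : Continuous fun x : G.toSubgroup => (x : GL (Fin n) ℂ) * (y : GL (Fin n) ℂ)⁻¹ := by fun_prop
      simpa using this.tendsto y
    have t2 : Tendsto (fun x : G.toSubgroup => (y : GL (Fin n) ℂ) * (x : GL (Fin n) ℂ)⁻¹) (𝓝 y) (𝓝 1) := by
      simpa using t1.inv
    filter_upwards [t1.eventually hconj, t2.eventually hconj] with x h1 h2
    constructor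
    · intro h
      have := hstep _ (G.toSubgroup.mul_mem y.2 (G.toSubgroup.inv_mem x.2)) h2 _ h
      simpa using this
    · intro h
      have := hstep _ (G.toSubgroup.mul_mem x.2 (G.toSubgroup.inv_mem y.2)) h1 _ h
      simpa using this
  have hclopen : IsClopen {x : G.toSubgroup | ∃ q, IsIwasawa 𝔞 H₀ (x : GL (Fin n) ℂ) q} := by
    constructor
    · rw [← isOpen_compl_iff, isOpen_iff_mem_nhds]
      intro y hy
      filter_upwards [hloc y] with x hx h
      exact hy (hx.1 h)
    · rw [isOpen_iff_mem_nhds]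
      intro y hy
      filter_upwards [hloc y] with x hx
      exact hx.2 hy
  have huniv := hclopen.eq_univ ⟨1, (1, 0), 0, Submodule.zero_mem _, by simp [expGL_zero, mat]⟩
  exact Set.eq_univ_iff_forall.1 huniv ⟨g, hg⟩

variable (𝔞) in
/-- The Iwasawa projections of `G`. -/
noncomputable def iwasawaProj (H₀ : 𝔞) (g : GL (Fin n) ℂ) : G.K × 𝔞 :=
  Classical.epsilon (IsIwasawa 𝔞 H₀ g)

theorem isIwasawa_iwasawaProj (h𝔞 : G.IsMaximalAbelian 𝔞) {H₀ : 𝔞} (hH₀ : IsChamberElement 𝔞 H₀)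
    {g : GL (Fin n) ℂ} (hg : g ∈ G.toSubgroup) : IsIwasawa 𝔞 H₀ g (iwasawaProj 𝔞 H₀ g) :=
  Classical.epsilon_spec (exists_isIwasawa h𝔞 hH₀ hg)

theorem IsIwasawa.proj_eq (h𝔞 : G.IsMaximalAbelian 𝔞) {H₀ : 𝔞}
    {g : GL (Fin n) ℂ} {q : G.K × 𝔞} (h : IsIwasawa 𝔞 H₀ g q) : iwasawaProj 𝔞 H₀ g = q :=
  IsIwasawa.unique h𝔞 (Classical.epsilon_spec ⟨q, h⟩) h

/-- The Iwasawa projections are given near the identity by differentiable functions. -/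
theorem exists_iwasawaProj_eq (h𝔞 : G.IsMaximalAbelian 𝔞) {H₀ : 𝔞} (hH₀ : IsChamberElement 𝔞 H₀) :
    ∃ (Θ : Matrix (Fin n) (Fin n) ℂ → G.lieAlg) (D : Matrix (Fin n) (Fin n) ℂ →L[ℝ] G.lieAlg),
      HasStrictFDerivAt Θ D 1 ∧ Θ 1 = 0 ∧ (∀ e : G.lieAlg, D e = e) ∧
      ∀ᶠ g in 𝓝 (1 : GL (Fin n) ℂ), g ∈ G.toSubgroup → iwasawaProj 𝔞 H₀ g =
        (⟨_, expGL_skew_mem ((iwasawaEquiv h𝔞 hH₀).symm (Θ g.val)).1⟩, iwasawaLinear h𝔞 hH₀ (Θ g.val)) := by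
  obtain ⟨Θ, D, h1, h2, h3, h4⟩ := exists_iwasawa_local_inverse h𝔞 hH₀
  refine ⟨Θ, D, h1, h2, h3, ?_⟩
  filter_upwards [h4] with g hg hgG
  have := isIwasawa_of_param ((iwasawaEquiv h𝔞 hH₀).symm (Θ g.val))
  rw [hg hgG] at this
  exact this.proj_eq h𝔞

theorem tendsto_iwasawaProj_one (h𝔞 : G.IsMaximalAbelian 𝔞) {H₀ : 𝔞} (hH₀ : IsChamberElement 𝔞 H₀) :
    Tendsto (iwasawaProj 𝔞 H₀) (𝓝[G.toSubgroup] 1) (𝓝 (1, 0)) := by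
  obtain ⟨Θ, D, h1, h2, -, h4⟩ := exists_iwasawaProj_eq h𝔞 hH₀
  have h5 : Tendsto (fun g : GL (Fin n) ℂ => Θ g.val) (𝓝 1) (𝓝 0) := by
    have := h1.continuousAt.tendsto.comp (Units.continuous_val.tendsto (1 : GL (Fin n) ℂ))
    rwa [h2] at this
  let A : G.lieAlg →ₗ[ℝ] G.skewAlg := LinearMap.fst ℝ _ _ ∘ₗ (iwasawaEquiv h𝔞 hH₀).symm.toLinearMap
  have hA : Continuous fun X => A X := A.continuous_of_finiteDimensional
  have hB : Continuous fun X => iwasawaLinear h𝔞 hH₀ X :=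
    LinearMap.continuous_of_finiteDimensional (𝕜 := ℝ) (E := G.lieAlg) (F' := 𝔞) (iwasawaLinear h𝔞 hH₀)
  have h6 : Continuous fun X : G.lieAlg =>
      ((⟨_, expGL_skew_mem (A X)⟩, iwasawaLinear h𝔞 hH₀ X) : G.K × 𝔞) :=
    Continuous.prodMk (Continuous.subtype_mk (continuous_expGL.comp (continuous_subtype_val.comp hA)) _) hB
  have h7 := (h6.tendsto 0).comp h5
  have h8 : ((⟨_, expGL_skew_mem (A 0)⟩, iwasawaLinear h𝔞 hH₀ 0) : G.K × 𝔞) = (1, 0) :=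
    Prod.ext (Subtype.ext (by simp [expGL_zero])) (map_zero _)
  rw [h8] at h7
  refine (h7.mono_left nhdsWithin_le_nhds).congr' ?_
  filter_upwards [h4.filter_mono nhdsWithin_le_nhds, self_mem_nhdsWithin] with g hg hgG
  exact (hg hgG).symm

theorem iwasawaProj_K_mul (h𝔞 : G.IsMaximalAbelian 𝔞) {H₀ : 𝔞} (hH₀ : IsChamberElement 𝔞 H₀)
    (k : G.K) {g : GL (Fin n) ℂ} (hg : g ∈ G.toSubgroup) :
    iwasawaProj 𝔞 H₀ (k * g) = (k * (iwasawaProj 𝔞 H₀ g).1, (iwasawaProj 𝔞 H₀ g).2) :=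
  ((isIwasawa_iwasawaProj h𝔞 hH₀ hg).left k).proj_eq h𝔞

theorem iwasawaProj_mul_M (h𝔞 : G.IsMaximalAbelian 𝔞) {H₀ : 𝔞} (hH₀ : IsChamberElement 𝔞 H₀)
    {m : G.K} (hm : m ∈ M 𝔞) {g : GL (Fin n) ℂ} (hg : g ∈ G.toSubgroup) :
    iwasawaProj 𝔞 H₀ (g * m) = ((iwasawaProj 𝔞 H₀ g).1 * m, (iwasawaProj 𝔞 H₀ g).2) :=
  ((isIwasawa_iwasawaProj h𝔞 hH₀ hg).mul_M hm).proj_eq h𝔞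

/-- Left translation by `K` and right translation by `AN` change the projections by explicit
continuous formulas, which move `g₀ = k a n` to the identity. -/
theorem continuousOn_iwasawaProj (h𝔞 : G.IsMaximalAbelian 𝔞) {H₀ : 𝔞} (hH₀ : IsChamberElement 𝔞 H₀) :
    ContinuousOn (iwasawaProj 𝔞 H₀) G.toSubgroup := by
  intro g₀ hg₀
  suffices key : ∀ q : G.K × 𝔞, IsIwasawa 𝔞 H₀ g₀ q →
      Tendsto (iwasawaProj 𝔞 H₀) (𝓝[G.toSubgroup] g₀) (𝓝 q) from key _ (isIwasawa_iwasawaProj h𝔞 hH₀ hg₀)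
  rintro ⟨k, H⟩ ⟨Y, hY, hq⟩
  have hbG : expGL (mat H) * expGL Y ∈ G.toSubgroup :=
    G.toSubgroup.mul_mem (G.expGL_mem (mat_mem _)) (G.expGL_mem (nilp_le_lieAlg _ _ hY))
  have hcG : ∀ g ∈ G.toSubgroup, (k : GL (Fin n) ℂ)⁻¹ * g * (expGL (mat H) * expGL Y)⁻¹ ∈ G.toSubgroup :=
    fun g hg => G.toSubgroup.mul_mem (G.toSubgroup.mul_mem (G.toSubgroup.inv_mem k.2.1) hg)
      (G.toSubgroup.inv_mem hbG)
  have hlim : Tendsto (fun g => (k : GL (Fin n) ℂ)⁻¹ * g * (expGL (mat H) * expGL Y)⁻¹)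
      (𝓝[G.toSubgroup] g₀) (𝓝[G.toSubgroup] 1) := by
    refine tendsto_nhdsWithin_of_tendsto_nhds_of_eventually_within _ ?_ ?_
    · have hcc : Continuous fun g => (k : GL (Fin n) ℂ)⁻¹ * g * (expGL (mat H) * expGL Y)⁻¹ := by fun_prop
      have := hcc.tendsto g₀
      have hc1 : (k : GL (Fin n) ℂ)⁻¹ * g₀ * (expGL (mat H) * expGL Y)⁻¹ = 1 := by
        rw [hq]
        group
      rw [hc1] at this
      exact this.mono_left nhdsWithin_le_nhds
    · filter_upwards [self_mem_nhdsWithin] with g hg using hcG g hg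
  have h1 := (tendsto_iwasawaProj_one h𝔞 hH₀).comp hlim
  have : ContinuousAdd 𝔞 := (Submodule.topologicalAddGroup 𝔞).toContinuousAdd
  have h2 : Continuous fun z : G.K × 𝔞 => (k * z.1, z.2 + H) :=
    (continuous_const.mul continuous_fst).prodMk (continuous_snd.add continuous_const)
  have h3 := (h2.tendsto (1, 0)).comp h1
  rw [mul_one, zero_add] at h3
  refine h3.congr' ?_
  filter_upwards [self_mem_nhdsWithin] with g hg
  have h4 := (((isIwasawa_iwasawaProj h𝔞 hH₀ (hcG g hg)).left k).right h𝔞 hH₀ H hY).proj_eq h𝔞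
  have h5 : k * ((k : GL (Fin n) ℂ)⁻¹ * g * (expGL (mat H) * expGL Y)⁻¹) * expGL (mat H) * expGL Y = g := by
    group
  rw [h5] at h4
  exact h4.symm

end Iwasawa

/-! ### Passage from `G_t` to `G` -/

section Rescaling

variable {n : ℕ} {G : LinearReductiveGroup n} {𝔞 : Submodule ℝ G.p}

/-- `dphi t` as a linear equivalence. -/
noncomputable def dphiEquiv (n : ℕ) {t : ℝ} (ht : t ≠ 0) :
    Matrix (Fin n) (Fin n) ℂ ≃ₗ[ℝ] Matrix (Fin n) (Fin n) ℂ :=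
  LinearEquiv.ofLinearMap (dphi n t) (dphi n t⁻¹) (LinearMap.ext fun X => dphi_dphi_inv ht X)
    (LinearMap.ext fun X => dphi_inv_dphi ht X)

theorem rootSpace_smul_eq_comap {t : ℝ} (ht : t ≠ 0) (α : Module.Dual ℝ 𝔞) :
    rootSpace 𝔞 t (t • α) = (rootSpace 𝔞 1 α).comap (dphiEquiv n ht).toLinearMap :=
  Submodule.ext fun _ => mem_rootSpace_smul_iff ht

theorem finrank_rootSpace_smul {t : ℝ} (ht : t ≠ 0) (α : Module.Dual ℝ 𝔞) :
    Module.finrank ℝ (rootSpace 𝔞 t (t • α)) = Module.finrank ℝ (rootSpace 𝔞 1 α) := by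
  have h : (rootSpace 𝔞 1 α).comap (dphiEquiv n ht).toLinearMap =
      (rootSpace 𝔞 1 α).map (dphiEquiv n ht).symm.toLinearMap :=
    (Submodule.map_equiv_eq_comap_symm (dphiEquiv n ht).symm _).symm
  rw [rootSpace_smul_eq_comap ht, h]
  exact LinearEquiv.finrank_map_eq _ _

theorem smul_mem_posRoots_iff {H₀ : 𝔞} {t : ℝ} (ht : 0 < t) {α : Module.Dual ℝ 𝔞} :
    t • α ∈ posRoots 𝔞 H₀ t ↔ α ∈ posRoots 𝔞 H₀ 1 := by
  have h1 : t • α ≠ 0 ↔ α ≠ 0 := by simp [ht.ne']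
  have h2 : rootSpace 𝔞 t (t • α) ≠ ⊥ ↔ rootSpace 𝔞 1 α ≠ ⊥ := by
    rw [← Submodule.one_le_finrank_iff, ← Submodule.one_le_finrank_iff, finrank_rootSpace_smul ht.ne']
  simp only [posRoots, IsRoot, Set.mem_ofPred_eq, h1, h2, LinearMap.smul_apply, smul_eq_mul,
    mul_pos_iff_of_pos_left ht]

theorem mem_nilp_iff {H₀ : 𝔞} {t : ℝ} (ht : 0 < t) {X : Matrix (Fin n) (Fin n) ℂ} :
    X ∈ nilp 𝔞 H₀ t ↔ dphi n t X ∈ nilp 𝔞 H₀ 1 := by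
  constructor
  · suffices h : nilp 𝔞 H₀ t ≤ (nilp 𝔞 H₀ 1).comap (dphi n t) from fun hX => h hX
    refine iSup₂_le fun α hα Y hY => ?_
    obtain ⟨β, rfl⟩ : ∃ β, α = t • β := ⟨t⁻¹ • α, by rw [smul_smul, mul_inv_cancel₀ ht.ne', one_smul]⟩
    exact le_iSup₂_of_le (f := fun α (_ : α ∈ posRoots 𝔞 H₀ 1) => rootSpace 𝔞 1 α) β
      ((smul_mem_posRoots_iff ht).1 hα) le_rfl ((mem_rootSpace_smul_iff ht.ne').1 hY)
  · suffices h : nilp 𝔞 H₀ 1 ≤ (nilp 𝔞 H₀ t).comap (dphi n t⁻¹) from fun hX => by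
      have := h hX
      rwa [Submodule.mem_comap, dphi_inv_dphi ht.ne'] at this
    refine iSup₂_le fun α hα Y hY => ?_
    refine le_iSup₂_of_le (f := fun α (_ : α ∈ posRoots 𝔞 H₀ t) => rootSpace 𝔞 t α) (t • α)
      ((smul_mem_posRoots_iff ht).2 hα) le_rfl ?_
    rw [mem_rootSpace_smul_iff ht.ne', dphi_dphi_inv ht.ne']
    exact hY

/-- Multiplication by `t` is a bijection between the positive roots of `𝔤` and those of `𝔤_t`, and
it preserves multiplicities. -/
theorem rho_eq_smul (H₀ : 𝔞) {t : ℝ} (ht : 0 < t) : rho 𝔞 H₀ t = t • rho 𝔞 H₀ 1 := by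
  rw [rho, rho, smul_comm]
  congr 1
  have hbij : Set.BijOn (fun α : Module.Dual ℝ 𝔞 => t • α) (posRoots 𝔞 H₀ 1) (posRoots 𝔞 H₀ t) := by
    refine ⟨fun α hα => (smul_mem_posRoots_iff ht).2 hα, (smul_right_injective _ ht.ne').injOn, fun α hα => ?_⟩
    refine ⟨t⁻¹ • α, ?_, by simp [smul_smul, ht.ne']⟩
    rw [← smul_mem_posRoots_iff ht, smul_smul, mul_inv_cancel₀ ht.ne', one_smul]
    exact hα
  rw [← finsum_mem_eq_of_bijOn (f := fun α => t • ((Module.finrank ℝ (rootSpace 𝔞 1 α) : ℝ) • α)) _ hbij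
    fun α _ => by rw [finrank_rootSpace_smul ht.ne', smul_comm]]
  rw [smul_finsum]
  refine finsum_congr fun α => ?_
  rw [smul_finsum]

theorem phi_mul {t : ℝ} (ht : t ≠ 0) (x y : G.K × G.p) : G.phi t (G.mul t x y) = G.phi t x * G.phi t y :=
  G.phi_phiInv ht (G.toSubgroup.mul_mem (G.phi_mem t x) (G.phi_mem t y))

theorem phi_inv {t : ℝ} (ht : t ≠ 0) (x : G.K × G.p) : G.phi t (G.inv t x) = (G.phi t x)⁻¹ :=
  G.phi_phiInv ht (G.toSubgroup.inv_mem (G.phi_mem t x))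

theorem phi_K (t : ℝ) (k : G.K) : G.phi t (k, 0) = k := by
  simp [phi, expGL_zero]

theorem phi_expGt {t : ℝ} (ht : t ≠ 0) {X : Matrix (Fin n) (Fin n) ℂ} (hX : X ∈ G.lieAlg) :
    G.phi t (G.expGt t X) = expGL (dphi n t X) :=
  G.phi_phiInv ht (G.expGL_mem (G.dphi_mem hX))

/-- The Iwasawa projections of `G_t`, in terms of those of `G`. -/
theorem iwasawa_eq (h𝔞 : G.IsMaximalAbelian 𝔞) {H₀ : 𝔞} (hH₀ : IsChamberElement 𝔞 H₀) {t : ℝ} (ht : 0 < t)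
    (γ : G.K × G.p) : iwasawa 𝔞 H₀ t γ =
      ((iwasawaProj 𝔞 H₀ (G.phi t γ)).1, t⁻¹ • (iwasawaProj 𝔞 H₀ (G.phi t γ)).2) := by
  -- Applying the injective homomorphism `φ_t` to a decomposition in `G_t` gives one in `G` whose
  -- component in `𝔞` is multiplied by `t`.
  have key : ∀ q : G.K × 𝔞, (∃ Y ∈ nilp 𝔞 H₀ t,
      γ = G.mul t (G.mul t (q.1, 0) (G.expGt t ((q.2 : G.p) : Matrix (Fin n) (Fin n) ℂ))) (G.expGt t Y)) ↔
      IsIwasawa 𝔞 H₀ (G.phi t γ) (q.1, t • q.2) := by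
    intro q
    have h1 : ∀ Y ∈ nilp 𝔞 H₀ t, (γ = G.mul t (G.mul t (q.1, 0)
        (G.expGt t ((q.2 : G.p) : Matrix (Fin n) (Fin n) ℂ))) (G.expGt t Y) ↔
        G.phi t γ = q.1 * expGL (mat (t • q.2)) * expGL (dphi n t Y)) := by
      intro Y hY
      rw [← (G.phi_injective ht.ne').eq_iff, phi_mul ht.ne', phi_mul ht.ne', phi_K,
        phi_expGt ht.ne' (mat_mem q.2), phi_expGt ht.ne' (nilp_le_lieAlg _ _ hY),
        dphi_of_isSelfAdjoint t (star_mat q.2)]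
      rfl
    constructor
    · rintro ⟨Y, hY, h⟩
      exact ⟨_, (mem_nilp_iff ht).1 hY, (h1 Y hY).1 h⟩
    · rintro ⟨Y, hY, h⟩
      have hY' : dphi n t⁻¹ Y ∈ nilp 𝔞 H₀ t := by
        rw [mem_nilp_iff ht, dphi_dphi_inv ht.ne']; exact hY
      refine ⟨_, hY', (h1 _ hY').2 ?_⟩
      rw [dphi_dphi_inv ht.ne']
      exact h
  have hex := isIwasawa_iwasawaProj h𝔞 hH₀ (G.phi_mem t γ)
  set q₀ := iwasawaProj 𝔞 H₀ (G.phi t γ)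
  have hq₀ : IsIwasawa 𝔞 H₀ (G.phi t γ) (q₀.1, t • (t⁻¹ • q₀.2)) := by
    rw [smul_smul, mul_inv_cancel₀ ht.ne', one_smul]
    exact hex
  have hspec : IsIwasawa 𝔞 H₀ (G.phi t γ) ((iwasawa 𝔞 H₀ t γ).1, t • (iwasawa 𝔞 H₀ t γ).2) :=
    (key _).1 (Classical.epsilon_spec (p := fun q : G.K × 𝔞 => ∃ Y ∈ nilp 𝔞 H₀ t,
      γ = G.mul t (G.mul t (q.1, 0) (G.expGt t ((q.2 : G.p) : Matrix (Fin n) (Fin n) ℂ))) (G.expGt t Y))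
      ⟨(q₀.1, t⁻¹ • q₀.2), (key (q₀.1, t⁻¹ • q₀.2)).2 hq₀⟩)
  have huniq := hspec.unique h𝔞 hq₀
  refine Prod.ext (Prod.ext_iff.1 huniq).1 ?_
  exact smul_right_injective _ ht.ne' (Prod.ext_iff.1 huniq).2

variable {V : Type*} [NormedAddCommGroup V] [InnerProductSpace ℂ V] (δ : G.MackeyParameter V)

/-- In `ρ_t(𝐚_t)` the factors `t` and `t⁻¹` cancel; only the term in `χ` keeps a factor `t⁻¹`. -/
theorem piT_apply (h𝔞 : G.IsMaximalAbelian 𝔞) {H₀ : 𝔞} (hH₀ : IsChamberElement 𝔞 H₀) {t : ℝ} (ht : 0 < t)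
    (γ : G.K × G.p) (f : G.K → V) (u : G.K) :
    δ.piT 𝔞 H₀ t γ f u =
      Complex.exp (-Complex.I * (t⁻¹ * δ.χ (iwasawaProj 𝔞 H₀ ((G.phi t γ)⁻¹ * u)).2 : ℝ) -
        (rho 𝔞 H₀ 1 (iwasawaProj 𝔞 H₀ ((G.phi t γ)⁻¹ * u)).2 : ℝ)) •
        f (iwasawaProj 𝔞 H₀ ((G.phi t γ)⁻¹ * u)).1 := by
  have h1 : G.phi t (G.mul t (G.inv t γ) (u, 0)) = (G.phi t γ)⁻¹ * u := by
    rw [phi_mul ht.ne', phi_inv ht.ne', phi_K]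
  simp only [MackeyParameter.piT, iwasawa_eq h𝔞 hH₀ ht, h1, rho_eq_smul H₀ ht]
  simp [ht.ne']

end Rescaling
end LinearReductiveGroup

/-! ### Distortion of Haar measure by the action on `K` -/

section CompactProjection

open scoped Pointwise

variable {𝒢 K : Type*} [Group 𝒢] [TopologicalSpace 𝒢] [IsTopologicalGroup 𝒢]
  [LocallyCompactSpace 𝒢] [Group K] [TopologicalSpace K] [IsTopologicalGroup K] [CompactSpace K]
  [MeasurableSpace K] [BorelSpace K]

/-- Let `κ` be a continuous projection of a locally compact group `𝒢` onto a compact group `K`, such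
that `κ h` is the component of `h` in `K` for a decomposition `𝒢 = K S` with `S` a subgroup.  Then the
transformations of `K` defined by the elements of a compact subset of `𝒢` distort the Haar measure by
a bounded factor. -/
theorem exists_map_le_smul_of_compact_projection (i : K →* 𝒢) (hi : Continuous i) (κ : 𝒢 → K)
    (hκ : Continuous κ) (hleft : ∀ k h, κ (i k * h) = k * κ h)
    (hright : ∀ g h, κ (g * i (κ h)) = κ (g * h)) (ν : Measure K) [ν.IsHaarMeasure]
    {C : Set 𝒢} (hC : IsCompact C) :
    ∃ c : ENNReal, c ≠ ⊤ ∧ ∀ g ∈ C, ν.map (fun u => κ (g * i u)) ≤ c • ν := by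
  borelize 𝒢
  let m : Measure 𝒢 := Measure.haar
  let s : 𝒢 → 𝒢 := fun h => (i (κ h))⁻¹ * h
  have hs : Continuous s := (hi.comp hκ).inv.mul continuous_id
  have hκ1 : κ 1 = 1 := by
    have h1 := hright 1 1
    have h2 := hleft (κ 1) 1
    rw [mul_one] at h2
    rw [one_mul, mul_one, h2] at h1
    exact mul_eq_left.1 h1
  have hs1 : s 1 = 1 := by simp [s, hκ1]
  have hsl : ∀ k h, s (i k * h) = s h := by
    intro k h
    simp only [s, hleft, map_mul, mul_inv_rev]
    group
  have hsr : ∀ g h, s (g * h) = s (g * i (κ h)) * s h := by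
    intro g h
    simp only [s, hright]
    group
  -- With `s h` the component of `h` in the second factor, `lam B` is the `κ`-image of Haar measure
  -- on the tube of those `h` with `s h ∈ B`. Left translation by `K` preserves the tube, so by
  -- uniqueness of Haar measure `lam B` is a multiple of `ν` when `B` is compact.
  let lam : Set 𝒢 → Measure K := fun B => (m.restrict (s ⁻¹' B)).map κ
  have hlam : ∀ (B : Set 𝒢) (E : Set K), MeasurableSet E → lam B E = m (κ ⁻¹' E ∩ s ⁻¹' B) := by
    intro B E hE
    simp only [lam]
    rw [Measure.map_apply hκ.measurable hE, Measure.restrict_apply (hκ.measurable hE)]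
  have hfin : ∀ B, IsCompact B → m (s ⁻¹' B) ≠ ⊤ := by
    intro B hB
    have hc : IsCompact (Set.range i * B) := (isCompact_range hi).mul hB
    refine ((measure_mono ?_).trans_lt hc.measure_lt_top).ne
    intro h hh
    exact ⟨i (κ h), ⟨_, rfl⟩, s h, hh, by simp [s]⟩
  have hscalar : ∀ B, IsCompact B → ∃ c : NNReal, lam B = c • ν := by
    intro B hB
    have h1 : (lam B).IsMulLeftInvariant := by
      refine ⟨fun k => ?_⟩
      ext E hE
      rw [Measure.map_apply (continuous_const_mul k).measurable hE,
        hlam _ _ ((continuous_const_mul k).measurable hE), hlam _ _ hE]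
      rw [← measure_preimage_mul m (i k) (κ ⁻¹' E ∩ s ⁻¹' B)]
      congr 1
      ext h
      simp [hleft, hsl]
    have h2 : IsFiniteMeasure (lam B) := by
      refine ⟨?_⟩
      rw [hlam _ _ MeasurableSet.univ]
      exact (measure_mono Set.inter_subset_right).trans_lt (hfin B hB).lt_top
    exact ⟨_, Measure.isMulInvariant_eq_smul_of_compactSpace (lam B) ν⟩
  obtain ⟨B₁, hB₁, hB₁n⟩ := exists_compact_mem_nhds (1 : 𝒢)
  -- Left translation by `g ∈ C` sends the tube over `B₁` into the tube over `S * B₁`, since `s (g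
  -- h) = s (g κ(h)) s h`. The larger tube does not depend on `g`.
  let S : Set 𝒢 := s '' (C * Set.range i)
  have hS : IsCompact S := (hC.mul (isCompact_range hi)).image hs
  obtain ⟨c₁, hc₁⟩ := hscalar B₁ hB₁
  obtain ⟨c₂, hc₂⟩ := hscalar (S * B₁) (hS.mul hB₁)
  -- The tube over `B₁` is a neighbourhood of `1`, so it has positive volume.
  have hc₁0 : (c₁ : ENNReal) ≠ 0 := by
    intro h0
    have h1 : lam B₁ Set.univ = 0 := by
      rw [hc₁, ENNReal.coe_eq_zero.1 h0]; simp
    rw [hlam _ _ MeasurableSet.univ, Set.preimage_univ, Set.univ_inter] at h1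
    refine (Measure.measure_pos_of_mem_nhds m (x := 1) ?_).ne' h1
    exact hs.continuousAt.preimage_mem_nhds (x := 1) (by rwa [hs1])
  refine ⟨c₂ / c₁, ENNReal.div_ne_top ENNReal.coe_ne_top hc₁0, fun g hg => ?_⟩
  have hτ : Measurable fun u => κ (g * i u) := (hκ.comp (hi.const_mul g)).measurable
  refine Measure.le_iff.2 fun E hE => ?_
  -- Left invariance of Haar measure on `𝒢` turns the inclusion of tubes into `c₁ ν(τ⁻¹ E) ≤ c₂
  -- ν(E)`, where `τ u = κ (g u)`.
  have key : lam B₁ ((fun u => κ (g * i u)) ⁻¹' E) ≤ lam (S * B₁) E := by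
    rw [hlam _ _ (hτ hE), hlam _ _ hE, ← measure_preimage_mul m g (κ ⁻¹' E ∩ s ⁻¹' (S * B₁))]
    refine measure_mono fun h hh => ⟨?_, ?_⟩
    · have := hh.1
      simpa [hright] using this
    · change s (g * h) ∈ S * B₁
      rw [hsr]
      exact Set.mul_mem_mul ⟨_, Set.mul_mem_mul hg ⟨_, rfl⟩, rfl⟩ hh.2
  rw [hc₁, hc₂] at key
  rw [Measure.map_apply hτ hE, Measure.smul_apply, smul_eq_mul]
  change (c₁ : ENNReal) * _ ≤ (c₂ : ENNReal) * _ at key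
  rw [← ENNReal.mul_div_right_comm, ENNReal.le_div_iff_mul_le (Or.inl hc₁0) (Or.inl ENNReal.coe_ne_top), mul_comm]
  exact key

end CompactProjection

namespace LinearReductiveGroup

variable {n : ℕ} {G : LinearReductiveGroup n} {𝔞 : Submodule ℝ G.p}

/-- The transformations `u ↦ κ (g u)` of `K` distort the Haar measure by a factor which is bounded for
`g` in a compact set. -/
theorem exists_map_iwasawaProj_le_smul (h𝔞 : G.IsMaximalAbelian 𝔞) {H₀ : 𝔞} (hH₀ : IsChamberElement 𝔞 H₀)
    [MeasurableSpace G.K] [BorelSpace G.K] (ν : Measure G.K) [ν.IsHaarMeasure]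
    {C : Set (GL (Fin n) ℂ)} (hC : IsCompact C) (hCG : C ⊆ G.toSubgroup) :
    ∃ c : ENNReal, c ≠ ⊤ ∧ ∀ g ∈ C,
      ν.map (fun u : G.K => (iwasawaProj 𝔞 H₀ (g * (u : GL (Fin n) ℂ))).1) ≤ c • ν := by
  have : LocallyCompactSpace (Matrix (Fin n) (Fin n) ℂ) :=
    inferInstanceAs (LocallyCompactSpace (Fin n → Fin n → ℂ))
  have : LocallyCompactSpace G.toSubgroup := G.isClosed.isClosedEmbedding_subtypeVal.locallyCompactSpace
  have hK : G.K ≤ G.toSubgroup := fun _ h => h.1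
  let i : G.K →* G.toSubgroup := Subgroup.inclusion hK
  let κ : G.toSubgroup → G.K := fun g => (iwasawaProj 𝔞 H₀ (g : GL (Fin n) ℂ)).1
  have hκ : Continuous κ := (continuousOn_iff_continuous_domRestrict.1 (continuousOn_iwasawaProj h𝔞 hH₀)).fst
  have hCc : IsCompact ((↑) ⁻¹' C : Set G.toSubgroup) := G.isClosed.isClosedEmbedding_subtypeVal.isCompact_preimage hC
  have hi : Continuous i := Continuous.subtype_mk continuous_subtype_val _
  -- Replacing `h` by its component in `K` removes a right factor in `AN`, which `κ` does not see.
  have hr : ∀ g h : G.toSubgroup, κ (g * i (κ h)) = κ (g * h) := by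
    intro g h
    obtain ⟨Y, hY, e⟩ := isIwasawa_iwasawaProj h𝔞 hH₀ h.2
    have h1 := (isIwasawa_iwasawaProj h𝔞 hH₀ (g * i (κ h)).2).right h𝔞 hH₀ (iwasawaProj 𝔞 H₀ (h : GL (Fin n) ℂ)).2 hY
    have h2 : ((g * i (κ h) : G.toSubgroup) : GL (Fin n) ℂ) *
        expGL (mat (iwasawaProj 𝔞 H₀ (h : GL (Fin n) ℂ)).2) * expGL Y = ((g * h : G.toSubgroup) : GL (Fin n) ℂ) := by
      rw [Subgroup.coe_mul, Subgroup.coe_mul, mul_assoc, mul_assoc]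
      refine congrArg ((g : GL (Fin n) ℂ) * ·) ?_
      rw [← mul_assoc]
      exact e.symm
    rw [h2] at h1
    exact (congrArg Prod.fst (h1.proj_eq h𝔞)).symm
  obtain ⟨c, hc, h⟩ := exists_map_le_smul_of_compact_projection i hi κ hκ
    (fun k h => congrArg Prod.fst (iwasawaProj_K_mul h𝔞 hH₀ k h.2)) hr ν hCc
  exact ⟨c, hc, fun g hg => h ⟨g, hCG hg⟩ hg⟩

/-! ### Uniform convergence for continuous functions -/

section Contraction

open scoped Matrix.Norms.Operator

variable {n : ℕ} {G : LinearReductiveGroup n} {𝔞 : Submodule ℝ G.p}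

/-- The orthogonal projection of `𝔭` onto `𝔞` is the first order part of the Iwasawa projection
`G → 𝔞` at the identity. -/
theorem tendsto_inv_mul_re_trace_iwasawaProj (h𝔞 : G.IsMaximalAbelian 𝔞) {H₀ : 𝔞} (hH₀ : IsChamberElement 𝔞 H₀)
    (H : 𝔞) {ι : Type*} {l : Filter ι} {t : ι → ℝ} {w : ι → Matrix (Fin n) (Fin n) ℂ} (ht : Tendsto t l (𝓝 0))
    (ht0 : ∀ᶠ j in l, t j ≠ 0) (hw : ∀ j, w j ∈ G.lieAlg) {R : ℝ} (hR : ∀ j, ‖w j‖ ≤ R) :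
    Tendsto (fun j => (t j)⁻¹ * (Matrix.trace (mat H * mat (iwasawaProj 𝔞 H₀ (expGL (-t j • w j))).2)).re +
      (Matrix.trace (mat H * w j)).re) l (𝓝 0) := by
  obtain ⟨Θ, D, h1, h2, h3, h4⟩ := exists_iwasawaProj_eq h𝔞 hH₀
  let ψ₀ : G.lieAlg →ₗ[ℝ] ℝ := Complex.reLm ∘ₗ
    ((Matrix.traceLinearMap (Fin n) ℂ ℂ).restrictScalars ℝ) ∘ₗ (LinearMap.mulLeft ℝ (mat H)) ∘ₗ G.lieAlg.subtype
  let ψ : G.lieAlg →L[ℝ] ℝ := LinearMap.toContinuousLinearMap ψ₀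
  have hψ : ∀ X : G.lieAlg, ψ X = (Matrix.trace (mat H * (X : Matrix (Fin n) (Fin n) ℂ))).re := fun X => rfl
  -- The derivative of `Z ↦ Re tr(H Θ(exp Z))` at `0` restricts to `Z ↦ Re tr(H Z)` on `𝔤`. As the
  -- `w j` are bounded, the remainder at `-t w` is `o(t)` whatever the dependence of `w` on `j`.
  have h5 : HasStrictFDerivAt (fun Z : Matrix (Fin n) (Fin n) ℂ => ψ (Θ (NormedSpace.exp Z))) (ψ ∘L D) 0 := by
    have h6 : HasStrictFDerivAt Θ D (NormedSpace.exp (0 : Matrix (Fin n) (Fin n) ℂ)) := by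
      rw [NormedSpace.exp_zero]; exact h1
    exact ψ.hasStrictFDerivAt.comp (0 : Matrix (Fin n) (Fin n) ℂ) (h6.comp 0 hasStrictFDerivAt_exp_zero_matrix)
  have hO : (fun j => -t j • w j) =O[l] t := by
    refine Asymptotics.IsBigO.of_bound R (Eventually.of_forall fun j => ?_)
    rw [norm_smul, norm_neg, mul_comm]
    exact mul_le_mul_of_nonneg_right (hR j) (norm_nonneg _)
  have hZ : Tendsto (fun j => -t j • w j) l (𝓝 0) := hO.trans_tendsto ht
  have h7 := ((h5.hasFDerivAt.isLittleO).comp_tendsto hZ)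
  have h8 : (fun j => ψ (Θ (NormedSpace.exp (-t j • w j))) + t j * (Matrix.trace (mat H * w j)).re) =o[l] t := by
    refine (h7.trans_isBigO ?_).congr_left fun j => ?_
    · simpa [Function.comp_def] using hO
    · have : D (-t j • w j) = -t j • (⟨w j, hw j⟩ : G.lieAlg) :=
        h3 (-t j • (⟨w j, hw j⟩ : G.lieAlg))
      have e2 : ψ (⟨w j, hw j⟩ : G.lieAlg) = (Matrix.trace (mat H * w j)).re := hψ _
      change ψ (Θ (NormedSpace.exp (-t j • w j))) - ψ (Θ (NormedSpace.exp 0)) - ψ (D (-t j • w j - 0)) = _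
      rw [sub_zero, NormedSpace.exp_zero, h2, map_zero, this, map_smul, e2, smul_eq_mul]
      ring
  refine (h8.tendsto_inv_smul_nhds_zero).congr' ?_
  have hE : Tendsto (fun j => expGL (-t j • w j)) l (𝓝 1) := by
    have := (continuous_expGL.tendsto (0 : Matrix (Fin n) (Fin n) ℂ)).comp hZ
    rwa [expGL_zero] at this
  filter_upwards [ht0, hE.eventually h4] with j hj hj4
  have e1 := hj4 (G.lieAlg.smul_mem (-t j) (hw j) |> G.expGL_mem)
  rw [e1, re_trace_mat_mul_iwasawaLinear, ← hψ, expGL_val, smul_eq_mul, mul_add, inv_mul_cancel_left₀ hj]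

theorem continuous_Ad_inv (v : G.p) :
    Continuous fun u : G.K => ((G.Ad u⁻¹ v : G.p) : Matrix (Fin n) (Fin n) ℂ) := by
  have h1 : Continuous fun u : G.K => ((u⁻¹ : G.K) : GL (Fin n) ℂ).val :=
    Units.continuous_val.comp (continuous_subtype_val.comp continuous_inv)
  have h2 : Continuous fun u : G.K => (u : GL (Fin n) ℂ).val := Units.continuous_val.comp continuous_subtype_val
  exact ((h1.matrix_mul continuous_const).matrix_mul h2).congr fun u => rfl

/-- Isolating `k⁻¹ u` on the left leaves only the Iwasawa projections of `exp(-t w)`, where `w =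
Ad(u⁻¹)v` ranges over a compact set. -/
theorem phi_inv_mul (t : ℝ) (k : G.K) (v : G.p) (u : G.K) :
    (G.phi t (k, v))⁻¹ * (u : GL (Fin n) ℂ) = ((k⁻¹ * u : G.K) : GL (Fin n) ℂ) *
      expGL (-t • ((G.Ad u⁻¹ v : G.p) : Matrix (Fin n) (Fin n) ℂ)) := by
  rw [G.expGL_conj_K u⁻¹ v (-t), phi, mul_inv_rev, ← expGL_neg, ← neg_smul]
  simp only [Subgroup.coe_mul, Subgroup.coe_inv, inv_inv]
  group

variable {V : Type*} [NormedAddCommGroup V] [InnerProductSpace ℂ V] (δ : G.MackeyParameter V)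

theorem coAd_apply (u : G.K) (χ : Module.Dual ℝ G.p) (v : G.p) : G.coAd u χ v = χ (G.Ad u⁻¹ v) := rfl

theorem norm_exp_I_mul (x : ℝ) : ‖Complex.exp (Complex.I * (x : ℂ))‖ = 1 := by
  rw [mul_comm]; exact Complex.norm_exp_ofReal_mul_I x

/-- For continuous functions, the operators of the principal series converge uniformly to those of the
representation of the motion group. -/
theorem tendstoUniformly_piT (h𝔞 : G.IsMaximalAbelian 𝔞) {H₀ : 𝔞} (hH₀ : IsChamberElement 𝔞 H₀)
    (hχ : IsRegular 𝔞 δ.χ) (k : G.K) (v : G.p) {f : G.K → V} (hf : Continuous f) :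
    TendstoUniformly (fun t : ℝ => δ.piT 𝔞 H₀ t (k, v) f) (δ.piZero (k, v) f) (𝓝[>] 0) := by
  obtain ⟨H, hH, -⟩ := hχ
  rw [tendstoUniformly_iff_tendsto, tendsto_uniformity_iff_dist_tendsto_zero]
  -- Uniform convergence on `K` as `t → 0⁺` is convergence along this product filter, with `u`
  -- unrestricted.
  let l : Filter (ℝ × G.K) := 𝓝[>] 0 ×ˢ ⊤
  let w : ℝ × G.K → Matrix (Fin n) (Fin n) ℂ := fun q => ((G.Ad q.2⁻¹ v : G.p) : Matrix (Fin n) (Fin n) ℂ)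
  have hw : ∀ q, w q ∈ G.lieAlg := fun q => (G.Ad q.2⁻¹ v).2.1
  obtain ⟨R, hR⟩ : ∃ R, ∀ q, ‖w q‖ ≤ R := by
    obtain ⟨R, hR⟩ := isCompact_univ.exists_bound_of_continuousOn
      (f := fun u : G.K => ((G.Ad u⁻¹ v : G.p) : Matrix (Fin n) (Fin n) ℂ)) (continuous_Ad_inv v).continuousOn
    exact ⟨R, fun q => hR q.2 trivial⟩
  have ht1 : Tendsto (fun q : ℝ × G.K => q.1) l (𝓝[>] 0) := tendsto_fst
  have ht : Tendsto (fun q : ℝ × G.K => q.1) l (𝓝 0) := ht1.mono_right nhdsWithin_le_nhds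
  have htpos : ∀ᶠ q in l, 0 < q.1 := ht1.eventually self_mem_nhdsWithin
  have hχlim := tendsto_inv_mul_re_trace_iwasawaProj h𝔞 hH₀ H ht (htpos.mono fun q h => h.ne') hw hR
  have hZ : Tendsto (fun q : ℝ × G.K => -q.1 • w q) l (𝓝 0) := by
    have hO : (fun q : ℝ × G.K => -q.1 • w q) =O[l] fun q => q.1 := by
      refine Asymptotics.IsBigO.of_bound R (Eventually.of_forall fun j => ?_)
      rw [norm_smul, norm_neg, mul_comm]
      exact mul_le_mul_of_nonneg_right (hR j) (norm_nonneg _)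
    exact hO.trans_tendsto ht
  let y : ℝ × G.K → GL (Fin n) ℂ := fun q => expGL (-q.1 • w q)
  have hyG : ∀ q, y q ∈ G.toSubgroup := fun q => G.expGL_mem (G.lieAlg.smul_mem _ (hw q))
  have hy : Tendsto y l (𝓝[G.toSubgroup] 1) := by
    refine tendsto_nhdsWithin_iff.2 ⟨?_, Eventually.of_forall hyG⟩
    have := (continuous_expGL.tendsto (0 : Matrix (Fin n) (Fin n) ℂ)).comp hZ
    rwa [expGL_zero] at this
  have hI := (tendsto_iwasawaProj_one h𝔞 hH₀).comp hy
  rw [nhds_prod_eq] at hI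
  have hκ : Tendsto (fun q => (iwasawaProj 𝔞 H₀ (y q)).1) l (𝓝 1) := tendsto_fst.comp hI
  have ha : Tendsto (fun q => (iwasawaProj 𝔞 H₀ (y q)).2) l (𝓝 0) := tendsto_snd.comp hI
  have hρc : Continuous (rho 𝔞 H₀ 1) :=
    LinearMap.continuous_of_finiteDimensional (𝕜 := ℝ) (E := 𝔞) (F' := ℝ) (rho 𝔞 H₀ 1)
  have hρ : Tendsto (fun q => rho 𝔞 H₀ 1 (iwasawaProj 𝔞 H₀ (y q)).2) l (𝓝 0) := by
    have := (hρc.tendsto 0).comp ha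
    rwa [map_zero] at this
  -- The difference between the exponent in `π_t` and the limiting exponent `i χ(Ad(u⁻¹)v)`.
  let c : ℝ × G.K → ℂ := fun q =>
    -Complex.I * ((q.1⁻¹ * (Matrix.trace (mat H * mat (iwasawaProj 𝔞 H₀ (y q)).2)).re +
      (Matrix.trace (mat H * w q)).re : ℝ) : ℂ) - (rho 𝔞 H₀ 1 (iwasawaProj 𝔞 H₀ (y q)).2 : ℝ)
  have hc : Tendsto c l (𝓝 0) := by
    have h1 := (Complex.continuous_ofReal.tendsto _).comp hχlim
    have h2 := (Complex.continuous_ofReal.tendsto _).comp hρ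
    have := (h1.const_mul (-Complex.I)).sub h2
    rw [Complex.ofReal_zero, mul_zero, sub_zero] at this
    exact this
  have hec : Tendsto (fun q => ‖Complex.exp (c q) - 1‖) l (𝓝 0) := by
    have := (((Complex.continuous_exp.tendsto 0).comp hc).sub_const 1).norm
    rw [Complex.exp_zero, sub_self, norm_zero] at this
    exact this
  obtain ⟨B, hB⟩ : ∃ B, ∀ u, ‖f u‖ ≤ B := by
    obtain ⟨B, hB⟩ := isCompact_univ.exists_bound_of_continuousOn hf.continuousOn
    exact ⟨B, fun u => hB u trivial⟩
  have hfu : Tendsto (fun q : ℝ × G.K => dist (f (k⁻¹ * q.2)) (f (k⁻¹ * q.2 * (iwasawaProj 𝔞 H₀ (y q)).1))) l (𝓝 0) := by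
    let _ : UniformSpace G.K := IsTopologicalGroup.rightUniformSpace G.K
    -- Compactness of `K` upgrades joint continuity to convergence, uniform in `u`, as the right
    -- factor `h` tends to `1`.
    have h1 : TendstoUniformly (fun h u : G.K => f (k⁻¹ * u * h)) (fun u => f (k⁻¹ * u * 1)) (𝓝 1) :=
      Continuous.tendstoUniformly (fun h u : G.K => f (k⁻¹ * u * h))
        (hf.comp ((continuous_const.mul continuous_snd).mul continuous_fst)) 1
    rw [tendstoUniformly_iff_tendsto, tendsto_uniformity_iff_dist_tendsto_zero] at h1
    have h2 := h1.comp (hκ.prodMk (tendsto_snd (f := 𝓝[>] (0 : ℝ)) (g := (⊤ : Filter G.K))))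
    simpa [Function.comp_def] using h2
  have hsum : Tendsto (fun q => ‖Complex.exp (c q) - 1‖ * B +
      dist (f (k⁻¹ * q.2)) (f (k⁻¹ * q.2 * (iwasawaProj 𝔞 H₀ (y q)).1))) l (𝓝 0) := by
    simpa using (hec.mul_const B).add hfu
  refine squeeze_zero' (Eventually.of_forall fun q => dist_nonneg) ?_ hsum
  filter_upwards [htpos] with q hq
  have e1 : iwasawaProj 𝔞 H₀ ((G.phi q.1 (k, v))⁻¹ * (q.2 : GL (Fin n) ℂ)) =
      (k⁻¹ * q.2 * (iwasawaProj 𝔞 H₀ (y q)).1, (iwasawaProj 𝔞 H₀ (y q)).2) := by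
    rw [phi_inv_mul]
    exact iwasawaProj_K_mul h𝔞 hH₀ (k⁻¹ * q.2) (hyG q)
  rw [piT_apply δ h𝔞 hH₀ hq, e1, MackeyParameter.piZero, coAd_apply, hH, hH, dist_comm, dist_eq_norm]
  have e2 : -Complex.I * ((q.1⁻¹ * (Matrix.trace (mat H * mat (iwasawaProj 𝔞 H₀ (y q)).2)).re : ℝ) : ℂ) -
      (rho 𝔞 H₀ 1 (iwasawaProj 𝔞 H₀ (y q)).2 : ℝ) =
      Complex.I * ((Matrix.trace (mat H * w q)).re : ℝ) + c q := by
    simp only [c]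
    push_cast
    ring
  change ‖Complex.exp (-Complex.I * ((q.1⁻¹ * (Matrix.trace (mat H * mat (iwasawaProj 𝔞 H₀ (y q)).2)).re : ℝ) : ℂ) -
      (rho 𝔞 H₀ 1 (iwasawaProj 𝔞 H₀ (y q)).2 : ℝ)) • f (k⁻¹ * q.2 * (iwasawaProj 𝔞 H₀ (y q)).1) -
      Complex.exp (Complex.I * ((Matrix.trace (mat H * w q)).re : ℝ)) • f (k⁻¹ * q.2)‖ ≤ _
  -- The limiting exponential has modulus one and factors out, leaving `e^c f(k⁻¹ u h) - f(k⁻¹ u)`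
  -- with `h = κ(exp(-t w))` near `1`.
  rw [e2, Complex.exp_add, mul_smul, ← smul_sub, norm_smul, norm_exp_I_mul, one_mul]
  have e3 : ∀ (z : ℂ) (a b : V), z • a - b = (z - 1) • a + (a - b) := fun z a b => by module
  rw [e3]
  refine (norm_add_le _ _).trans (add_le_add ?_ ?_)
  · rw [norm_smul]
    exact mul_le_mul_of_nonneg_left (hB _) (norm_nonneg _)
  · rw [dist_comm, dist_eq_norm]

end Contraction

end LinearReductiveGroup

/-- Composition with a map that distorts a measure by a bounded factor is bounded on `L²`. -/
theorem eLpNorm_comp_le_of_map_le_smul {α E : Type*} [MeasurableSpace α] [NormedAddCommGroup E] {ν : Measure α}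
    {τ : α → α} (hτ : Measurable τ) {c : ENNReal} (h : ν.map τ ≤ c • ν) {f : α → E}
    (hf : AEStronglyMeasurable f ν) : eLpNorm (f ∘ τ) 2 ν ≤ c ^ (1 / 2 : ENNReal).toReal * eLpNorm f 2 ν := by
  have hac : ν.map τ ≪ ν := Measure.absolutelyContinuous_of_le_smul h
  rw [← eLpNorm_map_measure (hf.mono_ac hac) hτ.aemeasurable, ← smul_eq_mul,
    ← eLpNorm_smul_measure_of_ne_top ENNReal.ofNat_ne_top]
  exact eLpNorm_mono_measure f h

theorem tendsto_eLpNorm_of_tendstoUniformly {α E ι : Type*} [MeasurableSpace α] [NormedAddCommGroup E]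
    (ν : Measure α) [IsFiniteMeasure ν] {f : ι → α → E} {g : α → E} {l : Filter ι}
    (h : TendstoUniformly f g l) : Tendsto (fun t => eLpNorm (f t - g) 2 ν) l (𝓝 0) := by
  rw [ENNReal.tendsto_nhds_zero]
  intro ε hε
  have h1 : Tendsto (fun δ : ℝ => ν Set.univ ^ (2 : ENNReal).toReal⁻¹ * ENNReal.ofReal δ) (𝓝[>] 0) (𝓝 0) := by
    have h2 : Tendsto (fun δ : ℝ => ENNReal.ofReal δ) (𝓝[>] 0) (𝓝 0) := by
      have := (ENNReal.continuous_ofReal.tendsto 0).mono_left (nhdsWithin_le_nhds (s := Set.Ioi 0))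
      rwa [ENNReal.ofReal_zero] at this
    have := ENNReal.Tendsto.const_mul h2 (a := ν Set.univ ^ (2 : ENNReal).toReal⁻¹)
      (Or.inr (ENNReal.rpow_ne_top_of_nonneg (by simp) (measure_ne_top ν _)))
    rwa [mul_zero] at this
  obtain ⟨η, hη, hη0⟩ := ((h1.eventually (gt_mem_nhds hε)).and self_mem_nhdsWithin).exists
  filter_upwards [Metric.tendstoUniformly_iff.1 h η hη0] with t ht
  refine (eLpNorm_le_of_ae_bound (C := η) (Eventually.of_forall fun u => ?_)).trans hη.le
  rw [Pi.sub_apply, ← dist_eq_norm, dist_comm]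
  exact (ht u).le

/-! ### The operators on `L²`: continuity, equivariance, bounds and strong convergence -/

namespace LinearReductiveGroup

variable {n : ℕ} {G : LinearReductiveGroup n} {𝔞 : Submodule ℝ G.p}
variable {V : Type*} [NormedAddCommGroup V] [InnerProductSpace ℂ V] (δ : G.MackeyParameter V)

section Continuity

theorem continuous_phi (k : G.K) (v : G.p) : Continuous fun t : ℝ => G.phi t (k, v) :=
  (continuous_expGL.comp (continuous_id.smul continuous_const)).mul continuous_const

theorem phi_inv_mul_mem (t : ℝ) (x : G.K × G.p) (u : G.K) :
    (G.phi t x)⁻¹ * (u : GL (Fin n) ℂ) ∈ G.toSubgroup :=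
  G.toSubgroup.mul_mem (G.toSubgroup.inv_mem (G.phi_mem t x)) u.2.1

theorem continuous_iwasawaProj_phi (h𝔞 : G.IsMaximalAbelian 𝔞) {H₀ : 𝔞} (hH₀ : IsChamberElement 𝔞 H₀)
    (k : G.K) (v : G.p) :
    Continuous fun q : ℝ × G.K => iwasawaProj 𝔞 H₀ ((G.phi q.1 (k, v))⁻¹ * (q.2 : GL (Fin n) ℂ)) :=
  (continuousOn_iwasawaProj h𝔞 hH₀).comp_continuous
    (((continuous_phi k v).comp continuous_fst).inv.mul (continuous_subtype_val.comp continuous_snd))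
    fun q => phi_inv_mul_mem q.1 (k, v) q.2

theorem continuous_iwasawaProj_phi_right (h𝔞 : G.IsMaximalAbelian 𝔞) {H₀ : 𝔞} (hH₀ : IsChamberElement 𝔞 H₀)
    (t : ℝ) (k : G.K) (v : G.p) :
    Continuous fun u : G.K => iwasawaProj 𝔞 H₀ ((G.phi t (k, v))⁻¹ * (u : GL (Fin n) ℂ)) :=
  (continuousOn_iwasawaProj h𝔞 hH₀).comp_continuous (continuous_const.mul continuous_subtype_val)
    fun u => phi_inv_mul_mem t (k, v) u

/-- The scalar factor in the operators of the principal series. -/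
noncomputable def piTFactor (χ : Module.Dual ℝ G.p) (H₀ : 𝔞) (t : ℝ) (x : G.K × G.p) (u : G.K) : ℂ :=
  Complex.exp (-Complex.I * (t⁻¹ * χ (iwasawaProj 𝔞 H₀ ((G.phi t x)⁻¹ * (u : GL (Fin n) ℂ))).2 : ℝ) -
    (rho 𝔞 H₀ 1 (iwasawaProj 𝔞 H₀ ((G.phi t x)⁻¹ * (u : GL (Fin n) ℂ))).2 : ℝ))

/-- The transformation of `K` in the operators of the principal series. -/
noncomputable def piTMap (H₀ : 𝔞) (t : ℝ) (x : G.K × G.p) (u : G.K) : G.K :=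
  (iwasawaProj 𝔞 H₀ ((G.phi t x)⁻¹ * (u : GL (Fin n) ℂ))).1

theorem piT_eq (h𝔞 : G.IsMaximalAbelian 𝔞) {H₀ : 𝔞} (hH₀ : IsChamberElement 𝔞 H₀) {t : ℝ} (ht : 0 < t)
    (x : G.K × G.p) (f : G.K → V) :
    δ.piT 𝔞 H₀ t x f = fun u => piTFactor δ.χ H₀ t x u • f (piTMap H₀ t x u) :=
  funext fun u => piT_apply δ h𝔞 hH₀ ht x f u

theorem continuous_dual (χ : Module.Dual ℝ 𝔞) : Continuous χ :=
  LinearMap.continuous_of_finiteDimensional (𝕜 := ℝ) (E := 𝔞) (F' := ℝ) χ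

theorem continuous_piTFactor (χ : Module.Dual ℝ G.p) (h𝔞 : G.IsMaximalAbelian 𝔞) {H₀ : 𝔞}
    (hH₀ : IsChamberElement 𝔞 H₀) (t : ℝ) (k : G.K) (v : G.p) : Continuous (piTFactor χ H₀ t (k, v)) := by
  have h := (continuous_iwasawaProj_phi_right h𝔞 hH₀ t k v).snd
  have h1 := (continuous_dual (χ ∘ₗ 𝔞.subtype)).comp h
  have h2 := (continuous_dual (rho 𝔞 H₀ 1)).comp h
  exact Complex.continuous_exp.comp ((continuous_const.mul (Complex.continuous_ofReal.comp
    (continuous_const.mul h1))).sub (Complex.continuous_ofReal.comp h2))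

theorem continuous_piTMap (h𝔞 : G.IsMaximalAbelian 𝔞) {H₀ : 𝔞}
    (hH₀ : IsChamberElement 𝔞 H₀) (t : ℝ) (k : G.K) (v : G.p) : Continuous (piTMap H₀ t (k, v)) :=
  (continuous_iwasawaProj_phi_right h𝔞 hH₀ t k v).fst

theorem norm_piTFactor (χ : Module.Dual ℝ G.p) (H₀ : 𝔞) (t : ℝ) (x : G.K × G.p) (u : G.K) :
    ‖piTFactor χ H₀ t x u‖ =
      Real.exp (-rho 𝔞 H₀ 1 (iwasawaProj 𝔞 H₀ ((G.phi t x)⁻¹ * (u : GL (Fin n) ℂ))).2) := by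
  rw [piTFactor, Complex.norm_exp]
  congr 1
  simp only [Complex.sub_re, Complex.ofReal_re, neg_mul, Complex.neg_re, Complex.I_mul_re, Complex.ofReal_im,
    neg_zero, zero_sub]

theorem continuous_piT (h𝔞 : G.IsMaximalAbelian 𝔞) {H₀ : 𝔞} (hH₀ : IsChamberElement 𝔞 H₀) {t : ℝ} (ht : 0 < t)
    (k : G.K) (v : G.p) {f : G.K → V} (hf : Continuous f) : Continuous (δ.piT 𝔞 H₀ t (k, v) f) := by
  rw [piT_eq δ h𝔞 hH₀ ht]
  exact (continuous_piTFactor δ.χ h𝔞 hH₀ t k v).smul (hf.comp (continuous_piTMap h𝔞 hH₀ t k v))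

theorem continuous_coAd_apply (χ : Module.Dual ℝ G.p) (v : G.p) : Continuous fun u : G.K => G.coAd u χ v :=
  (LinearMap.continuous_of_finiteDimensional (𝕜 := ℝ) (E := G.p) (F' := ℝ) χ).comp
    (Continuous.subtype_mk (continuous_Ad_inv v) _)

theorem continuous_exp_coAd (χ : Module.Dual ℝ G.p) (v : G.p) :
    Continuous fun u : G.K => Complex.exp (Complex.I * (G.coAd u χ v : ℝ)) :=
  Complex.continuous_exp.comp (continuous_const.mul (Complex.continuous_ofReal.comp (continuous_coAd_apply χ v)))

theorem continuous_piZero (k : G.K) (v : G.p) {f : G.K → V} (hf : Continuous f) :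
    Continuous (δ.piZero (k, v) f) :=
  (continuous_exp_coAd δ.χ v).smul (hf.comp (continuous_const.mul continuous_id))

/-- The factor involving `χ` has modulus one, so `t⁻¹` disappears from the norm. What remains is
continuous on the compact set `[0, T] × K`, including `t = 0`. -/
theorem exists_norm_piTFactor_le (χ : Module.Dual ℝ G.p) (h𝔞 : G.IsMaximalAbelian 𝔞) {H₀ : 𝔞}
    (hH₀ : IsChamberElement 𝔞 H₀) (k : G.K) (v : G.p) (T : ℝ) :
    ∃ A : ℝ, ∀ t ∈ Set.Icc 0 T, ∀ u, ‖piTFactor χ H₀ t (k, v) u‖ ≤ A := by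
  have h := (continuous_dual (rho 𝔞 H₀ 1)).comp (continuous_iwasawaProj_phi h𝔞 hH₀ k v).snd
  obtain ⟨A, hA⟩ := ((isCompact_Icc (a := (0 : ℝ)) (b := T)).prod
    (isCompact_univ (X := G.K))).exists_bound_of_continuousOn (Real.continuous_exp.comp h.neg).continuousOn
  refine ⟨A, fun t ht u => ?_⟩
  rw [norm_piTFactor]
  exact (le_abs_self _).trans (hA (t, u) ⟨ht, trivial⟩)

theorem norm_piZero (x : G.K × G.p) (f : G.K → V) (u : G.K) : ‖δ.piZero x f u‖ = ‖f (x.1⁻¹ * u)‖ := by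
  rw [MackeyParameter.piZero, norm_smul, norm_exp_I_mul, one_mul]

end Continuity

section Equivariance

theorem coAd_mul_stab {χ : Module.Dual ℝ G.p} (u : G.K) (m : G.stab χ) :
    G.coAd (u * (m : G.K)) χ = G.coAd u χ := by
  have hm : χ ∘ₗ G.Ad (m : G.K)⁻¹ = χ := m.2
  change χ ∘ₗ G.Ad (u * (m : G.K))⁻¹ = χ ∘ₗ G.Ad u⁻¹
  rw [mul_inv_rev, Ad_mul, ← LinearMap.comp_assoc, hm]

theorem piTFactor_mul_M (χ : Module.Dual ℝ G.p) (h𝔞 : G.IsMaximalAbelian 𝔞) {H₀ : 𝔞}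
    (hH₀ : IsChamberElement 𝔞 H₀) (t : ℝ) (x : G.K × G.p) {m : G.K} (hm : m ∈ M 𝔞) (u : G.K) :
    piTFactor χ H₀ t x (u * m) = piTFactor χ H₀ t x u := by
  rw [piTFactor, Subgroup.coe_mul, ← mul_assoc, iwasawaProj_mul_M h𝔞 hH₀ hm (phi_inv_mul_mem t x u), piTFactor]

theorem piTMap_mul_M (h𝔞 : G.IsMaximalAbelian 𝔞) {H₀ : 𝔞}
    (hH₀ : IsChamberElement 𝔞 H₀) (t : ℝ) (x : G.K × G.p) {m : G.K} (hm : m ∈ M 𝔞) (u : G.K) :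
    piTMap H₀ t x (u * m) = piTMap H₀ t x u * m := by
  rw [piTMap, Subgroup.coe_mul, ← mul_assoc, iwasawaProj_mul_M h𝔞 hH₀ hm (phi_inv_mul_mem t x u), piTMap]

end Equivariance

section Measure

variable [MeasurableSpace G.K] [BorelSpace G.K] (ν : Measure G.K) [ν.IsHaarMeasure]

theorem exists_map_piTMap_le_smul (h𝔞 : G.IsMaximalAbelian 𝔞) {H₀ : 𝔞} (hH₀ : IsChamberElement 𝔞 H₀)
    (k : G.K) (v : G.p) (T : ℝ) :
    ∃ c : ENNReal, c ≠ ⊤ ∧ ∀ t ∈ Set.Icc 0 T, ν.map (piTMap H₀ t (k, v)) ≤ c • ν := by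
  obtain ⟨c, hc, h⟩ := exists_map_iwasawaProj_le_smul h𝔞 hH₀ ν
    ((isCompact_Icc (a := (0 : ℝ)) (b := T)).image (continuous_phi k v).inv)
    (by rintro _ ⟨t, -, rfl⟩; exact G.toSubgroup.inv_mem (G.phi_mem t (k, v)))
  exact ⟨c, hc, fun t ht => h _ ⟨t, ht, rfl⟩⟩

theorem quasiMeasurePreserving_piTMap (h𝔞 : G.IsMaximalAbelian 𝔞) {H₀ : 𝔞} (hH₀ : IsChamberElement 𝔞 H₀)
    {t : ℝ} (ht : 0 < t) (k : G.K) (v : G.p) : Measure.QuasiMeasurePreserving (piTMap H₀ t (k, v)) ν ν := by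
  obtain ⟨c, -, h⟩ := exists_map_piTMap_le_smul ν h𝔞 hH₀ k v t
  exact ⟨(continuous_piTMap h𝔞 hH₀ t k v).measurable,
    Measure.absolutelyContinuous_of_le_smul (h t ⟨ht.le, le_rfl⟩)⟩

theorem aestronglyMeasurable_piT (h𝔞 : G.IsMaximalAbelian 𝔞) {H₀ : 𝔞} (hH₀ : IsChamberElement 𝔞 H₀)
    {t : ℝ} (ht : 0 < t) (k : G.K) (v : G.p) {f : G.K → V} (hf : AEStronglyMeasurable f ν) :
    AEStronglyMeasurable (δ.piT 𝔞 H₀ t (k, v) f) ν := by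
  rw [piT_eq δ h𝔞 hH₀ ht]
  exact (continuous_piTFactor δ.χ h𝔞 hH₀ t k v).aestronglyMeasurable.smul
    (hf.comp_quasiMeasurePreserving (quasiMeasurePreserving_piTMap ν h𝔞 hH₀ ht k v))

/-- The operators of the principal series are bounded on `L²`, uniformly for `t` in a bounded interval. -/
theorem exists_eLpNorm_piT_le (h𝔞 : G.IsMaximalAbelian 𝔞) {H₀ : 𝔞} (hH₀ : IsChamberElement 𝔞 H₀)
    (k : G.K) (v : G.p) (T : ℝ) :
    ∃ C : ENNReal, C ≠ ⊤ ∧ ∀ t, 0 < t → t ≤ T → ∀ f : G.K → V, AEStronglyMeasurable f ν →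
      eLpNorm (δ.piT 𝔞 H₀ t (k, v) f) 2 ν ≤ C * eLpNorm f 2 ν := by
  obtain ⟨c, hc, h⟩ := exists_map_piTMap_le_smul ν h𝔞 hH₀ k v T
  obtain ⟨A, hA⟩ := exists_norm_piTFactor_le δ.χ h𝔞 hH₀ k v T
  refine ⟨ENNReal.ofReal A * c ^ (1 / 2 : ENNReal).toReal, ENNReal.mul_ne_top ENNReal.ofReal_ne_top
    (ENNReal.rpow_ne_top_of_nonneg ENNReal.toReal_nonneg hc), fun t ht htT f hf => ?_⟩
  rw [piT_eq δ h𝔞 hH₀ ht, mul_assoc]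
  refine (eLpNorm_le_mul_eLpNorm_of_ae_le_mul (g := f ∘ piTMap H₀ t (k, v)) (c := A)
    (Eventually.of_forall fun u => ?_) 2).trans ?_
  · rw [norm_smul]
    exact mul_le_mul_of_nonneg_right (hA t ⟨ht.le, htT⟩ u) (norm_nonneg _)
  · gcongr
    exact eLpNorm_comp_le_of_map_le_smul (continuous_piTMap h𝔞 hH₀ t k v).measurable (h t ⟨ht.le, htT⟩) hf

theorem memLp_piT (h𝔞 : G.IsMaximalAbelian 𝔞) {H₀ : 𝔞} (hH₀ : IsChamberElement 𝔞 H₀)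
    {t : ℝ} (ht : 0 < t) (k : G.K) (v : G.p) {f : G.K → V} (hf : MemLp f 2 ν) :
    MemLp (δ.piT 𝔞 H₀ t (k, v) f) 2 ν := by
  obtain ⟨C, hC, h⟩ := exists_eLpNorm_piT_le δ ν h𝔞 hH₀ k v t
  exact ⟨aestronglyMeasurable_piT δ ν h𝔞 hH₀ ht k v hf.1,
    (h t ht le_rfl f hf.1).trans_lt (ENNReal.mul_lt_top hC.lt_top hf.2)⟩

theorem piT_congr_ae (h𝔞 : G.IsMaximalAbelian 𝔞) {H₀ : 𝔞} (hH₀ : IsChamberElement 𝔞 H₀)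
    {t : ℝ} (ht : 0 < t) (k : G.K) (v : G.p) {f g : G.K → V} (h : f =ᵐ[ν] g) :
    δ.piT 𝔞 H₀ t (k, v) f =ᵐ[ν] δ.piT 𝔞 H₀ t (k, v) g := by
  rw [piT_eq δ h𝔞 hH₀ ht, piT_eq δ h𝔞 hH₀ ht]
  filter_upwards [(quasiMeasurePreserving_piTMap ν h𝔞 hH₀ ht k v).ae h] with u hu
  rw [hu]

theorem inE_piT (h𝔞 : G.IsMaximalAbelian 𝔞) {H₀ : 𝔞} (hH₀ : IsChamberElement 𝔞 H₀)
    {t : ℝ} (ht : 0 < t) (k : G.K) (v : G.p) {f : G.K → V} (hf : δ.InE 𝔞 ν f) :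
    δ.InE 𝔞 ν (δ.piT 𝔞 H₀ t (k, v) f) := by
  refine ⟨memLp_piT δ ν h𝔞 hH₀ ht k v hf.1, fun m hm => ?_⟩
  rw [piT_eq δ h𝔞 hH₀ ht]
  filter_upwards [(quasiMeasurePreserving_piTMap ν h𝔞 hH₀ ht k v).ae (hf.2 m hm)] with u hu
  rw [piTFactor_mul_M δ.χ h𝔞 hH₀ t (k, v) hm, piTMap_mul_M h𝔞 hH₀ t (k, v) hm, hu, map_smul]

theorem piZero_congr_ae (k : G.K) (v : G.p) {f g : G.K → V} (h : f =ᵐ[ν] g) :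
    δ.piZero (k, v) f =ᵐ[ν] δ.piZero (k, v) g := by
  filter_upwards [(measurePreserving_mul_left ν k⁻¹).quasiMeasurePreserving.ae h] with u hu
  rw [MackeyParameter.piZero, MackeyParameter.piZero, hu]

theorem aestronglyMeasurable_piZero (k : G.K) (v : G.p) {f : G.K → V} (hf : AEStronglyMeasurable f ν) :
    AEStronglyMeasurable (δ.piZero (k, v) f) ν :=
  (continuous_exp_coAd δ.χ v).aestronglyMeasurable.smul
    (hf.comp_measurePreserving (measurePreserving_mul_left ν k⁻¹))

theorem eLpNorm_piZero (k : G.K) (v : G.p) {f : G.K → V} (hf : AEStronglyMeasurable f ν) :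
    eLpNorm (δ.piZero (k, v) f) 2 ν = eLpNorm f 2 ν := by
  rw [← eLpNorm_comp_measurePreserving hf (measurePreserving_mul_left ν k⁻¹)]
  exact eLpNorm_congr_norm_ae (Eventually.of_forall fun u => norm_piZero δ (k, v) f u)

theorem memLp_piZero (k : G.K) (v : G.p) {f : G.K → V} (hf : MemLp f 2 ν) : MemLp (δ.piZero (k, v) f) 2 ν :=
  ⟨aestronglyMeasurable_piZero δ ν k v hf.1, (eLpNorm_piZero δ ν k v hf.1).trans_lt hf.2⟩

theorem piZero_mul_stab (k : G.K) (v : G.p) {f : G.K → V} {m : G.stab δ.χ}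
    (hf : ∀ᵐ u ∂ν, f (u * (m : G.K)) = δ.μ m⁻¹ (f u)) :
    ∀ᵐ u ∂ν, δ.piZero (k, v) f (u * (m : G.K)) = δ.μ m⁻¹ (δ.piZero (k, v) f u) := by
  filter_upwards [(measurePreserving_mul_left ν k⁻¹).quasiMeasurePreserving.ae hf] with u hu
  rw [MackeyParameter.piZero, MackeyParameter.piZero, coAd_mul_stab, ← mul_assoc, hu, map_smul]

/-- The operators of the principal series converge strongly to those of the representation of the motion
group. -/
theorem tendsto_eLpNorm_piT_sub (h𝔞 : G.IsMaximalAbelian 𝔞) {H₀ : 𝔞} (hH₀ : IsChamberElement 𝔞 H₀)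
    (hχ : IsRegular 𝔞 δ.χ) (k : G.K) (v : G.p) {f : G.K → V} (hf : MemLp f 2 ν) :
    Tendsto (fun t : ℝ => eLpNorm (δ.piT 𝔞 H₀ t (k, v) f - δ.piZero (k, v) f) 2 ν) (𝓝[>] 0) (𝓝 0) := by
  obtain ⟨C, hC, hbd⟩ := exists_eLpNorm_piT_le δ ν h𝔞 hH₀ k v 1
  rw [ENNReal.tendsto_nhds_zero]
  intro ε hε
  have h1 : Tendsto (fun η : ENNReal => C * η + η + η) (𝓝[>] 0) (𝓝 0) := by
    have h2 : Tendsto (fun η : ENNReal => η) (𝓝[>] 0) (𝓝 0) := nhdsWithin_le_nhds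
    have := ((ENNReal.Tendsto.const_mul h2 (Or.inr hC)).add h2).add h2
    rwa [mul_zero, add_zero, add_zero] at this
  obtain ⟨η, hη, hη0⟩ := ((h1.eventually (gt_mem_nhds hε)).and self_mem_nhdsWithin).exists
  -- After approximation by a continuous `g`, the three terms `π_t(f - g)`, `π_t g - π₀ g` and `π₀(f
  -- - g)` have norms at most `C η`, `η` and `η`. No equivariance of `g` is needed, since uniform
  -- convergence holds for every continuous function.
  obtain ⟨g, hg, hgL⟩ := hf.exists_boundedContinuous_eLpNorm_sub_le ENNReal.ofNat_ne_top hη0.ne'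
  have hunif := tendsto_eLpNorm_of_tendstoUniformly ν
    (tendstoUniformly_piT δ h𝔞 hH₀ hχ k v g.continuous)
  filter_upwards [(ENNReal.tendsto_nhds_zero.1 hunif) η hη0, self_mem_nhdsWithin,
    nhdsWithin_le_nhds (Iic_mem_nhds zero_lt_one)] with t ht ht0 ht1
  have hm := (hf.sub hgL).1
  have e : δ.piT 𝔞 H₀ t (k, v) f - δ.piZero (k, v) f =
      δ.piT 𝔞 H₀ t (k, v) (f - g) + (δ.piT 𝔞 H₀ t (k, v) g - δ.piZero (k, v) g) - δ.piZero (k, v) (f - g) := by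
    funext u
    simp only [MackeyParameter.piT, MackeyParameter.piZero, Pi.sub_apply, Pi.add_apply, smul_sub]
    abel
  have m1 := aestronglyMeasurable_piT δ ν h𝔞 hH₀ ht0 k v hm
  have m2 := (aestronglyMeasurable_piT δ ν h𝔞 hH₀ ht0 k v hgL.1).sub (aestronglyMeasurable_piZero δ ν k v hgL.1)
  have m3 := aestronglyMeasurable_piZero δ ν k v hm
  rw [e]
  refine le_trans ?_ hη.le
  refine (eLpNorm_sub_le (m1.add m2) m3 (by norm_num)).trans (add_le_add ((eLpNorm_add_le m1 m2 (by norm_num)).trans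
    (add_le_add ?_ ht)) ?_)
  · exact (hbd t ht0 ht1 _ hm).trans (by gcongr)
  · rw [eLpNorm_piZero δ ν k v hm]
    exact hg

end Measure

end LinearReductiveGroup

theorem proposition3p12 {n : ℕ} (G : LinearReductiveGroup n)
    {V : Type*} [NormedAddCommGroup V] [InnerProductSpace ℂ V] [FiniteDimensional ℂ V]
    (δ : G.MackeyParameter V)
    (𝔞 : Submodule ℝ G.p) (h𝔞 : G.IsMaximalAbelian 𝔞)
    (hχ : LinearReductiveGroup.IsRegular 𝔞 δ.χ)
    (H₀ : 𝔞) (hH₀ : LinearReductiveGroup.IsChamberElement 𝔞 H₀)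
    [MeasurableSpace G.K] [BorelSpace G.K] (ν : Measure G.K) [ν.IsHaarMeasure]
    (k : G.K) (v : G.p) :
    -- the operators are well defined on classes of functions modulo equality a.e.,
    -- and are endomorphisms of the carrier spaces
    (∀ f g : G.K → V, f =ᵐ[ν] g →
      (∀ t : ℝ, 0 < t → δ.piT 𝔞 H₀ t (k, v) f =ᵐ[ν] δ.piT 𝔞 H₀ t (k, v) g) ∧
      δ.piZero (k, v) f =ᵐ[ν] δ.piZero (k, v) g) ∧
    (∀ f : G.K → V, δ.InE 𝔞 ν f →
      (∀ t : ℝ, 0 < t → δ.InE 𝔞 ν (δ.piT 𝔞 H₀ t (k, v) f)) ∧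
      δ.InE 𝔞 ν (δ.piZero (k, v) f)) ∧
    (∀ f : G.K → V, δ.InH ν f → δ.InH ν (δ.piZero (k, v) f)) ∧
    -- convergence in `L²(K, V)`
    (∀ f : G.K → V, δ.InE 𝔞 ν f →
      Tendsto (fun t : ℝ => eLpNorm (δ.piT 𝔞 H₀ t (k, v) f - δ.piZero (k, v) f) 2 ν)
        (𝓝[>] 0) (𝓝 0)) ∧
    -- uniform convergence in `C(K, V)`
    (∀ f : G.K → V, δ.InE 𝔞 ν f → Continuous f →
      (∀ t : ℝ, 0 < t → Continuous (δ.piT 𝔞 H₀ t (k, v) f)) ∧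
      Continuous (δ.piZero (k, v) f) ∧
      TendstoUniformly (fun t : ℝ => δ.piT 𝔞 H₀ t (k, v) f) (δ.piZero (k, v) f)
        (𝓝[>] 0)) := by

  refine ⟨fun f g h => ⟨fun t ht => ?_, ?_⟩, fun f hf => ⟨fun t ht => ?_, ?_, fun m hm => ?_⟩,
    fun f hf => ⟨?_, fun m => ?_⟩, fun f hf => ?_, fun f _ hc => ⟨fun t ht => ?_, ?_, ?_⟩⟩
  · exact LinearReductiveGroup.piT_congr_ae δ ν h𝔞 hH₀ ht k v h
  · exact LinearReductiveGroup.piZero_congr_ae δ ν k v h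
  · exact LinearReductiveGroup.inE_piT δ ν h𝔞 hH₀ ht k v hf
  · exact LinearReductiveGroup.memLp_piZero δ ν k v hf.1
  · exact LinearReductiveGroup.piZero_mul_stab δ ν k v (hf.2 m hm)
  · exact LinearReductiveGroup.memLp_piZero δ ν k v hf.1
  · exact LinearReductiveGroup.piZero_mul_stab δ ν k v (hf.2 m)
  · exact LinearReductiveGroup.tendsto_eLpNorm_piT_sub δ ν h𝔞 hH₀ hχ k v hf.1
  · exact LinearReductiveGroup.continuous_piT δ h𝔞 hH₀ ht k v hc
  · exact LinearReductiveGroup.continuous_piZero δ k v hc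
  · exact LinearReductiveGroup.tendstoUniformly_piT δ h𝔞 hH₀ hχ k v hc
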